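/- **Setting.** An $H$-field is an ordered differential field $K$ which satisfies $\mathcal O=C+\mathfrak{o}$, and $a'>0$ for every $a\in K$ with $a>C$; here $C=\{a\in K: a'=0\}$, $\mathcal O=\{a: |a|\le c\text{ for some }c\in C^{>0}\}$ and $\mathfrak{o}=\{a: |a|<c\text{ for all }c\in C^{>0}\}$. Write $f\preceq g$ if $|f|\le c|g|$ for some $c\in C^{>0}$, and put $\operatorname{I}(K)=\{y\in K: y\preceq f'\text{ for some }f\in\mathfrak{o}\}$. The $H$-field $K$ *admits small integration* if $\{a':a\in\mathfrak{o}\}=\operatorname{I}(K)$. In that case define $\int\colon K\to K$ by $\int a'=a$ for $a\in\mathfrak{o}$, and $\int b=0$ if $b$ is not the derivative of an element of $\mathfrak{o}$. Let $\mathcal L=\{0,1,+,-,\cdot,\partial,\le,\preceq\}$. Let $\mathcal L'$ extend $\mathcal L$ by an $n$-ary function symbol for every $n$ and every $\mathbb Q$-semialgebraic function $f\colon\mathbb R^n\to\mathbb R$ (that is, the graph of $f$ is defined in $\mathbb R$ by a quantifier-free formula, without parameters, in the language of ordered rings). In a real closed $H$-field $K$ this symbol names the function $K^n\to K$ whose graph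 is defined in $K$ by the same formula. Let $\mathcal L'_{\operatorname I}$ extend $\mathcal L'$ by a unary predicate symbol for $\operatorname I(K)$, and let $\mathcal L^*$ extend $\mathcal L'_{\operatorname I}$ by a unary function symbol for $\int$. Let $T^*$ be the $\mathcal L^*$-theory of real closed $H$-fields admitting small integration. **Proposition.** The theory $T^*$ has closures of $\mathcal L'_{\operatorname I}$-substructures: for all models $A,B$ of $T^*$ and every common $\mathcal L'_{\operatorname I}$-substructure $C$ of (the $\mathcal L'_{\operatorname I}$-reducts of) $A$ and $B$, there is an isomorphism from the $\mathcal L^*$-substructure of $A$ generated by $C$ onto the $\mathcal L^*$-substructure of $B$ generated by $C$ which is the identity on $C$. Moreover, for every $n$, every quantifier-free $\mathcal L^*$-formula $\varphi(x_1,\dots,x_n)$ is $T^*$-equivalent to some quantifier-free $\mathcal L'_{\operatorname I}$-formula $\psi(x_1,\dots,x_n)$. -/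

import Mathlib

universe u

noncomputable section

open FirstOrder FirstOrder.Language
open scoped Differential

namespace HFields

/-! ### H-fields

`K` is an ordered differential field: an ordered field (hence of characteristic zero) with a
derivation `a ↦ a′`. -/

section OrderedDifferentialField

variable (K : Type*) [Field K] [LinearOrder K] [Differential K]

/-- The constant field `C` of `K`, as a set. -/
def constants : Set K := {a | a′ = 0}

/-- The convex hull `𝒪` of `C` in `K`. -/
def bigO : Set K := {a | ∃ c ∈ constants K, 0 < c ∧ |a| ≤ c}

/-- The set `o` of infinitesimals (the maximal ideal of `𝒪`). -/
def smallO : Set K := {a | ∀ c ∈ constants K, 0 < c → |a| < c}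

/-- `K` is an H-field: `𝒪 = C + o`, and `a′ > 0` whenever `a > C`. -/
structure IsHField : Prop where
  mem_bigO_iff : ∀ a : K, a ∈ bigO K ↔ ∃ c ∈ constants K, ∃ e ∈ smallO K, a = c + e
  deriv_pos : ∀ a : K, (∀ c ∈ constants K, c < a) → 0 < a′

variable {K} in
/-- The valuation divisibility `f ≼ g` of an H-field: `|f| ≤ c |g|` for some constant `c > 0`. -/
def Dominated (f g : K) : Prop := ∃ c ∈ constants K, 0 < c ∧ |f| ≤ c * |g|

/-- `I(K)`: the elements `y` with `y ≼ f′` for some infinitesimal `f`. -/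
def setI : Set K := {y | ∃ f ∈ smallO K, Dominated y f′}

/-- `K` admits small integration: the derivatives of the infinitesimals are exactly the elements
of `I(K)`. -/
def AdmitsSmallIntegration : Prop := {y : K | ∃ a ∈ smallO K, a′ = y} = setI K

open Classical in
variable {K} in
/-- Small integration: `∫ a′ = a` for infinitesimal `a`, and `∫ b = 0` if `b` is not the
derivative of an infinitesimal. (In an H-field `a` is determined by `a′`, because `0` is the only
infinitesimal constant.) -/
def smallInt (b : K) : K := if h : ∃ a ∈ smallO K, a′ = b then h.choose else 0

end OrderedDifferentialField

/-! ### The languages -/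

/-- The language of ordered rings `{0, 1, +, -, ·, ≤}`. -/
abbrev langOR : FirstOrder.Language.{0, 0} := FirstOrder.Language.ring.sum FirstOrder.Language.order

/-- Every ordered field is a structure for the language of ordered rings in the usual way. -/
instance structureOR (K : Type*) [Field K] [LinearOrder K] : langOR.Structure K :=
  letI : Ring.CompatibleRing K := Ring.compatibleRingOfRing K
  letI : FirstOrder.Language.order.Structure K := orderStructure K
  sumStructure FirstOrder.Language.ring FirstOrder.Language.order K

/-- The quantifier-free formula `φ(x₀, …, xₙ₋₁, xₙ)` in the language of ordered rings defines the
graph of `f : ℝⁿ → ℝ` in `ℝ`. -/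
def DefinesGraph {n : ℕ} (f : (Fin n → ℝ) → ℝ) (φ : langOR.Formula (Fin (n + 1))) : Prop :=
  φ.IsQF ∧ ∀ (x : Fin n → ℝ) (y : ℝ), φ.Realize (Fin.snoc x y : Fin (n + 1) → ℝ) ↔ y = f x

/-- The `ℚ`-semialgebraic functions `ℝⁿ → ℝ`. -/
def SemialgFun (n : ℕ) : Type :=
  {f : (Fin n → ℝ) → ℝ // ∃ φ : langOR.Formula (Fin (n + 1)), DefinesGraph f φ}

/-- A quantifier-free formula that defines the graph of `f` in `ℝ`. -/
def SemialgFun.graph {n : ℕ} (f : SemialgFun n) : langOR.Formula (Fin (n + 1)) := f.2.choose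

open Classical in
/-- The interpretation of a `ℚ`-semialgebraic function `f` in `K`, for real closed `K`: the
function `Kⁿ → K` whose graph is defined in `K` by a formula that defines the graph of `f` in `ℝ`.
(All real closed fields have the same theory in the language of ordered rings. So such a formula
does define the graph of a function on `K`, and this function does not depend on the formula.) -/
def SemialgFun.interp {n : ℕ} (f : SemialgFun n) (K : Type*) [Field K] [LinearOrder K]
    (x : Fin n → K) : K :=
  if h : ∃ y : K, f.graph.Realize (Fin.snoc x y : Fin (n + 1) → K) then h.choose else 0

/-- A unary symbol. -/
inductive UnarySymbol : ℕ → Type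
  | sym : UnarySymbol 1

/-- A binary symbol. -/
inductive BinarySymbol : ℕ → Type
  | sym : BinarySymbol 2

/-- The symbols `∂` (unary function) and `≼` (binary relation). -/
def langDerDom : FirstOrder.Language.{0, 0} := ⟨UnarySymbol, BinarySymbol⟩

/-- One `n`-ary function symbol for every `ℚ`-semialgebraic function `ℝⁿ → ℝ`. -/
def langSemialg : FirstOrder.Language.{0, 0} := ⟨SemialgFun, fun _ => Empty⟩

/-- The unary predicate symbol `I`. -/
def langPredI : FirstOrder.Language.{0, 0} := ⟨fun _ => Empty, UnarySymbol⟩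

/-- The unary function symbol `∫`. -/
def langInt : FirstOrder.Language.{0, 0} := ⟨UnarySymbol, fun _ => Empty⟩

/-- `ℒ = {0, 1, +, -, ·, ∂, ≤, ≼}`, the language of ordered valued differential rings. -/
abbrev langL : FirstOrder.Language.{0, 0} := langOR.sum langDerDom

/-- `ℒ′`: the language `ℒ` with function symbols for the `ℚ`-semialgebraic functions. -/
abbrev langLprime : FirstOrder.Language.{0, 0} := langL.sum langSemialg

/-- `ℒ′_I`: the language `ℒ′` with the predicate symbol `I`. -/
abbrev langLprimeI : FirstOrder.Language.{0, 0} := langLprime.sum langPredI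

/-- `ℒ*`: the language `ℒ′_I` with the function symbol `∫`. -/
abbrev langLstar : FirstOrder.Language.{0, 0} := langLprimeI.sum langInt

/-- `ℒ′_I` as a sublanguage of `ℒ*`. -/
abbrev inclLprimeI : langLprimeI →ᴸ langLstar := LHom.sumInl

/-! ### The natural interpretation of the symbols -/

section Interpretation

variable (K : Type*) [Field K] [LinearOrder K] [Differential K]

instance structureDerDom : langDerDom.Structure K where
  funMap := fun f => match f with
    | UnarySymbol.sym => fun x => Differential.deriv (x 0)
  RelMap := fun r => match r with
    | BinarySymbol.sym => fun x => Dominated (x 0) (x 1)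

instance structurePredI : langPredI.Structure K where
  funMap := fun f => nomatch f
  RelMap := fun r => match r with
    | UnarySymbol.sym => fun x => x 0 ∈ setI K

instance structureInt : langInt.Structure K where
  funMap := fun f => match f with
    | UnarySymbol.sym => fun x => smallInt (x 0)
  RelMap := fun r => nomatch r

end Interpretation

instance structureSemialg (K : Type*) [Field K] [LinearOrder K] : langSemialg.Structure K where
  funMap := fun f x => SemialgFun.interp f K x
  RelMap := fun r => nomatch r

/-- Real closed H-fields admitting small integration as `ℒ*`-structures. -/
instance structureLstar (K : Type*) [Field K] [LinearOrder K] [Differential K] :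
    langLstar.Structure K :=
  inferInstance

/-- `T*`: the `ℒ*`-theory of real closed H-fields admitting small integration, that is, the set of
all `ℒ*`-sentences that are true in all of them. -/
def theoryTstar : langLstar.Theory :=
  {σ | ∀ (K : Type) [Field K] [LinearOrder K] [IsStrictOrderedRing K] [Differential K],
    IsRealClosed K → IsHField K → AdmitsSmallIntegration K → Sentence.Realize K σ}

/-! ### Closures of substructures -/

/-- The theory `T` in the language `M` has closures of `L`-substructures, for a sublanguage
`ι : L → M`: if `A, B ⊨ T` have a common `L`-substructure `C` (with inclusions `i` and `j`), then
there is an isomorphism from the `M`-substructure of `A` generated by `C` onto the `M`-substructure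
of `B` generated by `C` which is the identity on `C`. -/
def HasClosures.{w, u₁, v₁, u₂, v₂} {L : FirstOrder.Language.{u₁, v₁}} {M : FirstOrder.Language.{u₂, v₂}}
    (ι : L →ᴸ M) (T : M.Theory) : Prop :=
  ∀ (A B C : Type w) [M.Structure A] [M.Structure B] [L.Structure C] [A ⊨ T] [B ⊨ T],
    letI : L.Structure A := ι.reduct A
    letI : L.Structure B := ι.reduct B
    ∀ (i : C ↪[L] A) (j : C ↪[L] B),
      ∃ e : Substructure.closure M (Set.range i) ≃[M] Substructure.closure M (Set.range j),
        ∀ c : C, e ⟨i c, Substructure.subset_closure (Set.mem_range_self c)⟩ =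
          ⟨j c, Substructure.subset_closure (Set.mem_range_self c)⟩

end HFields

end

set_option linter.unusedSectionVars false

/-! ## Real closed fields -/

noncomputable section

open Polynomial
open scoped IntermediateField

namespace RealClosed

/-! ### Factorization, intermediate values and Rolle's theorem over real closed fields. -/

section FundamentalTheorem

variable {K : Type*} [Field K] [LinearOrder K] [IsStrictOrderedRing K] [IsRealClosed K]

/-! Both claims come from one extension result, `exists_isIsoGraph`: a correspondence between parts
of two models `K`, `K'` that is closed under the functions of `ℒ′_I` and respects its relations
extends to the graph of an isomorphism of `ℒ*`-substructures. Isomorphisms between subfields are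
represented by their graphs, which are subrings of `K × K'`. A graph is `IsGood` if its two sides
are real closed differential subfields and it respects ordering, valuation and `I`. Closure under
semialgebraic functions makes the initial graph good. Zorn's lemma gives a maximal good graph, and
`IsGood.exists_extension` shows that it is closed under `∫`.

Let `E` be the common field of a good graph, and let `y`, `z` be infinitesimals of `K`, `K'` with
the same derivative in `E`. An infinitesimal is positive exactly when its derivative is negative, so
`y` and `z` fill the same cut over `E` (`IsCommonSubfield.lt_iff`). Polynomials over the real closed
field `E` split into linear factors and sums of two squares, so the cut determines all signs on
`E[y]`. The valuation is written multiplicatively: `val K a < 1` means that `a` is infinitesimal.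
Sizes of infinitesimals are compared through their derivatives, which leaves two cases. If no
infinitesimal of `E` approximates `y` best, then adjoining `y` adds no new values. If `b` is a best
approximation, then the value of `y - b` is new, and by the key lemma `IsHField.val_lt_of_val_ne`
all infinitesimals of `E` are smaller than `y - b`. In the first case an element has the same value
as one of `E`, which settles membership in `I`. In the second case, with `q = y - b`, the set `I`
consists of the elements strictly dominated by the logarithmic derivative of `q`
(`IsHField.mem_setI_iff_lt`). Passing to the real closure is harmless: ordering, valuation and
derivation all extend uniquely to algebraic elements.

For the quantifier-free claim, compactness reduces the matter to two tuples with the same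
quantifier-free `ℒ′_I`-type. The values of the `ℒ′_I`-terms at them form a correspondence to which
the extension result applies.

Semialgebraic functions on a real closed field make sense only through Tarski's transfer from `ℝ`,
so quantifier elimination for real closed fields is proved on the way, from uniqueness of real
closures. The models of the theory `T*` are then identified with the intended H-fields by explicit
axioms. -/

theorem finrank_eq_one_of_odd {M : Type*} [Field M] [Algebra K M] [FiniteDimensional K M]
    (h : Odd (Module.finrank K M)) : Module.finrank K M = 1 := by
  obtain ⟨α, hα⟩ := Field.exists_primitive_element K M
  have hint : IsIntegral K α := Algebra.IsIntegral.isIntegral α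
  have hdeg : (minpoly K α).natDegree = Module.finrank K M := by
    rw [← IntermediateField.adjoin.finrank hint, hα, IntermediateField.finrank_top']
  obtain ⟨x, hx⟩ := IsRealClosed.exists_isRoot_of_odd_natDegree (f := minpoly K α) (hdeg ▸ h)
  have := Polynomial.degree_eq_one_of_irreducible_of_root (minpoly.irreducible hint) hx
  rw [← hdeg]
  exact natDegree_eq_of_degree_eq_some this

variable {L : Type*} [Field L] [Algebra K L]

theorem mem_adjoin_I {i : L} (hi : i * i = -1) {x : L} (hx : x ∈ K⟮i⟯) :
    ∃ a b : K, x = algebraMap K L a + algebraMap K L b * i := by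
  have hint : IsAlgebraic K i := by
    refine ⟨X ^ 2 + 1, ?_, ?_⟩
    · exact (by monicity! : (X ^ 2 + 1 : K[X]).Monic).ne_zero
    · simp [sq, hi]
  rw [← IntermediateField.mem_toSubalgebra,
    IntermediateField.adjoin_simple_toSubalgebra_of_isAlgebraic hint,
    Algebra.adjoin_singleton_eq_range_aeval] at hx
  obtain ⟨p, rfl⟩ := hx
  induction p using Polynomial.induction_on' with
  | add p q hp hq =>
    obtain ⟨a, b, h⟩ := hp
    obtain ⟨c, d, h'⟩ := hq
    refine ⟨a + c, b + d, ?_⟩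
    rw [map_add, h, h', map_add, map_add]
    ring
  | monomial n c =>
    induction n with
    | zero => exact ⟨c, 0, by simp⟩
    | succ n ih =>
      obtain ⟨a, b, h⟩ := ih
      change aeval i (monomial n c) = _ at h
      refine ⟨-b, a, ?_⟩
      change aeval i (monomial (n + 1) c) = _
      rw [aeval_monomial] at h ⊢
      rw [pow_succ, ← mul_assoc, h, map_neg, add_mul, mul_assoc, hi]
      ring

/-- The complex square root formula: with `r` the modulus of `a + bi`, the parts of the root are
square roots of `(r + a)/2` and `(r - a)/2`, with signs chosen so that `2cd = b`. -/
theorem exists_sq_eq_of_mem_adjoin_I {i : L} (hi : i * i = -1) {x : L} (hx : x ∈ K⟮i⟯) :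
    ∃ s ∈ K⟮i⟯, s * s = x := by
  obtain ⟨a, b, rfl⟩ := mem_adjoin_I hi hx
  have hiF : i ∈ K⟮i⟯ := IntermediateField.mem_adjoin_simple_self K i
  obtain ⟨r, hr⟩ := IsRealClosed.nonneg_iff_isSquare.1
    (add_nonneg (mul_self_nonneg a) (mul_self_nonneg b))
  wlog hr0 : 0 ≤ r generalizing r
  · exact this (-r) (by linear_combination hr) (by linarith)
  have hra : |a| ≤ r := abs_le_of_sq_le_sq (by nlinarith [mul_self_nonneg b]) hr0
  have h1 : 0 ≤ (r + a) / 2 := by linarith [neg_abs_le a]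
  have h2 : 0 ≤ (r - a) / 2 := by linarith [le_abs_self a]
  obtain ⟨c, hc⟩ := IsRealClosed.nonneg_iff_isSquare.1 h1
  obtain ⟨d, hd⟩ := IsRealClosed.nonneg_iff_isSquare.1 h2
  have hcd : (2 * c * d) ^ 2 = b ^ 2 := by
    have : (2 * c * d) ^ 2 = 4 * (c * c) * (d * d) := by ring
    rw [this, ← hc, ← hd]
    linear_combination -hr
  have key : ∀ d' : K, d' * d' = d * d → 2 * c * d' = b →
      ∃ s ∈ K⟮i⟯, s * s = algebraMap K L a + algebraMap K L b * i := by
    intro d' hd' hb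
    refine ⟨algebraMap K L c + algebraMap K L d' * i,
      add_mem (algebraMap_mem _ _) (mul_mem (algebraMap_mem _ _) hiF), ?_⟩
    have ha : a = c * c - d' * d' := by rw [hd', ← hc, ← hd]; ring
    rw [ha, ← hb]
    simp only [map_sub, map_mul, map_ofNat]
    linear_combination (algebraMap K L d') ^ 2 * hi
  rcases sq_eq_sq_iff_eq_or_eq_neg.1 hcd with h | h
  · exact key d rfl h
  · exact key (-d) (by ring) (by linear_combination -h)

/-- Artin's argument. The fixed field of a Sylow 2-subgroup has odd degree over `K`, hence is `K`,
so `L` has 2-power degree. Were `L` larger than `K(i)`, a subgroup of index 2 would give a quadratic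
extension of `K(i)`, but every element of `K(i)` is a square there. -/
theorem adjoin_I_eq_top [FiniteDimensional K L] [IsGalois K L] {i : L} (hi : i * i = -1) :
    K⟮i⟯ = ⊤ := by
  have h2 : Fact (Nat.Prime 2) := ⟨Nat.prime_two⟩
  obtain ⟨k, m, hm, hk⟩ := Nat.exists_eq_two_pow_mul_odd (n := Nat.card Gal(L/K))
    Nat.card_pos.ne'
  obtain ⟨H, hH⟩ := Sylow.exists_subgroup_card_pow_prime (G := Gal(L/K)) 2 (n := k)
    (by rw [hk]; exact dvd_mul_right _ _)
  have hLK : Module.finrank K L = 2 ^ k := by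
    have e1 := IntermediateField.finrank_fixedField_eq_card H
    have e2 := Module.finrank_mul_finrank K (IntermediateField.fixedField H) L
    rw [e1, hH, ← IsGalois.card_aut_eq_finrank K L, hk, mul_comm] at e2
    have e3 := Nat.eq_of_mul_eq_mul_left (by positivity) e2
    have := finrank_eq_one_of_odd (K := K) (M := IntermediateField.fixedField H) (e3 ▸ hm)
    rw [← Module.finrank_mul_finrank K (IntermediateField.fixedField H) L, this, e1, hH, one_mul]
  set F := K⟮i⟯ with hF
  obtain ⟨j, -, hj⟩ := (Nat.dvd_prime_pow Nat.prime_two).1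
    (⟨_, (hLK ▸ Module.finrank_mul_finrank K F L).symm.trans (mul_comm _ _)⟩ :
      Module.finrank F L ∣ 2 ^ k)
  rcases j with _ | j
  · exact IntermediateField.finrank_eq_one_iff_eq_top.1 (by simpa using hj)
  exfalso
  obtain ⟨H', hH'⟩ := Sylow.exists_subgroup_card_pow_prime (G := Gal(L/F)) 2 (n := j)
    (by rw [IsGalois.card_aut_eq_finrank, hj]; exact pow_dvd_pow _ (Nat.le_succ _))
  have e1 := IntermediateField.finrank_fixedField_eq_card H'
  have e2 := Module.finrank_mul_finrank F (IntermediateField.fixedField H') L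
  rw [e1, hH', hj, pow_succ, mul_comm] at e2
  have e3 : Module.finrank F (IntermediateField.fixedField H') = 2 :=
    Nat.eq_of_mul_eq_mul_left (by positivity) e2
  have hne : IntermediateField.fixedField H' ≠ ⊥ := by
    intro h
    rw [IntermediateField.finrank_eq_one_iff.2 h] at e3
    omega
  obtain ⟨w, hw, hwF⟩ := SetLike.exists_of_lt (bot_lt_iff_ne_bot.2 hne)
  have hwint : IsIntegral F w := Algebra.IsIntegral.isIntegral w
  have hdeg : (minpoly F w).natDegree ≤ 2 := by
    have := minpoly.natDegree_le (A := F) (⟨w, hw⟩ : IntermediateField.fixedField H')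
    rw [e3, IntermediateField.minpoly_eq] at this
    exact this
  have hdeg1 : (minpoly F w).natDegree ≠ 1 := by
    intro h
    exact hwF (IntermediateField.mem_bot.2 (minpoly.natDegree_eq_one_iff.1 h))
  have hdeg2 : (minpoly F w).natDegree = 2 := by
    have := minpoly.natDegree_pos hwint
    omega
  have hev := minpoly.aeval F w
  rw [aeval_eq_sum_range, hdeg2] at hev
  have hlead : (minpoly F w).coeff 2 = 1 := by
    rw [← hdeg2]; exact minpoly.monic hwint
  simp only [Finset.sum_range_succ, Finset.range_zero, Finset.sum_empty, hlead, zero_add,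
    pow_zero, pow_one, Algebra.smul_def, mul_one, map_one, one_mul] at hev
  set p := (minpoly F w).coeff 1
  set q := (minpoly F w).coeff 0
  -- `s²` is a quarter of the discriminant of `X² + pX + q`, so `w` is `-p/2 ± s` and lies in
  -- `K(i)`.
  obtain ⟨s, hs, hss⟩ := exists_sq_eq_of_mem_adjoin_I hi (p * p / 4 - q : F).2
  have h0 : (w + algebraMap F L p / 2 - s) * (w + algebraMap F L p / 2 + s) = 0 := by
    have : CharZero L := charZero_of_injective_algebraMap (algebraMap K L).injective
    have e : s * s = algebraMap F L p * algebraMap F L p / 4 - algebraMap F L q := by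
      rw [hss]; simp; rfl
    linear_combination hev - e
  refine hwF (IntermediateField.mem_bot.2 ?_)
  rcases mul_eq_zero.1 h0 with h | h
  · refine ⟨⟨s, hs⟩ - p / 2, ?_⟩
    rw [map_sub, map_div₀, map_ofNat]
    change s - _ = w
    linear_combination -h
  · refine ⟨-⟨s, hs⟩ - p / 2, ?_⟩
    rw [map_sub, map_neg, map_div₀, map_ofNat]
    change -s - _ = w
    linear_combination -h

/-- Monic irreducible polynomials over a real closed field are linear or of the form
`(X - b)² + c²`. -/
theorem irreducible_cases {f : K[X]} (hf : Irreducible f) :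
    ∃ d : K, d ≠ 0 ∧ ((∃ a, f = C d * (X - C a)) ∨
      ∃ b c, c ≠ 0 ∧ f = C d * ((X - C b) ^ 2 + C c ^ 2)) := by
  have hlc : f.leadingCoeff ≠ 0 := leadingCoeff_ne_zero.2 hf.ne_zero
  by_cases hroot : ∃ a, f.IsRoot a
  · obtain ⟨a, ha⟩ := hroot
    obtain ⟨g, hg⟩ := dvd_iff_isRoot.2 ha
    rcases hf.isUnit_or_isUnit hg with h | h
    · exact absurd h (not_isUnit_X_sub_C a)
    · obtain ⟨d, hd, rfl⟩ := Polynomial.isUnit_iff.1 h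
      exact ⟨d, hd.ne_zero, .inl ⟨a, by rw [hg, mul_comm]⟩⟩
  -- The factor `X² + 1` puts a square root of `-1` into the splitting field.
  let g : K[X] := f * (X ^ 2 + 1)
  have hg : g ≠ 0 := mul_ne_zero hf.ne_zero (by monicity! : (X ^ 2 + 1 : K[X]).Monic).ne_zero
  let L := g.SplittingField
  have : CharZero L := charZero_of_injective_algebraMap (algebraMap K L).injective
  have : Normal K L := Normal.of_isSplittingField g
  have : IsGalois K L := ⟨⟩
  have hsp := SplittingField.splits g
  rw [show g = f * (X ^ 2 + 1) from rfl, Polynomial.map_mul] at hsp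
  have hne : (f.map (algebraMap K L)) * (X ^ 2 + 1 : K[X]).map (algebraMap K L) ≠ 0 := by
    rw [← Polynomial.map_mul]; exact (Polynomial.map_ne_zero hg)
  have hs1 := hsp.of_dvd hne (dvd_mul_right _ _)
  have hs2 := hsp.of_dvd hne (dvd_mul_left _ _)
  obtain ⟨i, hi⟩ := hs2.exists_eval_eq_zero (by
    rw [degree_map]; rw [show (X ^ 2 + 1 : K[X]).degree = 2 by compute_degree!]; simp)
  obtain ⟨z, hz⟩ := hs1.exists_eval_eq_zero (by
    rw [degree_map]; exact (degree_pos_of_irreducible hf).ne')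
  have hi' : i * i = -1 := by
    simp at hi; linear_combination hi
  obtain ⟨a, b, hab⟩ := mem_adjoin_I (K := K) (x := z) hi' (by
    rw [adjoin_I_eq_top hi']; trivial)
  rw [eval_map_algebraMap] at hz
  have hq : aeval z ((X - C a) ^ 2 + C b ^ 2 : K[X]) = 0 := by
    simp [hab]; linear_combination (algebraMap K L b) ^ 2 * hi'
  have hdvd : f ∣ ((X - C a) ^ 2 + C b ^ 2 : K[X]) := by
    have h1 := minpoly.dvd K z hq
    rw [← minpoly.eq_of_irreducible hf hz] at h1
    exact (dvd_mul_right _ _).trans h1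
  have hb : b ≠ 0 := by
    rintro rfl
    have : f ∣ (X - C a) ^ 2 := by simpa using hdvd
    have h2 := (hf.prime.dvd_of_dvd_pow this)
    exact hroot ⟨a, dvd_iff_isRoot.1 (hf.associated_of_dvd (irreducible_X_sub_C a) h2).symm.dvd⟩
  have hqdeg : ((X - C a) ^ 2 + C b ^ 2 : K[X]).natDegree = 2 := by
    rw [← C_pow, natDegree_add_C, natDegree_pow, natDegree_X_sub_C]
  have hqm : ((X - C a) ^ 2 + C b ^ 2 : K[X]).Monic := by
    rw [← C_pow]
    refine ((monic_X_sub_C a).pow 2).add_of_left (degree_C_le.trans_lt ?_)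
    rw [degree_pow, degree_X_sub_C]
    norm_num
  have hfd : f.natDegree ≠ 1 := by
    intro h
    obtain ⟨r, hr⟩ := exists_root_of_degree_eq_one (p := f)
      (by rw [degree_eq_natDegree hf.ne_zero, h]; rfl)
    exact hroot ⟨r, hr⟩
  have hfd2 : f.natDegree = 2 := by
    have h1 := natDegree_le_of_dvd hdvd hqm.ne_zero
    have h2 := hf.natDegree_pos
    omega
  obtain ⟨g', hg'⟩ := hdvd
  have hg'0 : g' ≠ 0 := by rintro rfl; rw [mul_zero] at hg'; exact hqm.ne_zero hg'
  have hg'd : g'.natDegree = 0 := by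
    have := natDegree_mul hf.ne_zero hg'0
    rw [← hg', hqdeg, hfd2] at this; omega
  rw [natDegree_eq_zero] at hg'd
  obtain ⟨e, rfl⟩ := hg'd
  have he : e ≠ 0 := by rintro rfl; simp at hg'0
  refine ⟨e⁻¹, inv_ne_zero he, .inr ⟨a, b, hb, ?_⟩⟩
  rw [hg', mul_comm f, ← mul_assoc, ← C_mul, inv_mul_cancel₀ he, C_1, one_mul]

/-- Induction on nonzero polynomials over a real closed field. -/
theorem poly_induction {motive : K[X] → Prop} (hC : ∀ d, d ≠ 0 → motive (C d))
    (hmul : ∀ p q, motive p → motive q → motive (p * q))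
    (hlin : ∀ a, motive (X - C a))
    (hquad : ∀ b c, c ≠ 0 → motive ((X - C b) ^ 2 + C c ^ 2))
    {f : K[X]} (hf : f ≠ 0) : motive f := by
  induction f using WfDvdMonoid.induction_on_irreducible with
  | zero => exact absurd rfl hf
  | unit u hu =>
    obtain ⟨d, hd, rfl⟩ := Polynomial.isUnit_iff.1 hu
    exact hC d hd.ne_zero
  | mul a i ha hi ih =>
    refine hmul _ _ ?_ (ih ha)
    obtain ⟨d, hd, ⟨r, rfl⟩ | ⟨b, c, hc, rfl⟩⟩ := irreducible_cases hi
    · exact hmul _ _ (hC d hd) (hlin r)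
    · exact hmul _ _ (hC d hd) (hquad b c hc)

/-- A polynomial without roots in `[a, b]` has the same sign at `a` and `b`. -/
theorem eval_mul_eval_pos {a b : K} (hab : a ≤ b) {f : K[X]} (hf : f ≠ 0)
    (h : ∀ x, a ≤ x → x ≤ b → f.eval x ≠ 0) : 0 < f.eval a * f.eval b := by
  revert h
  refine poly_induction (motive := fun f => (∀ x, a ≤ x → x ≤ b → f.eval x ≠ 0) →
    0 < f.eval a * f.eval b) ?_ ?_ ?_ ?_ hf
  · intro d hd _
    simpa using mul_self_pos.2 hd
  · intro p q hp hq h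
    have h1 := hp fun x h1 h2 h3 => h x h1 h2 (by simp [h3])
    have h2 := hq fun x h1 h2 h3 => h x h1 h2 (by simp [h3])
    rw [eval_mul, eval_mul]
    linarith [mul_pos h1 h2]
  · intro r h
    simp only [eval_sub, eval_X, eval_C] at h ⊢
    rcases lt_or_ge r a with h1 | h1
    · exact mul_pos (by linarith) (by linarith)
    · rcases lt_or_ge b r with h2 | h2
      · exact mul_pos_of_neg_of_neg (by linarith) (by linarith)
      · exact absurd (sub_self r) (h r h1 h2)
  · intro u v hv _
    simp only [eval_add, eval_pow, eval_sub, eval_X, eval_C]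
    positivity

theorem exists_root_of_mul_neg {a b : K} (hab : a ≤ b) {f : K[X]}
    (h : f.eval a * f.eval b < 0) : ∃ x, a < x ∧ x < b ∧ f.eval x = 0 := by
  by_contra hc
  push Not at hc
  have hf : f ≠ 0 := by rintro rfl; simp at h
  refine (eval_mul_eval_pos hab hf fun x h1 h2 h3 => ?_).not_gt h
  rcases h1.eq_or_lt with rfl | h1
  · simp [h3] at h
  rcases h2.eq_or_lt with rfl | h2
  · simp [h3] at h
  exact hc x h1 h2 h3

/-- Rolle's theorem. -/
theorem exists_root_derivative {a b : K} (hab : a < b) {f : K[X]} (hf : f ≠ 0)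
    (ha : f.eval a = 0) (hb : f.eval b = 0) :
    ∃ x, a ≤ x ∧ x ≤ b ∧ (derivative f).eval x = 0 := by
  classical
  -- With `c` the least root above `a`, write `f = (X - a)(X - c)r`. Then `r` keeps its sign on `[a,
  -- c]`, so the derivative has opposite signs at `a` and `c`.
  let S := f.roots.toFinset.filter (a < ·)
  have hbS : b ∈ S := by simp [S, hf, hb, hab]
  obtain ⟨c, hcS, hc⟩ := S.exists_min_image id ⟨b, hbS⟩
  have hcS' : f.eval c = 0 ∧ a < c := by simpa [S, hf] using hcS
  obtain ⟨hc0, hac⟩ := hcS'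
  have hcb : c ≤ b := hc b hbS
  obtain ⟨g, hg⟩ := dvd_iff_isRoot.2 ha
  have hgc : g.IsRoot c := by
    rw [hg] at hc0
    simp only [eval_mul, eval_sub, eval_X, eval_C, mul_eq_zero] at hc0
    exact hc0.resolve_left (by linarith)
  obtain ⟨r, hr⟩ := dvd_iff_isRoot.2 hgc
  have hfr : f = (X - C a) * (X - C c) * r := by rw [hg, hr, mul_assoc]
  have hda : (derivative f).eval a = (a - c) * r.eval a := by
    rw [hfr]; simp
  have hdc : (derivative f).eval c = (c - a) * r.eval c := by
    rw [hfr]; simp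
  by_cases h1 : (derivative f).eval a = 0
  · exact ⟨a, le_rfl, hab.le, h1⟩
  by_cases h2 : (derivative f).eval c = 0
  · exact ⟨c, hac.le, hcb, h2⟩
  have hr0 : r ≠ 0 := by rintro rfl; simp at hfr; exact hf hfr
  have hpos := eval_mul_eval_pos hac.le hr0 (by
    intro x hx1 hx2 hx
    rcases hx1.eq_or_lt with rfl | hx1
    · exact h1 (by rw [hda, hx, mul_zero])
    rcases hx2.eq_or_lt with rfl | hx2
    · exact h2 (by rw [hdc, hx, mul_zero])
    have : x ∈ S := by simp [S, hf, hx1]; rw [hfr]; simp [hx]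
    exact absurd (hc x this) (not_le.2 hx2))
  obtain ⟨x, hx1, hx2, hx⟩ := exists_root_of_mul_neg (f := derivative f) hac.le (by
    rw [hda, hdc]
    have : 0 < (c - a) * (c - a) := mul_self_pos.2 (by linarith)
    nlinarith [mul_pos this hpos])
  exact ⟨x, hx1.le, hx2.le.trans hcb, hx⟩

end FundamentalTheorem


/-- `i` embeds `E` as a relatively algebraically closed subring of `K`. -/
def RelClosed {E K : Type*} [CommRing E] [CommRing K] (i : E →+* K) : Prop :=
  ∀ f : E[X], f ≠ 0 → ∀ x, f.eval₂ i x = 0 → ∃ e, i e = x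

/-! ### Relatively closed subfields and real closedness. -/

section RelClosed

variable {E K : Type*} [Field E] [LinearOrder E] [IsStrictOrderedRing E]
  [Field K] [LinearOrder K] [IsStrictOrderedRing K]

/-- The quadratic factors stay positive in every ordered extension, so all roots come from linear
factors. -/
theorem RelClosed.of_isRealClosed [IsRealClosed E] (i : E →+* K) : RelClosed i := by
  intro f hf
  refine poly_induction (motive := fun f => ∀ x, f.eval₂ i x = 0 → ∃ e, i e = x) ?_ ?_ ?_ ?_ hf
  · intro d hd x hx
    simp [hd] at hx
  · intro p q hp hq x hx
    rw [eval₂_mul, mul_eq_zero] at hx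
    exact hx.elim (hp x) (hq x)
  · intro a x hx
    rw [eval₂_sub, eval₂_X, eval₂_C, sub_eq_zero] at hx
    exact ⟨a, hx.symm⟩
  · intro b c hc x hx
    have : i c ≠ 0 := (map_ne_zero i).2 hc
    simp only [eval₂_add, eval₂_pow, eval₂_sub, eval₂_X, eval₂_C] at hx
    have : 0 < (x - i b) ^ 2 + i c ^ 2 := by positivity
    exact absurd hx this.ne'

theorem RelClosed.isRealClosed [IsRealClosed K] {i : E →+* K} (hi : Monotone i)
    (h : RelClosed i) : IsRealClosed E := by
  refine .of_linearOrderedField ?_ ?_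
  · intro x hx
    obtain ⟨y, hy⟩ := IsRealClosed.nonneg_iff_isSquare.1 (map_zero i ▸ hi hx)
    obtain ⟨e, rfl⟩ := h (X ^ 2 - C x) (monic_X_pow_sub_C x two_ne_zero).ne_zero y (by
      simp [hy, sq])
    exact ⟨e, i.injective (by rw [hy, map_mul])⟩
  · intro f hf
    obtain ⟨x, hx⟩ := IsRealClosed.exists_isRoot_of_odd_natDegree (f := f.map i)
      (by rwa [natDegree_map])
    rw [IsRoot, eval_map] at hx
    obtain ⟨e, rfl⟩ := h f (by rintro rfl; simp at hf) x hx
    refine ⟨e, i.injective ?_⟩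
    rw [map_zero, ← hx, eval₂_at_apply]

end RelClosed

instance : IsRealClosed ℝ := by
  refine .of_linearOrderedField (fun h => ⟨_, (Real.mul_self_sqrt h).symm⟩) ?_
  intro f hf
  wlog hlc : 0 < f.leadingCoeff generalizing f
  · have hf0 : f ≠ 0 := by rintro rfl; simp at hf
    obtain ⟨x, hx⟩ := this (f := -f) (by rwa [natDegree_neg]) (by
      rw [leadingCoeff_neg]
      exact neg_pos.2 (lt_of_le_of_ne (not_lt.1 hlc) (leadingCoeff_ne_zero.2 hf0)))
    exact ⟨x, by simpa using hx⟩
  have hdeg : 0 < f.degree := natDegree_pos_iff_degree_pos.1 hf.pos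
  have h1 := f.tendsto_atTop_of_leadingCoeff_nonneg hdeg hlc.le
  have h2 := (f.comp (-X)).tendsto_atBot_of_leadingCoeff_nonpos (by
      rw [← natDegree_pos_iff_degree_pos, natDegree_comp, natDegree_neg, natDegree_X, mul_one]
      exact hf.pos)
    (by
      rw [leadingCoeff_comp (by simp)]
      simp [hf.neg_one_pow, hlc.le])
  obtain ⟨a, ha⟩ := (h1.eventually_ge_atTop 0).exists
  obtain ⟨b, hb⟩ := (h2.eventually_le_atBot 0).exists
  rw [eval_comp] at hb
  exact mem_range_of_exists_le_of_exists_ge f.continuous ⟨_, hb⟩ ⟨a, ha⟩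

end RealClosed

end

/-! ## Extending isomorphisms of ordered fields -/

noncomputable section

open Polynomial

namespace RealClosed

theorem eval_mul_eval_pos' {K : Type*} [Field K] [LinearOrder K] [IsStrictOrderedRing K]
    [IsRealClosed K] {a b : K} {f : K[X]} (h : ∀ x ∈ Set.uIcc a b, f.eval x ≠ 0) :
    0 < f.eval a * f.eval b := by
  have hf : f ≠ 0 := by rintro rfl; exact h a Set.left_mem_uIcc eval_zero
  rcases le_total a b with hab | hab
  · exact eval_mul_eval_pos hab hf fun x h1 h2 => h x (Set.uIcc_of_le hab ▸ ⟨h1, h2⟩)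
  · rw [mul_comm]
    exact eval_mul_eval_pos hab hf fun x h1 h2 => h x (Set.uIcc_of_ge hab ▸ ⟨h1, h2⟩)

/-- A bound for `|x|` when `x` satisfies a monic polynomial inequality. -/
theorem abs_le_of_pow_le {K : Type*} [Field K] [LinearOrder K] [IsStrictOrderedRing K]
    {x : K} {m : ℕ} (hm : 0 < m) {a : ℕ → K} (ha : ∀ k, 0 ≤ a k)
    (h : |x| ^ m ≤ ∑ k ∈ Finset.range m, a k * |x| ^ k) :
    |x| ≤ 1 + ∑ k ∈ Finset.range m, a k := by
  by_contra hc
  push Not at hc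
  have hs : 0 ≤ ∑ k ∈ Finset.range m, a k := Finset.sum_nonneg fun k _ => ha k
  have h1 : 1 ≤ |x| := by linarith
  have h2 : ∑ k ∈ Finset.range m, a k * |x| ^ k ≤
      (∑ k ∈ Finset.range m, a k) * |x| ^ (m - 1) := by
    rw [Finset.sum_mul]
    refine Finset.sum_le_sum fun k hk => mul_le_mul_of_nonneg_left ?_ (ha k)
    exact pow_le_pow_right₀ h1 (by have := Finset.mem_range.1 hk; omega)
  have h3 : |x| ^ m = |x| * |x| ^ (m - 1) := by
    rw [← pow_succ', Nat.sub_add_cancel hm]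
  have h4 : 0 < |x| ^ (m - 1) := by positivity
  rw [h3] at h
  have := le_of_mul_le_mul_right (h.trans h2) h4
  linarith

/-! ### An ordered field embedded in two real closed fields. -/

section TwoEmbeddings

variable {E K K' : Type*} [Field E] [LinearOrder E] [IsStrictOrderedRing E]
  [Field K] [LinearOrder K] [IsStrictOrderedRing K]
  [Field K'] [LinearOrder K'] [IsStrictOrderedRing K']

theorem exists_bound_of_root {i : E →+* K} (hi : Monotone i) {f : E[X]} (hf : f ≠ 0) {x : K}
    (hx : f.eval₂ i x = 0) : ∃ M, i (-M) < x ∧ x < i M := by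
  have hlc : f.leadingCoeff ≠ 0 := leadingCoeff_ne_zero.2 hf
  have hilc : i f.leadingCoeff ≠ 0 := (map_ne_zero i).2 hlc
  have habs : ∀ e, |i e| = i |e| := fun e => by
    rcases le_total 0 e with h | h
    · rw [abs_of_nonneg h, abs_of_nonneg (map_zero i ▸ hi h)]
    · rw [abs_of_nonpos h, abs_of_nonpos (map_zero i ▸ hi h), map_neg]
  have hdeg : 0 < f.natDegree := by
    by_contra h
    obtain ⟨c, rfl⟩ := natDegree_eq_zero.1 (by omega : f.natDegree = 0)
    rw [eval₂_C, map_eq_zero] at hx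
    simp [hx] at hf
  have key := abs_le_of_pow_le (x := x) hdeg (a := fun k => i |f.coeff k / f.leadingCoeff|)
    (fun k => map_zero i ▸ hi (abs_nonneg _)) (by
      have h1 : x ^ f.natDegree =
          -∑ k ∈ Finset.range f.natDegree, i (f.coeff k / f.leadingCoeff) * x ^ k := by
        rw [eval₂_eq_sum_range, Finset.sum_range_succ] at hx
        simp only [map_div₀, div_mul_eq_mul_div, ← Finset.sum_div]
        rw [eq_neg_iff_add_eq_zero, eq_comm]
        field_simp
        rw [leadingCoeff]
        linear_combination -hx
      rw [← abs_pow, h1, abs_neg]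
      refine (Finset.abs_sum_le_sum_abs _ _).trans (le_of_eq ?_)
      refine Finset.sum_congr rfl fun k _ => ?_
      rw [abs_mul, abs_pow, habs])
  refine ⟨1 + ∑ k ∈ Finset.range f.natDegree, |f.coeff k / f.leadingCoeff| + 1, ?_⟩
  rw [map_neg, ← abs_lt, map_add, map_add, map_sum, map_one]
  linarith

/-- The endpoints are the elements of `S`, `lo`, `hi` nearest to `u` on either side. This isolates
`u` from the finitely many roots in `E` of a given polynomial. -/
theorem exists_gap {i : E →+* K} {u : K} (hu : ∀ e, i e ≠ u) (S : Finset E)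
    {lo hi : E} (h1 : i lo < u) (h2 : u < i hi) :
    ∃ g₁ g₂, lo ≤ g₁ ∧ g₂ ≤ hi ∧ i g₁ < u ∧ u < i g₂ ∧ ∀ s ∈ S, s ≤ g₁ ∨ g₂ ≤ s := by
  classical
  obtain ⟨g₁, hg₁, hmax⟩ := (insert lo (S.filter (i · < u))).exists_max_image id ⟨lo, by simp⟩
  obtain ⟨g₂, hg₂, hmin⟩ := (insert hi (S.filter (u < i ·))).exists_min_image id ⟨hi, by simp⟩
  refine ⟨g₁, g₂, hmax lo (by simp), hmin hi (by simp), ?_, ?_, fun s hs => ?_⟩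
  · rcases Finset.mem_insert.1 hg₁ with rfl | h
    · exact h1
    · exact (Finset.mem_filter.1 h).2
  · rcases Finset.mem_insert.1 hg₂ with rfl | h
    · exact h2
    · exact (Finset.mem_filter.1 h).2
  · rcases lt_or_gt_of_ne (hu s) with h | h
    · exact .inl (hmax s (by simp [hs, h]))
    · exact .inr (hmin s (by simp [hs, h]))

/-- Write `f = (X - u)q`. A zero of `q` between the endpoints would, by Rolle, force a zero of the
derivative there, and by `hroots` that zero would lie in `E`. Hence `q` keeps its sign while `X - u`
changes it. -/
theorem sign_change_of_root [IsRealClosed K] {i : E →+* K} (hi : Monotone i) {f : E[X]}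
    (hroots : ∀ g : E[X], g ≠ 0 → g.natDegree < f.natDegree → ∀ x, g.eval₂ i x = 0 → ∃ e, i e = x)
    (hf : ∀ e, f.eval e ≠ 0) {u : K} (hu : f.eval₂ i u = 0) {e₁ e₂ : E} (h1 : i e₁ < u)
    (h2 : u < i e₂) (hder : ∀ e, (derivative f).eval e = 0 → e ≤ e₁ ∨ e₂ ≤ e)
    (hder0 : derivative f ≠ 0) (hdeg : (derivative f).natDegree < f.natDegree) :
    f.eval e₁ * f.eval e₂ < 0 := by
  have hsm := hi.strictMono_of_injective i.injective
  have hder' : ∀ x, i e₁ < x → x < i e₂ → (derivative f).eval₂ i x ≠ 0 := by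
    intro x hx1 hx2 hx
    obtain ⟨e, rfl⟩ := hroots _ hder0 hdeg x hx
    rw [eval₂_at_apply, map_eq_zero] at hx
    rcases hder e hx with h | h
    · exact (hsm.lt_iff_lt.1 hx1).not_ge h
    · exact (hsm.lt_iff_lt.1 hx2).not_ge h
  have hf0 : f ≠ 0 := by rintro rfl; exact hf 0 eval_zero
  have hF0 : f.map i ≠ 0 := Polynomial.map_ne_zero hf0
  obtain ⟨q, hq⟩ := dvd_iff_isRoot.2 (show (f.map i).IsRoot u by rwa [IsRoot, eval_map])
  have hval : ∀ e, i (f.eval e) = (i e - u) * q.eval (i e) := by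
    intro e
    rw [← eval₂_at_apply, ← eval_map, hq]
    simp
  have hpos : 0 < q.eval (i e₁) * q.eval (i e₂) := by
    refine eval_mul_eval_pos (h1.trans h2).le (by rintro rfl; simp at hq; exact hf0 hq) ?_
    intro x hx1 hx2 hx
    rcases hx1.eq_or_lt with rfl | hx1
    · exact hf e₁ ((map_eq_zero i).1 (by rw [hval, hx, mul_zero]))
    rcases hx2.eq_or_lt with rfl | hx2
    · exact hf e₂ ((map_eq_zero i).1 (by rw [hval, hx, mul_zero]))
    have hFx : (f.map i).eval x = 0 := by rw [hq]; simp [hx]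
    have hFu : (f.map i).eval u = 0 := by rw [hq]; simp
    rcases lt_trichotomy x u with h | rfl | h
    · obtain ⟨y, hy1, hy2, hy⟩ := exists_root_derivative h hF0 hFx hFu
      rw [derivative_map, eval_map] at hy
      exact hder' y (hx1.trans_le hy1) (hy2.trans_lt h2) hy
    · refine hder' x h1 h2 ?_
      rw [← eval_map, ← derivative_map, hq]
      simp [hx]
    · obtain ⟨y, hy1, hy2, hy⟩ := exists_root_derivative h hF0 hFu hFx
      rw [derivative_map, eval_map] at hy
      exact hder' y (h1.trans_le hy1) (hy2.trans_lt hx2) hy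
  rw [← hsm.lt_iff_lt, map_mul, hval, hval, map_zero]
  have := mul_pos (mul_pos (sub_pos.2 h1) (sub_pos.2 h2)) hpos
  nlinarith

/-- A gap around `u` without zeros of the derivative isolates `u`. The sign change of `f` across it
is visible in `E`, so `f` has exactly one root in the corresponding interval of `K'`. Signs of other
polynomials reduce modulo `f` to degrees where all roots lie in `E`. -/
theorem exists_matching_root [IsRealClosed K] [IsRealClosed K'] {i : E →+* K} {j : E →+* K'}
    (hi : Monotone i) (hj : Monotone j) {f : E[X]} (hf0 : f ≠ 0)
    (hri : ∀ g : E[X], g ≠ 0 → g.natDegree < f.natDegree → ∀ x, g.eval₂ i x = 0 → ∃ e, i e = x)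
    (hrj : ∀ g : E[X], g ≠ 0 → g.natDegree < f.natDegree → ∀ x, g.eval₂ j x = 0 → ∃ e, j e = x)
    {u : K} (hu : f.eval₂ i u = 0) (hui : ∀ e, i e ≠ u) :
    ∃ u', f.eval₂ j u' = 0 ∧ ∀ p : E[X], 0 ≤ p.eval₂ i u ↔ 0 ≤ p.eval₂ j u' := by
  have hsi := hi.strictMono_of_injective i.injective
  have hsj := hj.strictMono_of_injective j.injective
  have hdeg : 0 < f.natDegree := by
    by_contra h
    obtain ⟨c, rfl⟩ := natDegree_eq_zero.1 (by omega : f.natDegree = 0)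
    rw [eval₂_C, map_eq_zero] at hu
    simp [hu] at hf0
  have hder0 : derivative f ≠ 0 := fun h => by
    have := derivative_eq_zero.1 h
    omega
  have hderdeg : (derivative f).natDegree < f.natDegree := natDegree_derivative_lt hdeg.ne'
  have hfE : ∀ e, f.eval e ≠ 0 := by
    intro e he
    obtain ⟨g, hg⟩ := dvd_iff_isRoot.2 he
    have hg0 : g ≠ 0 := by rintro rfl; simp at hg; exact hf0 hg
    have hgd : g.natDegree < f.natDegree := by
      rw [hg, natDegree_mul (X_sub_C_ne_zero e) hg0, natDegree_X_sub_C]; omega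
    rw [hg, eval₂_mul, mul_eq_zero] at hu
    rcases hu with h | h
    · rw [eval₂_sub, eval₂_X, eval₂_C, sub_eq_zero] at h
      exact hui e h.symm
    · obtain ⟨e', he'⟩ := hri g hg0 hgd u h
      exact hui e' he'
  obtain ⟨M, hM1, hM2⟩ := exists_bound_of_root hi hf0 hu
  obtain ⟨e₁, e₂, -, -, he1, he2, hS⟩ := exists_gap hui (derivative f).roots.toFinset hM1 hM2
  have hder : ∀ e, (derivative f).eval e = 0 → e ≤ e₁ ∨ e₂ ≤ e := fun e he =>
    hS e (by simp [hder0, he])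
  have he12 : e₁ < e₂ := hsi.lt_iff_lt.1 (he1.trans he2)
  have hder' : ∀ x, j e₁ < x → x < j e₂ → (derivative f).eval₂ j x ≠ 0 := by
    intro x hx1 hx2 hx
    obtain ⟨e, rfl⟩ := hrj _ hder0 hderdeg x hx
    rw [eval₂_at_apply, map_eq_zero] at hx
    rcases hder e hx with h | h
    · exact (hsj.lt_iff_lt.1 hx1).not_ge h
    · exact (hsj.lt_iff_lt.1 hx2).not_ge h
  have hroot : ∀ g₁ g₂, e₁ ≤ g₁ → g₂ ≤ e₂ → i g₁ < u → u < i g₂ →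
      ∃ w, j g₁ < w ∧ w < j g₂ ∧ f.eval₂ j w = 0 := by
    intro g₁ g₂ h1 h2 h3 h4
    have hneg := sign_change_of_root hi hri hfE hu h3 h4 (fun e he =>
      (hder e he).imp (·.trans h1) h2.trans) hder0 hderdeg
    have hg : g₁ < g₂ := hsi.lt_iff_lt.1 (h3.trans h4)
    obtain ⟨w, hw1, hw2, hw⟩ := exists_root_of_mul_neg (f := f.map j) (hj hg.le) (by
      rw [eval_map, eval_map, eval₂_at_apply, eval₂_at_apply, ← map_mul, ← map_zero j]
      exact hsj hneg)
    exact ⟨w, hw1, hw2, by rwa [eval_map] at hw⟩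
  obtain ⟨u', hu1, hu2, hu'⟩ := hroot e₁ e₂ le_rfl le_rfl he1 he2
  have huniq : ∀ w, j e₁ < w → w < j e₂ → f.eval₂ j w = 0 → w = u' := by
    intro w hw1 hw2 hw
    have hF0 : f.map j ≠ 0 := Polynomial.map_ne_zero hf0
    rw [← eval_map] at hw hu'
    rcases lt_trichotomy w u' with h | h | h
    · obtain ⟨y, hy1, hy2, hy⟩ := exists_root_derivative h hF0 hw hu'
      rw [derivative_map, eval_map] at hy
      exact absurd hy (hder' y (hw1.trans_le hy1) (hy2.trans_lt hu2))
    · exact h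
    · obtain ⟨y, hy1, hy2, hy⟩ := exists_root_derivative h hF0 hu' hw
      rw [derivative_map, eval_map] at hy
      exact absurd hy (hder' y (hu1.trans_le hy1) (hy2.trans_lt hw2))
  refine ⟨u', hu', fun p => ?_⟩
  have hmod1 : p.eval₂ i u = (p % f).eval₂ i u := by
    conv_lhs => rw [← EuclideanDomain.div_add_mod p f]
    rw [eval₂_add, eval₂_mul, hu, zero_mul, zero_add]
  have hmod2 : p.eval₂ j u' = (p % f).eval₂ j u' := by
    conv_lhs => rw [← EuclideanDomain.div_add_mod p f]
    rw [eval₂_add, eval₂_mul, hu', zero_mul, zero_add]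
  rw [hmod1, hmod2]
  by_cases hr : p % f = 0
  · simp [hr]
  have hrd : (p % f).natDegree < f.natDegree := natDegree_mod_lt p hdeg.ne'
  -- A smaller gap that also avoids the roots of the remainder. The root of `f` found there is again
  -- `u'`, by uniqueness.
  obtain ⟨g₁, g₂, hg1, hg2, hg3, hg4, hg⟩ := exists_gap hui (p % f).roots.toFinset he1 he2
  obtain ⟨w, hw1, hw2, hw⟩ := hroot g₁ g₂ hg1 hg2 hg3 hg4
  obtain rfl := huniq w ((hj hg1).trans_lt hw1) (hw2.trans_le (hj hg2)) hw
  have hg12 : g₁ < g₂ := hsi.lt_iff_lt.1 (hg3.trans hg4)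
  -- The remainder has no zero in the gap, so its signs at `u` and at `w` both agree with its sign
  -- at the sample point `m` of `E`.
  obtain ⟨m, hm1, hm2⟩ := exists_between hg12
  have hnr : ∀ e, (p % f).eval e = 0 → e ≤ g₁ ∨ g₂ ≤ e := fun e he =>
    hg e (by simp [hr, he])
  have hs1 : 0 < (p % f).eval₂ i u * i ((p % f).eval m) := by
    rw [← eval₂_at_apply, ← eval_map, ← eval_map]
    refine eval_mul_eval_pos' fun x hx hx0 => ?_
    rw [eval_map] at hx0
    obtain ⟨e, rfl⟩ := hri _ hr hrd x hx0
    rw [eval₂_at_apply, map_eq_zero] at hx0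
    have h3 := lt_of_lt_of_le (lt_min hg3 (hsi hm1)) hx.1
    have h4 := lt_of_le_of_lt hx.2 (max_lt hg4 (hsi hm2))
    rcases hnr e hx0 with h | h
    · exact (hsi.lt_iff_lt.1 h3).not_ge h
    · exact (hsi.lt_iff_lt.1 h4).not_ge h
  have hs2 : 0 < (p % f).eval₂ j w * j ((p % f).eval m) := by
    rw [← eval₂_at_apply, ← eval_map, ← eval_map]
    refine eval_mul_eval_pos' fun x hx hx0 => ?_
    rw [eval_map] at hx0
    obtain ⟨e, rfl⟩ := hrj _ hr hrd x hx0
    rw [eval₂_at_apply, map_eq_zero] at hx0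
    have h3 := lt_of_lt_of_le (lt_min hw1 (hsj hm1)) hx.1
    have h4 := lt_of_le_of_lt hx.2 (max_lt hw2 (hsj hm2))
    rcases hnr e hx0 with h | h
    · exact (hsj.lt_iff_lt.1 h3).not_ge h
    · exact (hsj.lt_iff_lt.1 h4).not_ge h
  rcases lt_trichotomy 0 ((p % f).eval m) with h | h | h
  · have h5 := hsi h
    have h6 := hsj h
    rw [map_zero] at h5 h6
    exact iff_of_true (pos_of_mul_pos_left hs1 h5.le).le (pos_of_mul_pos_left hs2 h6.le).le
  · rw [← h] at hs1
    simp at hs1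
  · have h5 := hsi h
    have h6 := hsj h
    rw [map_zero] at h5 h6
    exact iff_of_false (not_le.2 (neg_of_mul_pos_left hs1 h5.le))
      (not_le.2 (neg_of_mul_pos_left hs2 h6.le))

/-- Among all polynomials with a root missing from `E` on either side, one of least degree satisfies
the hypotheses of `exists_matching_root`. -/
theorem exists_extension_of_not_relClosed [IsRealClosed K] [IsRealClosed K']
    {i : E →+* K} {j : E →+* K'} (hi : Monotone i) (hj : Monotone j)
    (h : ¬ (RelClosed i ∧ RelClosed j)) :
    ∃ u u', (∃ f : E[X], f ≠ 0 ∧ f.eval₂ i u = 0) ∧ ((∀ e, i e ≠ u) ∨ ∀ e, j e ≠ u') ∧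
      ∀ p : E[X], 0 ≤ p.eval₂ i u ↔ 0 ≤ p.eval₂ j u' := by
  classical
  have hex : ∃ n, ∃ f : E[X], f ≠ 0 ∧ f.natDegree = n ∧
      ((∃ u, f.eval₂ i u = 0 ∧ ∀ e, i e ≠ u) ∨ ∃ u, f.eval₂ j u = 0 ∧ ∀ e, j e ≠ u) := by
    simp only [RelClosed] at h
    contrapose! h
    exact ⟨fun f hf x hx => (h _ f hf rfl).1 x hx, fun f hf x hx => (h _ f hf rfl).2 x hx⟩
  obtain ⟨f, hf, hfn, hcase⟩ := Nat.find_spec hex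
  have hri : ∀ g : E[X], g ≠ 0 → g.natDegree < f.natDegree →
      ∀ x, g.eval₂ i x = 0 → ∃ e, i e = x := by
    intro g hg hlt x hx
    by_contra hc
    exact Nat.find_min hex (hfn ▸ hlt) ⟨g, hg, rfl, .inl ⟨x, hx, not_exists.1 hc⟩⟩
  have hrj : ∀ g : E[X], g ≠ 0 → g.natDegree < f.natDegree →
      ∀ x, g.eval₂ j x = 0 → ∃ e, j e = x := by
    intro g hg hlt x hx
    by_contra hc
    exact Nat.find_min hex (hfn ▸ hlt) ⟨g, hg, rfl, .inr ⟨x, hx, not_exists.1 hc⟩⟩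
  rcases hcase with ⟨u, hu, hui⟩ | ⟨u', hu', huj⟩
  · obtain ⟨u', hu', hp⟩ := exists_matching_root hi hj hf hri hrj hu hui
    exact ⟨u, u', ⟨f, hf, hu⟩, .inl hui, hp⟩
  · obtain ⟨u, hu, hp⟩ := exists_matching_root hj hi hf hrj hri hu' huj
    exact ⟨u, u', ⟨f, hf, hu⟩, .inr huj, fun p => (hp p).symm⟩

/-- The sign of a polynomial over a real closed field at a point of an ordered extension only
depends on the cut of that point. -/
theorem sign_eq_of_cut_eq [IsRealClosed E] {i : E →+* K} {j : E →+* K'} {u : K} {u' : K'}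
    (hcut : ∀ e, i e < u ↔ j e < u') (hu : ∀ e, i e ≠ u) (hu' : ∀ e, j e ≠ u') (p : E[X]) :
    0 ≤ p.eval₂ i u ↔ 0 ≤ p.eval₂ j u' := by
  have monoi : ∀ d, 0 < d → 0 < i d := by
    intro d hd
    obtain ⟨r, rfl⟩ := IsRealClosed.nonneg_iff_isSquare.1 hd.le
    rw [map_mul]
    exact mul_self_pos.2 ((map_ne_zero i).2 (by rintro rfl; simp at hd))
  have monoj : ∀ d, 0 < d → 0 < j d := by
    intro d hd
    obtain ⟨r, rfl⟩ := IsRealClosed.nonneg_iff_isSquare.1 hd.le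
    rw [map_mul]
    exact mul_self_pos.2 ((map_ne_zero j).2 (by rintro rfl; simp at hd))
  by_cases hp : p = 0
  · simp [hp]
  suffices h : (0 < p.eval₂ i u ∧ 0 < p.eval₂ j u') ∨ (p.eval₂ i u < 0 ∧ p.eval₂ j u' < 0) by
    rcases h with h | h
    · exact iff_of_true h.1.le h.2.le
    · exact iff_of_false (not_le.2 h.1) (not_le.2 h.2)
  refine poly_induction (motive := fun p => (0 < p.eval₂ i u ∧ 0 < p.eval₂ j u') ∨
    (p.eval₂ i u < 0 ∧ p.eval₂ j u' < 0)) ?_ ?_ ?_ ?_ hp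
  · intro d hd
    rw [eval₂_C, eval₂_C]
    rcases lt_or_gt_of_ne hd with h | h
    · have h1 := monoi (-d) (neg_pos.2 h)
      have h2 := monoj (-d) (neg_pos.2 h)
      rw [map_neg] at h1 h2
      exact .inr ⟨neg_pos.1 h1, neg_pos.1 h2⟩
    · exact .inl ⟨monoi d h, monoj d h⟩
  · rintro p q (⟨h1, h2⟩ | ⟨h1, h2⟩) (⟨h3, h4⟩ | ⟨h3, h4⟩) <;> rw [eval₂_mul, eval₂_mul]
    · exact .inl ⟨mul_pos h1 h3, mul_pos h2 h4⟩
    · exact .inr ⟨mul_neg_of_pos_of_neg h1 h3, mul_neg_of_pos_of_neg h2 h4⟩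
    · exact .inr ⟨mul_neg_of_neg_of_pos h1 h3, mul_neg_of_neg_of_pos h2 h4⟩
    · exact .inl ⟨mul_pos_of_neg_of_neg h1 h3, mul_pos_of_neg_of_neg h2 h4⟩
  · intro a
    simp only [eval₂_sub, eval₂_X, eval₂_C, sub_pos, sub_neg]
    rcases lt_or_gt_of_ne (hu a) with h | h
    · exact .inl ⟨h, (hcut a).1 h⟩
    · exact .inr ⟨h, lt_of_le_of_ne (not_lt.1 (mt (hcut a).2 h.not_gt)) (hu' a).symm⟩
  · intro b c hc
    have h1 : i c ≠ 0 := (map_ne_zero i).2 hc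
    have h2 : j c ≠ 0 := (map_ne_zero j).2 hc
    simp only [eval₂_add, eval₂_pow, eval₂_sub, eval₂_X, eval₂_C]
    exact .inl ⟨by positivity, by positivity⟩

end TwoEmbeddings

end RealClosed

end

/-! ## Graphs of order isomorphisms -/

noncomputable section

open Polynomial

namespace RealClosed

theorem relClosed_comp_iff {E F K : Type*} [CommRing E] [CommRing F] [CommRing K] (e : E ≃+* F)
    {i : F →+* K} : RelClosed (i.comp (e : E →+* F)) ↔ RelClosed i := by
  constructor
  · intro h f hf x hx
    obtain ⟨y, hy⟩ := h (f.map (e.symm : F →+* E))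
      ((Polynomial.map_ne_zero_iff e.symm.injective).2 hf) x (by
        rw [eval₂_map, RingHom.comp_assoc]
        simpa using hx)
    exact ⟨e y, hy⟩
  · intro h f hf x hx
    obtain ⟨y, hy⟩ := h (f.map (e : E →+* F))
      ((Polynomial.map_ne_zero_iff e.injective).2 hf) x (by rwa [eval₂_map])
    exact ⟨e.symm y, by simpa using hy⟩

/-! ### Order graphs and their extension to real closures. -/

section OrdGraph

variable {K K' : Type*} [Field K] [LinearOrder K] [IsStrictOrderedRing K]
  [Field K'] [LinearOrder K'] [IsStrictOrderedRing K']

/-- A subring of `K × K'` that is the graph of an order isomorphism between subrings of `K`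
and `K'`. -/
def OrdGraph (G : Subring (K × K')) : Prop := ∀ p ∈ G, 0 ≤ p.1 ↔ 0 ≤ p.2

/-- The first projection of a subring of `K × K'`. -/
abbrev fstHom (G : Subring (K × K')) : G →+* K := (RingHom.fst K K').comp G.subtype

/-- The second projection of a subring of `K × K'`. -/
abbrev sndHom (G : Subring (K × K')) : G →+* K' := (RingHom.snd K K').comp G.subtype

/-- The subring of `K × K'` generated by `G` and `q`. -/
def adjoin (G : Subring (K × K')) (q : K × K') : Subring (K × K') :=
  (eval₂RingHom G.subtype q).range

theorem le_adjoin (G : Subring (K × K')) (q : K × K') : G ≤ adjoin G q := fun p hp =>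
  ⟨C ⟨p, hp⟩, by simp⟩

theorem mem_adjoin (G : Subring (K × K')) (q : K × K') : q ∈ adjoin G q := ⟨X, by simp⟩

theorem eval₂_fst (G : Subring (K × K')) (q : K × K') (p : G[X]) :
    (p.eval₂ G.subtype q).1 = p.eval₂ (fstHom G) q.1 :=
  hom_eval₂ p G.subtype (RingHom.fst K K') q

theorem eval₂_snd (G : Subring (K × K')) (q : K × K') (p : G[X]) :
    (p.eval₂ G.subtype q).2 = p.eval₂ (sndHom G) q.2 :=
  hom_eval₂ p G.subtype (RingHom.snd K K') q

variable {G : Subring (K × K')}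

theorem OrdGraph.adjoin {q : K × K'}
    (h : ∀ p : G[X], 0 ≤ p.eval₂ (fstHom G) q.1 ↔ 0 ≤ p.eval₂ (sndHom G) q.2) :
    OrdGraph (adjoin G q) := by
  rintro _ ⟨p, rfl⟩
  rw [coe_eval₂RingHom, eval₂_fst, eval₂_snd]
  exact h p

namespace OrdGraph

theorem le_iff (hG : OrdGraph G) {p q : K × K'} (hp : p ∈ G) (hq : q ∈ G) :
    p.1 ≤ q.1 ↔ p.2 ≤ q.2 := by
  rw [← sub_nonneg, ← sub_nonneg (b := p.2)]
  exact hG _ (sub_mem hq hp)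

theorem eq_iff (hG : OrdGraph G) {p q : K × K'} (hp : p ∈ G) (hq : q ∈ G) :
    p.1 = q.1 ↔ p.2 = q.2 := by
  rw [le_antisymm_iff, le_antisymm_iff, hG.le_iff hp hq, hG.le_iff hq hp]

theorem fst_eq_zero_iff (hG : OrdGraph G) {p : K × K'} (hp : p ∈ G) : p.1 = 0 ↔ p.2 = 0 :=
  hG.eq_iff hp (zero_mem G)

theorem eq_of_fst_eq (hG : OrdGraph G) {p q : K × K'} (hp : p ∈ G) (hq : q ∈ G)
    (h : p.1 = q.1) : p = q :=
  Prod.ext h ((hG.eq_iff hp hq).1 h)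

theorem eq_of_snd_eq (hG : OrdGraph G) {p q : K × K'} (hp : p ∈ G) (hq : q ∈ G)
    (h : p.2 = q.2) : p = q :=
  Prod.ext ((hG.eq_iff hp hq).2 h) h

theorem abs_mem (hG : OrdGraph G) {p : K × K'} (hp : p ∈ G) : (|p.1|, |p.2|) ∈ G := by
  rcases le_total 0 p.1 with h | h
  · rwa [abs_of_nonneg h, abs_of_nonneg ((hG p hp).1 h)]
  · rw [abs_of_nonpos h, abs_of_nonpos ((hG.le_iff hp (zero_mem G)).1 h)]
    exact neg_mem hp

theorem fst_injective (hG : OrdGraph G) : Function.Injective (fstHom G) := fun p q h =>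
  Subtype.ext (hG.eq_of_fst_eq p.2 q.2 h)

theorem snd_injective (hG : OrdGraph G) : Function.Injective (sndHom G) := fun p q h =>
  Subtype.ext (hG.eq_of_snd_eq p.2 q.2 h)

/-- Turns a graph into an abstract ordered field with two monotone embeddings, the form in which the
results on two embeddings apply. -/
theorem exists_orderedField.{w, v} {K : Type w} {K' : Type v} [Field K] [LinearOrder K]
    [IsStrictOrderedRing K] [Field K'] [LinearOrder K'] [IsStrictOrderedRing K']
    {G : Subring (K × K')} (hG : OrdGraph G) (hinv : ∀ p ∈ G, p⁻¹ ∈ G) :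
    ∃ (E : Type (max w v)) (_ : Field E) (_ : LinearOrder E) (_ : IsStrictOrderedRing E)
      (e : E ≃+* G), Monotone ((fstHom G).comp (e : E →+* G)) ∧
        Monotone ((sndHom G).comp (e : E →+* G)) := by
  let F : Field G := IsField.toField (R := G)
    { exists_pair_ne := ⟨0, 1, fun h => zero_ne_one (congrArg (fstHom G) h)⟩
      mul_comm := mul_comm
      mul_inv_cancel := fun {p} hp => by
        have h1 : p.1.1 ≠ 0 := fun h => hp (hG.fst_injective h)
        have h2 : p.1.2 ≠ 0 := fun h => hp (hG.snd_injective h)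
        exact ⟨⟨p.1⁻¹, hinv _ p.2⟩, Subtype.ext (Prod.ext (mul_inv_cancel₀ h1)
          (mul_inv_cancel₀ h2))⟩ }
  let O : LinearOrder G := LinearOrder.lift' (fstHom G) hG.fst_injective
  have hlt : ∀ p q : G, O.lt p q ↔ p.1.1 < q.1.1 := fun p q => by
    rw [O.lt_iff_le_not_ge, lt_iff_le_not_ge]; rfl
  have hO : @IsStrictOrderedRing G F.toSemiring O.toPartialOrder :=
    @Function.Injective.isStrictOrderedRing K G _ _ _ F.toSemiring O.toPartialOrder (fstHom G)
      (map_zero (fstHom G)) (map_one (fstHom G)) (map_add (fstHom G)) (map_mul (fstHom G))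
      Iff.rfl (fun {p q} => (hlt p q).symm)
  exact ⟨G, F, O, hO, RingEquiv.refl G, fun _ _ h => h, fun p q h => (hG.le_iff p.2 q.2).1 h⟩

/-- The exponent clears all denominators, and being even it makes the multiplier positive on both
sides. Signs of polynomials in `q⁻¹` thus reduce to signs in `G`. -/
theorem exists_mul_pow_eq (hG : OrdGraph G) {q : K × K'} (hq : q ∈ G) (hq0 : q.1 ≠ 0)
    (p : G[X]) : ∃ e : G, (p.eval₂ (fstHom G) q⁻¹.1) * q.1 ^ (2 * p.natDegree) = fstHom G e ∧
      (p.eval₂ (sndHom G) q⁻¹.2) * q.2 ^ (2 * p.natDegree) = sndHom G e := by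
  have hq0' : q.2 ≠ 0 := mt (hG.fst_eq_zero_iff hq).2 hq0
  refine ⟨∑ k ∈ Finset.range (p.natDegree + 1), p.coeff k * ⟨q, hq⟩ ^ (2 * p.natDegree - k), ?_, ?_⟩
  all_goals
    rw [eval₂_eq_sum_range, map_sum, Finset.sum_mul]
    refine Finset.sum_congr rfl fun k hk => ?_
    have hk' : k ≤ 2 * p.natDegree := by have := Finset.mem_range.1 hk; omega
    rw [map_mul, map_pow, mul_assoc]
    congr 1
  · change q.1⁻¹ ^ k * q.1 ^ _ = q.1 ^ _
    rw [inv_pow, pow_sub₀ _ hq0 hk', mul_comm]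
  · change q.2⁻¹ ^ k * q.2 ^ _ = q.2 ^ _
    rw [inv_pow, pow_sub₀ _ hq0' hk', mul_comm]

/-- Uniqueness of real closures: an order graph extends to one between relatively
algebraically closed subfields, by algebraic elements. -/
theorem exists_relClosed [IsRealClosed K] [IsRealClosed K'] {G₀ : Subring (K × K')}
    (hG₀ : OrdGraph G₀) :
    ∃ G, G₀ ≤ G ∧ OrdGraph G ∧ (∀ p ∈ G, p⁻¹ ∈ G) ∧ RelClosed (fstHom G) ∧ RelClosed (sndHom G) ∧
      ∀ p ∈ G, ∃ f : G₀[X], f ≠ 0 ∧ f.eval₂ (fstHom G₀) p.1 = 0 := by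
  -- Zorn's lemma is applied to the order graphs that are algebraic over `G₀`.
  let S : Set (Subring (K × K')) := {G | OrdGraph G ∧
    ∀ p ∈ G, ∃ f : G₀[X], f ≠ 0 ∧ f.eval₂ (fstHom G₀) p.1 = 0}
  obtain ⟨G, hG₀G, ⟨⟨hG, halg⟩, hmax⟩⟩ := zorn_le_nonempty₀ S (by
    intro c hc hchain y hy
    have hdir : DirectedOn (· ≤ ·) c := hchain.directedOn
    refine ⟨sSup c, ⟨fun p hp => ?_, fun p hp => ?_⟩, fun z hz => le_sSup hz⟩
    · obtain ⟨H, hH, hpH⟩ := (Subring.mem_sSup_of_directedOn ⟨y, hy⟩ hdir).1 hp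
      exact (hc hH).1 p hpH
    · obtain ⟨H, hH, hpH⟩ := (Subring.mem_sSup_of_directedOn ⟨y, hy⟩ hdir).1 hp
      exact (hc hH).2 p hpH) G₀ ⟨hG₀, fun p hp => ⟨X - C ⟨p, hp⟩, X_sub_C_ne_zero _, by simp⟩⟩
  -- By maximality, any algebraic pair on which all polynomials over `G` have matching signs is
  -- already in `G`. Inverses and missing roots are both handled in this way.
  have hext : ∀ q : K × K', (∃ f : G[X], f ≠ 0 ∧ f.eval₂ (fstHom G) q.1 = 0) →
      (∀ p : G[X], 0 ≤ p.eval₂ (fstHom G) q.1 ↔ 0 ≤ p.eval₂ (sndHom G) q.2) → q ∈ G := by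
    intro q hqalg hq
    refine hmax ⟨OrdGraph.adjoin hq, ?_⟩ (le_adjoin G q) (mem_adjoin G q)
    let : Algebra G₀ K := (fstHom G₀).toAlgebra
    let : Algebra G K := (fstHom G).toAlgebra
    let : Algebra G₀ G := (Subring.inclusion hG₀G).toAlgebra
    have : IsScalarTower G₀ G K := .of_algebraMap_eq fun _ => rfl
    have : IsDomain G := hG.fst_injective.isDomain (fstHom G)
    have hG₀alg : Algebra.IsAlgebraic G₀ G := ⟨fun p => by
      obtain ⟨f, hf, hfp⟩ := halg p.1 p.2
      refine ⟨f, hf, hG.fst_injective ?_⟩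
      rw [aeval_def, hom_eval₂, map_zero]
      exact hfp⟩
    have hqalg' : IsAlgebraic G q.1 := hqalg
    rintro _ ⟨p, rfl⟩
    have h1 : IsAlgebraic G (aeval q.1 p) :=
      Algebra.adjoin_le (S := Subalgebra.algebraicClosure G K) (Set.singleton_subset_iff.2 hqalg')
        (aeval_mem_adjoin_singleton G q.1)
    have h2 : IsAlgebraic G₀ (aeval q.1 p) := h1.restrictScalars G₀
    rw [coe_eval₂RingHom, eval₂_fst]
    exact h2
  have hinv : ∀ p ∈ G, p⁻¹ ∈ G := by
    intro q hq
    by_cases hq0 : q.1 = 0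
    · have h2 := (hG.fst_eq_zero_iff hq).1 hq0
      have : q = 0 := Prod.ext hq0 h2
      rw [this, show (0 : K × K')⁻¹ = 0 from Prod.ext inv_zero inv_zero]
      exact zero_mem G
    have hq0' : q.2 ≠ 0 := mt (hG.fst_eq_zero_iff hq).2 hq0
    refine hext _ ⟨C ⟨q, hq⟩ * X - 1, ?_, ?_⟩ fun p => ?_
    · intro h
      have := congrArg (coeff · 0) h
      simp at this
    · have : q.1 * q.1⁻¹ - 1 = 0 := by rw [mul_inv_cancel₀ hq0, sub_self]
      simpa using this
    · obtain ⟨e, he1, he2⟩ := hG.exists_mul_pow_eq hq hq0 p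
      have h1 : 0 < q.1 ^ (2 * p.natDegree) := by rw [pow_mul]; positivity
      have h2 : 0 < q.2 ^ (2 * p.natDegree) := by rw [pow_mul]; positivity
      rw [← mul_nonneg_iff_of_pos_right h1, ← mul_nonneg_iff_of_pos_right h2, he1, he2]
      exact hG e e.2
  refine ⟨G, hG₀G, hG, hinv, ?_⟩
  suffices h : RelClosed (fstHom G) ∧ RelClosed (sndHom G) from ⟨h.1, h.2, halg⟩
  obtain ⟨E, _, _, _, e, hi, hj⟩ := hG.exists_orderedField hinv
  rw [← relClosed_comp_iff e, ← relClosed_comp_iff e]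
  by_contra hcon
  obtain ⟨u, u', ⟨f, hf, hfu⟩, hu, hp⟩ := exists_extension_of_not_relClosed hi hj hcon
  have := hext (u, u') ⟨f.map (e : E →+* G), (Polynomial.map_ne_zero_iff e.injective).2 hf, by
    rwa [eval₂_map]⟩ fun p => by
      have := hp (p.map (e.symm : G →+* E))
      simpa [eval₂_map, RingHom.comp_assoc] using this
  rcases hu with h | h
  · exact h (e.symm ⟨_, this⟩) (by simp)
  · exact h (e.symm ⟨_, this⟩) (by simp)

end OrdGraph

end OrdGraph

end RealClosed

end

/-! ## Equivalence to quantifier-free formulas -/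

noncomputable section

open FirstOrder FirstOrder.Language
open scoped Differential

namespace HFields

/-! ### Compactness -/

/-- Compactness: the variables become new constants, and by directedness a finite part of the
resulting theory follows from `T` and a single formula of `S`. -/
theorem exists_model_of_directed {M : FirstOrder.Language.{0, 0}} {α : Type} (T : M.Theory)
    (S : Set (M.Formula α)) (hne : S.Nonempty)
    (hdir : ∀ φ ∈ S, ∀ ψ ∈ S, ∃ θ ∈ S, ∀ (A : Type) [M.Structure A] (a : α → A),
      θ.Realize a → φ.Realize a ∧ ψ.Realize a)
    (h : ∀ φ ∈ S, ∃ (A : Type) (_ : M.Structure A) (_ : Nonempty A) (_ : A ⊨ T) (a : α → A),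
      φ.Realize a) :
    ∃ (A : Type) (_ : M.Structure A) (_ : Nonempty A) (_ : A ⊨ T) (a : α → A),
      ∀ φ ∈ S, φ.Realize a := by
  let T' : M[[α]].Theory := (M.lhomWithConstants α).onTheory T ∪ Formula.equivSentence '' S
  have hsat : T'.IsSatisfiable := by
    rw [Theory.isSatisfiable_iff_isFinitelySatisfiable]
    intro T₀ hT₀
    have key : ∃ θ ∈ S, ∀ (A : Type) [M[[α]].Structure A] [M.Structure A]
        [(M.lhomWithConstants α).IsExpansionOn A] [A ⊨ T],
        θ.Realize (fun a => (M.con a : A)) → ∀ σ ∈ T₀, A ⊨ σ := by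
      classical
      induction T₀ using Finset.induction_on with
      | empty =>
        obtain ⟨θ, hθ⟩ := hne
        exact ⟨θ, hθ, by simp⟩
      | insert σ T₁ _ ih =>
        rw [Finset.coe_insert, Set.insert_subset_iff] at hT₀
        obtain ⟨θ, hθ, hθ'⟩ := ih hT₀.2
        rcases hT₀.1 with hσ | ⟨φ, hφ, rfl⟩
        · refine ⟨θ, hθ, fun A _ _ _ _ hA τ hτ => ?_⟩
          rcases Finset.mem_insert.1 hτ with rfl | hτ
          · obtain ⟨ρ, hρ, rfl⟩ := hσ
            exact (LHom.realize_onSentence A _ ρ).2 (T.realize_sentence_of_mem hρ)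
          · exact hθ' A hA τ hτ
        · obtain ⟨θ', hθ'S, h'⟩ := hdir θ hθ φ hφ
          refine ⟨θ', hθ'S, fun A _ _ _ _ hA τ hτ => ?_⟩
          rcases Finset.mem_insert.1 hτ with rfl | hτ
          · exact (Formula.realize_equivSentence A φ).2 (h' A _ hA).2
          · exact hθ' A (h' A _ hA).1 τ hτ
    obtain ⟨θ, hθ, hθ'⟩ := key
    obtain ⟨A, _, _, _, a, ha⟩ := h θ hθ
    let : (constantsOn α).Structure A := constantsOn.structure a
    have : A ⊨ (T₀ : M[[α]].Theory) := ⟨fun σ hσ => hθ' A ha σ hσ⟩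
    exact Theory.Model.isSatisfiable A
  obtain ⟨N⟩ := hsat
  let : M.Structure N := (M.lhomWithConstants α).reduct N
  have : (M.lhomWithConstants α).IsExpansionOn N := LHom.isExpansionOn_reduct _ _
  refine ⟨N, inferInstance, inferInstance, ?_, fun a => (M.con a : N), fun φ hφ => ?_⟩
  · rw [← LHom.onTheory_model (M.lhomWithConstants α)]
    exact Theory.Model.mono N.is_model Set.subset_union_left
  · rw [← Formula.realize_equivSentence]
    exact N.is_model.realize_of_mem _ (.inr ⟨φ, hφ, rfl⟩)

/-- A formula whose truth is preserved between points with the same quantifier-free `L`-type is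
equivalent to a quantifier-free `L`-formula. -/
theorem exists_isQF_iff {L M : FirstOrder.Language.{0, 0}} (ι : L →ᴸ M) (T : M.Theory) {α : Type}
    (φ : M.Formula α)
    (h : ∀ (A B : Type) [M.Structure A] [M.Structure B] [Nonempty A] [Nonempty B] [A ⊨ T] [B ⊨ T]
      (a : α → A) (b : α → B), (∀ ψ : L.Formula α, ψ.IsQF →
        ((ι.onFormula ψ).Realize a ↔ (ι.onFormula ψ).Realize b)) → φ.Realize a → φ.Realize b) :
    ∃ ψ : L.Formula α, ψ.IsQF ∧ T.Iff φ (ι.onFormula ψ) := by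
  by_contra hcon
  push Not at hcon
  have hinf : ∀ (ψ θ : L.Formula α) (A : Type) [M.Structure A] (a : α → A),
      (ι.onFormula (ψ ⊓ θ)).Realize a ↔ (ι.onFormula ψ).Realize a ∧ (ι.onFormula θ).Realize a := by
    intro ψ θ A _ a
    let := ι.reduct A
    have := LHom.isExpansionOn_reduct ι A
    simp only [LHom.realize_onFormula, Formula.realize_inf]
  have hnot : ∀ (ψ : L.Formula α) (A : Type) [M.Structure A] (a : α → A),
      (ι.onFormula ψ.not).Realize a ↔ ¬ (ι.onFormula ψ).Realize a := by
    intro ψ A _ a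
    let := ι.reduct A
    have := LHom.isExpansionOn_reduct ι A
    simp only [LHom.realize_onFormula, Formula.realize_not]
  -- `Γ` consists of the quantifier-free consequences of `φ`. If `φ` is equivalent to none of them,
  -- then `Γ` is consistent with the negation of `φ`, which yields `a`.
  let Γ : Set (L.Formula α) := {ψ | ψ.IsQF ∧ ∀ (A : Type) [M.Structure A] [Nonempty A] [A ⊨ T]
    (a : α → A), φ.Realize a → (ι.onFormula ψ).Realize a}
  obtain ⟨A, _, _, _, a, ha⟩ := exists_model_of_directed T
    {χ | ∃ ψ ∈ Γ, χ = ι.onFormula ψ ⊓ φ.not} ⟨_, ⊤, ⟨BoundedFormula.IsQF.top, by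
      intro A _ _ _ a _
      let := ι.reduct A
      have := LHom.isExpansionOn_reduct ι A
      simp only [LHom.realize_onFormula, Formula.realize_top]⟩, rfl⟩ (by
      rintro _ ⟨ψ, hψ, rfl⟩ _ ⟨θ, hθ, rfl⟩
      refine ⟨_, ⟨ψ ⊓ θ, ⟨hψ.1.inf hθ.1, fun A _ _ _ a ha =>
        (hinf ψ θ A a).2 ⟨hψ.2 A a ha, hθ.2 A a ha⟩⟩, rfl⟩, fun A _ a ha => ?_⟩
      simp only [Formula.realize_inf, hinf] at ha ⊢
      exact ⟨⟨ha.1.1, ha.2⟩, ha.1.2, ha.2⟩) (by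
      rintro _ ⟨ψ, hψ, rfl⟩
      by_contra hc
      refine hcon ψ hψ.1 fun A v xs => ?_
      rw [BoundedFormula.realize_iff, Unique.eq_default xs]
      refine ⟨hψ.2 A v, fun h1 => ?_⟩
      by_contra h2
      exact hc ⟨A, inferInstance, inferInstance, inferInstance, v,
        Formula.realize_inf.2 ⟨h1, Formula.realize_not.2 h2⟩⟩)
  have haφ : ¬ φ.Realize a := by
    have := ha _ ⟨⊤, ⟨BoundedFormula.IsQF.top, by
      intro A _ _ _ a _
      let := ι.reduct A
      have := LHom.isExpansionOn_reduct ι A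
      simp only [LHom.realize_onFormula, Formula.realize_top]⟩, rfl⟩
    simp only [Formula.realize_inf, Formula.realize_not] at this
    exact this.2
  -- The quantifier-free type of `a` is consistent with `φ`: if some `ψ` in it were not, the
  -- negation of `ψ` would belong to `Γ` and hold at `a`.
  obtain ⟨B, _, _, _, b, hb⟩ := exists_model_of_directed T
    {χ | ∃ ψ : L.Formula α, ψ.IsQF ∧ (ι.onFormula ψ).Realize a ∧ χ = ι.onFormula ψ ⊓ φ}
    ⟨_, ⊤, BoundedFormula.IsQF.top, by
      let := ι.reduct A
      have := LHom.isExpansionOn_reduct ι A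
      simp only [LHom.realize_onFormula, Formula.realize_top], rfl⟩ (by
      rintro _ ⟨ψ, hψ, hψa, rfl⟩ _ ⟨θ, hθ, hθa, rfl⟩
      refine ⟨_, ⟨ψ ⊓ θ, hψ.inf hθ, (hinf ψ θ A a).2 ⟨hψa, hθa⟩, rfl⟩, fun A _ a ha => ?_⟩
      simp only [Formula.realize_inf, hinf] at ha ⊢
      exact ⟨⟨ha.1.1, ha.2⟩, ha.1.2, ha.2⟩) (by
      rintro _ ⟨ψ, hψ, hψa, rfl⟩
      by_contra hc
      have : ψ.not ∈ Γ := ⟨hψ.not, fun B _ _ _ b hb => (hnot ψ B b).2 fun h2 =>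
        hc ⟨B, inferInstance, inferInstance, inferInstance, b, Formula.realize_inf.2 ⟨h2, hb⟩⟩⟩
      have h3 := (Formula.realize_inf.1 (ha _ ⟨_, this, rfl⟩)).1
      exact (hnot ψ A a).1 h3 hψa)
  have hbψ : ∀ ψ : L.Formula α, ψ.IsQF → (ι.onFormula ψ).Realize a → (ι.onFormula ψ).Realize b :=
    fun ψ hψ h1 => (Formula.realize_inf.1 (hb _ ⟨ψ, hψ, h1, rfl⟩)).1
  have hbφ : φ.Realize b := by
    have h1 := hb (ι.onFormula ⊤ ⊓ φ) ⟨⊤, BoundedFormula.IsQF.top, by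
      let := ι.reduct A
      have := LHom.isExpansionOn_reduct ι A
      simp only [LHom.realize_onFormula, Formula.realize_top], rfl⟩
    exact (Formula.realize_inf.1 h1).2
  refine haφ (h B A b a (fun ψ hψ => ⟨fun h1 => ?_, hbψ ψ hψ⟩) hbφ)
  by_contra h2
  exact (hnot ψ B b).1 (hbψ ψ.not hψ.not ((hnot ψ A a).2 h2)) h1

/-! ### The theory of real closed fields -/

/-- The language of rings as a sublanguage of the language of ordered rings. -/
abbrev inclRing : FirstOrder.Language.ring →ᴸ langOR := LHom.sumInl

section Axioms

open FirstOrder.Ring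

/-- The terms of the language of rings as terms of the language of ordered rings. -/
abbrev orTerm {α : Type} (t : Language.ring.Term α) : langOR.Term α := inclRing.onTerm t

/-- Addition is monotone. -/
def addLeSentence : langOR.Sentence :=
  ∀' ∀' ∀' ((orTerm (&0)).le (orTerm (&1)) ⟹ (orTerm (&0 + &2)).le (orTerm (&1 + &2)))

/-- Products of nonnegative elements are nonnegative. -/
def mulNonnegSentence : langOR.Sentence :=
  ∀' ∀' ((orTerm 0).le (orTerm (&0)) ⟹ (orTerm 0).le (orTerm (&1)) ⟹
    (orTerm 0).le (orTerm (&0 * &1)))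

/-- Nonnegative elements are squares. -/
def sqrtSentence : langOR.Sentence :=
  ∀' ((orTerm 0).le (orTerm (&0)) ⟹ ∃' ((orTerm (&0)).bdEqual (orTerm (&1 * &1))))

variable {A : Type*} [Field A] [LinearOrder A] [S : langOR.Structure A] [CompatibleRing A]
  [inclRing.IsExpansionOn A] [langOR.OrderedStructure A]

theorem realize_addLeSentence :
    A ⊨ addLeSentence ↔ ∀ x y z : A, x ≤ y → x + z ≤ y + z := by
  simp [addLeSentence, Sentence.Realize, Formula.Realize, Fin.snoc]

theorem realize_mulNonnegSentence :
    A ⊨ mulNonnegSentence ↔ ∀ x y : A, 0 ≤ x → 0 ≤ y → 0 ≤ x * y := by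
  simp [mulNonnegSentence, Sentence.Realize, Formula.Realize, Fin.snoc]

theorem realize_sqrtSentence :
    A ⊨ sqrtSentence ↔ ∀ x : A, 0 ≤ x → ∃ y, x = y * y := by
  simp [sqrtSentence, Sentence.Realize, Formula.Realize, Fin.snoc]

/-- The theory of real closed fields in the language of ordered rings. -/
def theoryRCF : langOR.Theory :=
  inclRing.onTheory (Theory.field ∪ Field.genericMonicPolyHasRoot '' {n | Odd n}) ∪
    langOR.linearOrderTheory ∪ {addLeSentence, mulNonnegSentence, sqrtSentence}

end Axioms

end HFields

end

/-! ## Quantifier elimination for real closed fields -/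

noncomputable section

open FirstOrder FirstOrder.Language
open scoped Differential

namespace HFields

section Natural

open FirstOrder.Ring

variable (K : Type*) [Field K] [LinearOrder K]

theorem isExpansionOn_inclRing : letI := compatibleRingOfRing K; inclRing.IsExpansionOn K :=
  letI := compatibleRingOfRing K
  ⟨fun _ _ => rfl, fun r => nomatch r⟩

instance orderedStructure_langOR : langOR.OrderedStructure K := ⟨fun _ => Iff.rfl⟩

end Natural

section Models

open FirstOrder.Ring FirstOrder.Field

instance models_theoryRCF (K : Type*) [Field K] [LinearOrder K] [IsStrictOrderedRing K]
    [IsRealClosed K] : K ⊨ theoryRCF := by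
  let := compatibleRingOfRing K
  have := isExpansionOn_inclRing K
  rw [theoryRCF, Theory.model_union_iff, Theory.model_union_iff, LHom.onTheory_model,
    Theory.model_union_iff]
  refine ⟨⟨⟨inferInstance, ⟨?_⟩⟩, inferInstance⟩, ⟨?_⟩⟩
  · rintro _ ⟨n, hn, rfl⟩
    exact (realize_genericMonicPolyHasRoot n).2
      fun p => IsRealClosed.exists_isRoot_of_odd_natDegree (p.2.2.symm ▸ hn : Odd p.1.natDegree)
  · rintro _ (rfl | rfl | rfl)
    · exact realize_addLeSentence.2 fun x y z h => by gcongr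
    · exact realize_mulNonnegSentence.2 fun x y h h' => mul_nonneg h h'
    · exact realize_sqrtSentence.2 fun x h => IsRealClosed.nonneg_iff_isSquare.1 h

/-- The models of the theory of real closed fields are the real closed fields. -/
theorem exists_realClosed_of_models (A : Type*) [S : langOR.Structure A] [hA : A ⊨ theoryRCF] :
    ∃ (_ : Field A) (_ : LinearOrder A) (_ : IsStrictOrderedRing A),
      IsRealClosed A ∧ S = structureOR A := by
  classical
  let := inclRing.reduct A
  have := LHom.isExpansionOn_reduct inclRing A
  obtain ⟨⟨⟨hfield, hroot⟩, hord⟩, hax⟩ := (by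
    simpa only [theoryRCF, Theory.model_union_iff, LHom.onTheory_model] using hA :
    ((A ⊨ Theory.field ∧ A ⊨ genericMonicPolyHasRoot '' {n | Odd n}) ∧
      A ⊨ langOR.linearOrderTheory) ∧
      A ⊨ ({addLeSentence, mulNonnegSentence, sqrtSentence} : langOR.Theory))
  let iF : Field A := fieldOfModelField A
  let := compatibleRingOfModelField A
  let iO : LinearOrder A := langOR.linearOrderOfModels A
  have : langOR.OrderedStructure A := ⟨fun x => by
    have hx : x = ![x 0, x 1] := by ext k; fin_cases k <;> rfl
    rw [hx]
    exact Iff.rfl⟩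
  have h1 : A ⊨ addLeSentence := hax.realize_of_mem _ (by simp)
  have h2 : A ⊨ mulNonnegSentence := hax.realize_of_mem _ (by simp)
  have h3 : A ⊨ sqrtSentence := hax.realize_of_mem _ (by simp)
  have h4 : ∀ n, Odd n → A ⊨ genericMonicPolyHasRoot n := fun n hn =>
    hroot.realize_of_mem _ ⟨n, hn, rfl⟩
  rw [realize_addLeSentence] at h1
  rw [realize_mulNonnegSentence] at h2
  rw [realize_sqrtSentence] at h3
  have i1 : IsOrderedAddMonoid A := ⟨fun a b h c => h1 a b c h, fun a b h c => by
    rw [add_comm c, add_comm c]; exact h1 a b c h⟩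
  have i0 : ZeroLEOneClass A := ⟨by
    rcases le_total 0 (1 : A) with h | h
    · exact h
    · have h5 := h1 1 0 (-1) h
      rw [add_neg_cancel, zero_add] at h5
      have := h2 _ _ h5 h5
      rwa [neg_mul_neg, one_mul] at this⟩
  have i2 : IsOrderedRing A := IsOrderedRing.of_mul_nonneg h2
  have i3 : IsStrictOrderedRing A := IsOrderedRing.toIsStrictOrderedRing A
  refine ⟨iF, iO, i3, .of_linearOrderedField (fun h => h3 _ h) fun {f} hf => ?_, ?_⟩
  · have hf0 : f ≠ 0 := by rintro rfl; simp at hf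
    obtain ⟨x, hx⟩ := (realize_genericMonicPolyHasRoot _).1 (h4 _ hf)
      ⟨f * Polynomial.C f.leadingCoeff⁻¹, Polynomial.monic_mul_leadingCoeff_inv hf0,
        Polynomial.natDegree_mul_leadingCoeff_inv f hf0⟩
    refine ⟨x, ?_⟩
    rw [Polynomial.eval_mul, Polynomial.eval_C, mul_eq_zero] at hx
    exact hx.resolve_right (inv_ne_zero (Polynomial.leadingCoeff_ne_zero.2 hf0))
  · ext n f x
    · rcases f with f | f
      · change S.funMap (inclRing.onFunction f) x = _
        rw [LHom.map_onFunction]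
        cases f
        · exact CompatibleRing.funMap_add x
        · exact CompatibleRing.funMap_mul x
        · exact CompatibleRing.funMap_neg x
        · exact CompatibleRing.funMap_zero x
        · exact CompatibleRing.funMap_one x
      · exact nomatch f
    · rcases f with f | f
      · exact nomatch f
      · cases f
        exact relMap_leSymb x

end Models

/-! ### Moving witnesses between real closed fields. -/

section Transfer

open FirstOrder.Ring RealClosed

variable {K K' : Type*} [Field K] [LinearOrder K] [IsStrictOrderedRing K]
  [Field K'] [LinearOrder K'] [IsStrictOrderedRing K']

theorem OrdGraph.term_realize_mem (G : Subring (K × K')) {α : Type*} {v : α → K} {w : α → K'}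
    (h : ∀ a, (v a, w a) ∈ G) (t : langOR.Term α) : (t.realize v, t.realize w) ∈ G := by
  induction t with
  | var a => exact h a
  | func f ts ih =>
    rcases f with f | f
    · cases f
      · exact add_mem (ih 0) (ih 1)
      · exact mul_mem (ih 0) (ih 1)
      · exact neg_mem (ih 0)
      · exact zero_mem G
      · exact one_mem G
    · exact nomatch f

theorem OrdGraph.realize_iff_of_isQF {G : Subring (K × K')} (hG : OrdGraph G) {α : Type*} {n : ℕ}
    {φ : langOR.BoundedFormula α n} (hφ : φ.IsQF) {v : α → K} {w : α → K'} {xs : Fin n → K}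
    {ys : Fin n → K'} (h : ∀ a, (v a, w a) ∈ G) (h' : ∀ k, (xs k, ys k) ∈ G) :
    φ.Realize v xs ↔ φ.Realize w ys := by
  have hmem : ∀ t : langOR.Term (α ⊕ Fin n),
      (t.realize (Sum.elim v xs), t.realize (Sum.elim w ys)) ∈ G := fun t =>
    OrdGraph.term_realize_mem G (by rintro (a | k); exacts [h a, h' k]) t
  induction hφ with
  | falsum => exact Iff.rfl
  | of_isAtomic h =>
    cases h with
    | equal t₁ t₂ => exact hG.eq_iff (hmem t₁) (hmem t₂)
    | rel R ts =>
      rcases R with R | R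
      · exact nomatch R
      · cases R
        exact hG.le_iff (hmem (ts 0)) (hmem (ts 1))
  | imp _ _ ih₁ ih₂ => exact imp_congr ih₁ ih₂


open Polynomial in
theorem exists_poly_term_realize {E : Type*} [CommRing E] (i : E →+* K) {α : Type*} {n : ℕ}
    (v : α → E) (xs : Fin n → E) (t : langOR.Term (α ⊕ Fin (n + 1))) :
    ∃ p : E[X], ∀ z : K, t.realize (Sum.elim (i ∘ v) (Fin.snoc (i ∘ xs) z : Fin (n + 1) → K)) =
      p.eval₂ i z := by
  induction t with
  | var a =>
    rcases a with a | k
    · exact ⟨C (v a), fun z => by simp⟩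
    · refine Fin.lastCases ⟨X, fun z => by simp⟩ (fun k => ⟨C (xs k), fun z => by simp⟩) k
  | func f ts ih =>
    choose p hp using ih
    rcases f with f | f
    · cases f
      · exact ⟨p 0 + p 1, fun z => by rw [eval₂_add, ← hp, ← hp]; rfl⟩
      · exact ⟨p 0 * p 1, fun z => by rw [eval₂_mul, ← hp, ← hp]; rfl⟩
      · exact ⟨-p 0, fun z => by rw [eval₂_neg, ← hp]; rfl⟩
      · exact ⟨0, fun z => by rw [eval₂_zero]; rfl⟩
      · exact ⟨1, fun z => by rw [eval₂_one]; rfl⟩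
    · exact nomatch f

-- Atomic formulas compare polynomials over `E`, and by relative closedness the roots of these lie
-- in `E`. So truth at a point outside `E` depends only on its position among finitely many elements
-- of `E`.
open Polynomial in
theorem exists_finset_of_isQF [IsRealClosed K] {E : Type*} [Field E] (i : E →+* K)
    (hi : RelClosed i) {α : Type*} {n : ℕ} (v : α → E) (xs : Fin n → E) {x : K}
    (hx : ∀ e, i e ≠ x) {φ : langOR.BoundedFormula α (n + 1)} (hφ : φ.IsQF) :
    ∃ S : Finset E, ∀ z : K, (∀ s ∈ S, i s ≠ z ∧ (i s < x ↔ i s < z)) →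
      (φ.Realize (i ∘ v) (Fin.snoc (i ∘ xs) x) ↔ φ.Realize (i ∘ v) (Fin.snoc (i ∘ xs) z)) := by
  classical
  have hroot : ∀ p : E[X], p ≠ 0 → ∀ z : K, p.eval₂ i z = 0 → ∃ s ∈ p.roots.toFinset, i s = z := by
    intro p hp z hz
    obtain ⟨e, rfl⟩ := hi p hp z hz
    rw [eval₂_at_apply, map_eq_zero] at hz
    exact ⟨e, by simp [hp, hz], rfl⟩
  induction hφ with
  | falsum => exact ⟨∅, fun _ _ => Iff.rfl⟩
  | of_isAtomic h =>
    cases h with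
    | equal t₁ t₂ =>
      obtain ⟨p₁, hp₁⟩ := exists_poly_term_realize i v xs t₁
      obtain ⟨p₂, hp₂⟩ := exists_poly_term_realize i v xs t₂
      refine ⟨(p₁ - p₂).roots.toFinset, fun z hz => ?_⟩
      change t₁.realize _ = t₂.realize _ ↔ t₁.realize _ = t₂.realize _
      rw [hp₁, hp₁, hp₂, hp₂]
      by_cases hp : p₁ - p₂ = 0
      · simp [sub_eq_zero.1 hp]
      · rw [← sub_eq_zero, ← eval₂_sub, ← sub_eq_zero (b := eval₂ i z p₂), ← eval₂_sub]
        refine iff_of_false (fun h => ?_) fun h => ?_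
        · obtain ⟨s, -, hs⟩ := hroot _ hp _ h
          exact hx s hs
        · obtain ⟨s, hsS, hs⟩ := hroot _ hp _ h
          exact (hz s hsS).1 hs
    | rel R ts =>
      rcases R with R | R
      · exact nomatch R
      · cases R
        obtain ⟨p₁, hp₁⟩ := exists_poly_term_realize i v xs (ts 0)
        obtain ⟨p₂, hp₂⟩ := exists_poly_term_realize i v xs (ts 1)
        refine ⟨(p₂ - p₁).roots.toFinset, fun z hz => ?_⟩
        change (ts 0).realize _ ≤ (ts 1).realize _ ↔ (ts 0).realize _ ≤ (ts 1).realize _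
        rw [hp₁, hp₁, hp₂, hp₂]
        by_cases hp : p₂ - p₁ = 0
        · simp [sub_eq_zero.1 hp]
        · rw [← sub_nonneg, ← eval₂_sub, ← sub_nonneg (b := eval₂ i z p₁), ← eval₂_sub]
          have h : 0 < (p₂ - p₁).eval₂ i x * (p₂ - p₁).eval₂ i z := by
            rw [← eval_map, ← eval_map]
            refine eval_mul_eval_pos' fun y hy hy0 => ?_
            rw [eval_map] at hy0
            obtain ⟨s, hsS, rfl⟩ := hroot _ hp _ hy0
            have h1 := hx s
            obtain ⟨h2, h3⟩ := hz s hsS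
            rcases lt_or_gt_of_ne h1 with h4 | h4
            · exact hy.1.not_gt (lt_min h4 (h3.1 h4))
            · refine hy.2.not_gt (max_lt h4 ?_)
              exact lt_of_le_of_ne (not_lt.1 (mt h3.2 h4.not_gt)) h2.symm
          constructor
          · intro h1
            exact (pos_of_mul_pos_right h h1).le
          · intro h1
            exact (pos_of_mul_pos_left h h1).le
  | imp _ _ ih₁ ih₂ =>
    obtain ⟨S₁, h₁⟩ := ih₁
    obtain ⟨S₂, h₂⟩ := ih₂
    exact ⟨S₁ ∪ S₂, fun z hz => imp_congr
      (h₁ z fun s hs => hz s (Finset.mem_union_left _ hs))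
      (h₂ z fun s hs => hz s (Finset.mem_union_right _ hs))⟩

/-- After extending the graph to relatively closed fields, a witness outside `E` can be replaced by
a point of `E` in the same position relative to a finite set. The graph then carries that point to
`K'`. -/
theorem OrdGraph.realize_ex_of_isQF [IsRealClosed K] [IsRealClosed K'] {G : Subring (K × K')}
    (hG : OrdGraph G) {α : Type*} {n : ℕ} {φ : langOR.BoundedFormula α (n + 1)} (hφ : φ.IsQF)
    {v : α → K} {w : α → K'} {xs : Fin n → K} {ys : Fin n → K'} (h : ∀ a, (v a, w a) ∈ G)
    (h' : ∀ k, (xs k, ys k) ∈ G) (hex : φ.ex.Realize v xs) : φ.ex.Realize w ys := by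
  obtain ⟨H, hGH, hH, hinv, hcl, -, -⟩ := hG.exists_relClosed
  obtain ⟨E, _, _, _, e, hi, hj⟩ := hH.exists_orderedField hinv
  rw [← relClosed_comp_iff e] at hcl
  set i := (fstHom H).comp (e : E →+* H) with hidef
  have hsi := hi.strictMono_of_injective i.injective
  obtain ⟨x, hx⟩ := BoundedFormula.realize_ex.1 hex
  suffices hs : ∃ z : E, φ.Realize v (Fin.snoc xs (i z)) by
    obtain ⟨z, hz⟩ := hs
    refine BoundedFormula.realize_ex.2 ⟨(e z).1.2, ?_⟩
    refine (OrdGraph.realize_iff_of_isQF hH hφ (fun a => hGH (h a)) ?_).1 hz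
    intro k
    refine Fin.lastCases ?_ (fun k => ?_) k
    · simp only [Fin.snoc_last]
      exact (e z).2
    · simp only [Fin.snoc_castSucc]
      exact hGH (h' k)
  by_cases hxi : ∃ z, i z = x
  · obtain ⟨z, rfl⟩ := hxi
    exact ⟨z, hx⟩
  push Not at hxi
  let v' : α → E := fun a => e.symm ⟨_, hGH (h a)⟩
  let xs' : Fin n → E := fun k => e.symm ⟨_, hGH (h' k)⟩
  have hv : i ∘ v' = v := by ext a; simp [v', i]
  have hxs : i ∘ xs' = xs := by ext a; simp [xs', i]
  obtain ⟨S, hS⟩ := exists_finset_of_isQF i hcl v' xs' hxi hφ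
  rw [hv, hxs] at hS
  obtain ⟨z, hz1, hz2⟩ := Order.exists_between_finsets (S.filter (i · < x)) (S.filter (x < i ·))
    (fun a ha b hb => hsi.lt_iff_lt.1
      ((Finset.mem_filter.1 ha).2.trans (Finset.mem_filter.1 hb).2))
  refine ⟨z, (hS (i z) fun s hs => ?_).1 hx⟩
  rcases lt_or_gt_of_ne (hxi s) with h1 | h1
  · have h2 := hsi (hz1 s (Finset.mem_filter.2 ⟨hs, h1⟩))
    exact ⟨h2.ne, iff_of_true h1 h2⟩
  · have h2 := hsi (hz2 s (Finset.mem_filter.2 ⟨hs, h1⟩))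
    exact ⟨h2.ne', iff_of_false h1.not_gt h2.not_gt⟩

theorem exists_term_of_mem_closure {α : Type*} {v : α → K} {w : α → K'} {p : K × K'}
    (hp : p ∈ Subring.closure (Set.range fun a => (v a, w a))) :
    ∃ t : langOR.Term α, p = (t.realize v, t.realize w) := by
  induction hp using Subring.closure_induction with
  | mem p hp =>
    obtain ⟨a, rfl⟩ := hp
    exact ⟨Term.var a, rfl⟩
  | zero => exact ⟨inclRing.onTerm 0, rfl⟩
  | one => exact ⟨inclRing.onTerm 1, rfl⟩
  | add p q _ _ hp hq =>
    obtain ⟨t, rfl⟩ := hp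
    obtain ⟨s, rfl⟩ := hq
    exact ⟨Term.func (inclRing.onFunction addFunc) ![t, s], rfl⟩
  | mul p q _ _ hp hq =>
    obtain ⟨t, rfl⟩ := hp
    obtain ⟨s, rfl⟩ := hq
    exact ⟨Term.func (inclRing.onFunction mulFunc) ![t, s], rfl⟩
  | neg p _ hp =>
    obtain ⟨t, rfl⟩ := hp
    exact ⟨Term.func (inclRing.onFunction negFunc) ![t], rfl⟩

/-- Points with the same quantifier-free type generate an order graph. -/
theorem ordGraph_closure_of_isQF {α : Type*} {v : α → K} {w : α → K'}
    (h : ∀ ψ : langOR.Formula α, ψ.IsQF → (ψ.Realize v ↔ ψ.Realize w)) :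
    OrdGraph (Subring.closure (Set.range fun a => (v a, w a))) := by
  intro p hp
  obtain ⟨t, rfl⟩ := exists_term_of_mem_closure hp
  have := h ((leSymb : langOR.Relations 2).formula₂ (inclRing.onTerm 0) t)
    (Relations.isQF _ _)
  rw [Formula.realize_rel₂, Formula.realize_rel₂] at this
  exact this

/-- Quantifier elimination for real closed fields. -/
theorem exists_isQF_iff_theoryRCF {α : Type} {n : ℕ} (φ : langOR.BoundedFormula α n) :
    ∃ ψ : langOR.BoundedFormula α n, ψ.IsQF ∧ theoryRCF.Iff φ ψ := by
  induction φ using BoundedFormula.induction_on_exists_not with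
  | hqf h => exact ⟨_, h, Theory.Iff.refl _⟩
  | hnot h =>
    obtain ⟨ψ, hψ, h⟩ := h
    exact ⟨ψ.not, hψ.not, h.not⟩
  | hex h =>
    obtain ⟨ψ, hψ, h⟩ := h
    rename_i m φ
    obtain ⟨χ, hχ, hχ'⟩ := exists_isQF_iff (LHom.id langOR) theoryRCF ψ.ex.toFormula (by
      intro A B SA SB _ _ _ _ a b hab hA
      obtain ⟨_, _, _, _, rfl⟩ := exists_realClosed_of_models A
      obtain ⟨_, _, _, _, rfl⟩ := exists_realClosed_of_models B
      simp only [LHom.onFormula, LHom.id_onBoundedFormula, id] at hab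
      rw [BoundedFormula.realize_toFormula] at hA ⊢
      exact OrdGraph.realize_ex_of_isQF (ordGraph_closure_of_isQF hab) hψ
        (fun k => Subring.subset_closure ⟨.inl k, rfl⟩)
        (fun k => Subring.subset_closure ⟨.inr k, rfl⟩) hA)
    refine ⟨BoundedFormula.relabel (id : α ⊕ Fin m → α ⊕ Fin m) χ, hχ.relabel _, ?_⟩
    refine h.ex.trans fun A v xs => ?_
    rw [BoundedFormula.realize_iff, BoundedFormula.realize_relabel]
    have := hχ'.realize_iff (M := A) (v := Sum.elim v xs)
    rw [BoundedFormula.realize_toFormula] at this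
    simp only [LHom.onFormula, LHom.id_onBoundedFormula, id] at this
    exact this.trans (iff_of_eq (congrArg (BoundedFormula.Realize χ _) (Subsingleton.elim _ _)))
  | hse h =>
    have h' : theoryRCF.Iff _ _ := fun A v xs =>
      (BoundedFormula.realize_iff.2 (h.realize_bd_iff (M := A) (v := v) (xs := xs)))
    exact exists_congr fun ψ => and_congr_right fun _ => ⟨h'.symm.trans, h'.trans⟩

end Transfer

end HFields

end

/-! ## Semialgebraic functions in real closed fields -/

noncomputable section

open FirstOrder FirstOrder.Language
open scoped Differential

namespace HFields

open FirstOrder.Ring RealClosed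

/-! ### Transfer from `ℝ` and the interpretation of semialgebraic functions. -/

section Tarski

/-- The variables of a formula as bound variables. -/
def bindVars {L : FirstOrder.Language.{0, 0}} {m : ℕ} (φ : L.Formula (Fin m)) :
    L.BoundedFormula Empty m :=
  BoundedFormula.relabel (n := m) (k := 0) Sum.inr φ

theorem realize_bindVars {L : FirstOrder.Language.{0, 0}} {A : Type*} [L.Structure A] {m : ℕ}
    (φ : L.Formula (Fin m)) (v : Empty → A) (x : Fin m → A) :
    (bindVars φ).Realize v x ↔ φ.Realize x :=
  Formula.realize_relabel_sumInr φ

/-- The formula `∃ y, φ(x, y)`. -/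
def exLast {n : ℕ} (φ : langOR.Formula (Fin (n + 1))) : langOR.Formula (Fin n) :=
  BoundedFormula.ex (n := 0) (BoundedFormula.relabel (n := 1) (k := 0)
    (Fin.snoc (α := fun _ => Fin n ⊕ Fin 1) Sum.inl (Sum.inr 0)) φ)

theorem realize_exLast {A : Type*} [langOR.Structure A] {n : ℕ}
    (φ : langOR.Formula (Fin (n + 1))) (x : Fin n → A) :
    (exLast φ).Realize x ↔ ∃ y, φ.Realize (Fin.snoc x y : Fin (n + 1) → A) := by
  rw [exLast, Formula.Realize, BoundedFormula.realize_ex]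
  refine exists_congr fun y => ?_
  rw [BoundedFormula.realize_relabel, Formula.Realize]
  refine iff_of_eq (congrArg₂ (BoundedFormula.Realize φ) ?_ (Subsingleton.elim _ _))
  ext k
  refine Fin.lastCases ?_ (fun k => ?_) k
  · simp
    rfl
  · simp

/-- The formula `φ(x, y)` in the variables `x, y, z`. -/
def dropLast {n : ℕ} (φ : langOR.Formula (Fin (n + 1))) : langOR.Formula (Fin (n + 2)) :=
  φ.relabel Fin.castSucc

/-- The formula `φ(x, z)` in the variables `x, y, z`. -/
def dropMiddle {n : ℕ} (φ : langOR.Formula (Fin (n + 1))) : langOR.Formula (Fin (n + 2)) :=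
  φ.relabel (Fin.snoc (α := fun _ => Fin (n + 2)) (fun k => k.castSucc.castSucc) (Fin.last _))

theorem realize_dropLast {A : Type*} [langOR.Structure A] {n : ℕ}
    (φ : langOR.Formula (Fin (n + 1))) (x : Fin (n + 1) → A) (z : A) :
    (dropLast φ).Realize (Fin.snoc x z : Fin (n + 2) → A) ↔ φ.Realize x := by
  rw [dropLast, Formula.realize_relabel]
  refine iff_of_eq (congrArg φ.Realize ?_)
  ext k
  simp

theorem realize_dropMiddle {A : Type*} [langOR.Structure A] {n : ℕ}
    (φ : langOR.Formula (Fin (n + 1))) (x : Fin n → A) (y z : A) :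
    (dropMiddle φ).Realize (Fin.snoc (Fin.snoc x y : Fin (n + 1) → A) z : Fin (n + 2) → A) ↔
      φ.Realize (Fin.snoc x z : Fin (n + 1) → A) := by
  rw [dropMiddle, Formula.realize_relabel]
  refine iff_of_eq (congrArg φ.Realize ?_)
  ext k
  refine Fin.lastCases ?_ (fun k => ?_) k
  · simp
  · simp

variable {K K' : Type*} [Field K] [LinearOrder K] [IsStrictOrderedRing K] [IsRealClosed K]
  [Field K'] [LinearOrder K'] [IsStrictOrderedRing K'] [IsRealClosed K']

/-- The transfer principle for real closed fields, with parameters. -/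
theorem OrdGraph.realize_iff {G : Subring (K × K')} (hG : OrdGraph G) {α : Type} {n : ℕ}
    (φ : langOR.BoundedFormula α n) {v : α → K} {w : α → K'} {xs : Fin n → K} {ys : Fin n → K'}
    (h : ∀ a, (v a, w a) ∈ G) (h' : ∀ k, (xs k, ys k) ∈ G) :
    φ.Realize v xs ↔ φ.Realize w ys := by
  obtain ⟨ψ, hψ, hφψ⟩ := exists_isQF_iff_theoryRCF φ
  rw [hφψ.realize_bd_iff, hφψ.realize_bd_iff]
  exact OrdGraph.realize_iff_of_isQF hG hψ h h'

/-- Real closed fields are elementarily equivalent. -/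
theorem realize_of_realize_real {m : ℕ} (φ : langOR.Formula (Fin m))
    (h : ∀ x : Fin m → ℝ, φ.Realize x) (x : Fin m → K) : φ.Realize x := by
  -- The integers, embedded diagonally, have the same signs in both fields. This graph suffices
  -- because a sentence has no parameters.
  let G : Subring (ℝ × K) := (Int.castRingHom (ℝ × K)).range
  have hG : OrdGraph G := by
    rintro _ ⟨n, rfl⟩
    simp
  have h1 : (bindVars φ).alls.Realize (default : Empty → ℝ) :=
    BoundedFormula.realize_alls.2 fun x => (realize_bindVars φ _ x).2 (h x)
  have h2 : (bindVars φ).alls.Realize (default : Empty → K) :=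
    (OrdGraph.realize_iff hG _ (fun a => a.elim) (fun k => k.elim0)).1 h1
  exact (realize_bindVars φ _ x).1 (BoundedFormula.realize_alls.1 h2 x)

theorem existsUnique_of_real {n : ℕ} (φ : langOR.Formula (Fin (n + 1)))
    (h : ∀ x : Fin n → ℝ, ∃! y, φ.Realize (Fin.snoc x y : Fin (n + 1) → ℝ)) (x : Fin n → K) :
    ∃! y, φ.Realize (Fin.snoc x y : Fin (n + 1) → K) := by
  obtain ⟨y, hy⟩ := (realize_exLast φ x).1 (realize_of_realize_real (exLast φ)
    (fun x => (realize_exLast φ x).2 (h x).exists) x)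
  refine ⟨y, hy, fun z hz => ?_⟩
  let χ : langOR.Formula (Fin (n + 2)) := (dropLast φ ⊓ dropMiddle φ).imp
    (Term.equal (Term.var (Fin.last n).castSucc) (Term.var (Fin.last (n + 1))))
  have hχ : χ.Realize (Fin.snoc (Fin.snoc x y : Fin (n + 1) → K) z : Fin (n + 2) → K) := by
    refine realize_of_realize_real χ (fun u => ?_) _
    obtain ⟨u, c, rfl⟩ : ∃ (u' : Fin (n + 1) → ℝ) (c : ℝ), u = Fin.snoc u' c :=
      ⟨Fin.init u, u (Fin.last _), (Fin.snoc_init_self u).symm⟩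
    obtain ⟨u, b, rfl⟩ : ∃ (u' : Fin n → ℝ) (b : ℝ), u = Fin.snoc u' b :=
      ⟨Fin.init u, u (Fin.last _), (Fin.snoc_init_self u).symm⟩
    rw [Formula.realize_imp, Formula.realize_inf, realize_dropLast, realize_dropMiddle,
      Formula.realize_equal]
    rintro ⟨h1, h2⟩
    simpa using (h u).unique h1 h2
  rw [Formula.realize_imp, Formula.realize_inf, realize_dropLast, realize_dropMiddle,
    Formula.realize_equal] at hχ
  simpa using (hχ ⟨hy, hz⟩).symm

/-- Unique existence transfers from `ℝ`, so the default value in `SemialgFun.interp` is never taken.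
-/
theorem SemialgFun.realize_graph {n : ℕ} (f : SemialgFun n) (x : Fin n → K) (y : K) :
    f.graph.Realize (Fin.snoc x y : Fin (n + 1) → K) ↔ y = f.interp K x := by
  classical
  obtain ⟨z, hz, huniq⟩ := existsUnique_of_real (K := K) f.graph
    (fun x => ⟨f.1 x, (f.2.choose_spec.2 x _).2 rfl, fun y hy => (f.2.choose_spec.2 x y).1 hy⟩) x
  have hex : ∃ y : K, f.graph.Realize (Fin.snoc x y : Fin (n + 1) → K) := ⟨z, hz⟩
  have h1 : f.interp K x = z := by
    rw [SemialgFun.interp, dif_pos hex]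
    exact huniq _ hex.choose_spec
  rw [h1]
  exact ⟨huniq y, fun h => h ▸ hz⟩

/-- Every first-order definable function on `ℝ` is semialgebraic. -/
theorem exists_semialgFun {n : ℕ} (φ : langOR.Formula (Fin (n + 1)))
    (h : ∀ x : Fin n → ℝ, ∃! y, φ.Realize (Fin.snoc x y : Fin (n + 1) → ℝ)) :
    ∃ f : SemialgFun n, ∀ (K : Type*) [Field K] [LinearOrder K] [IsStrictOrderedRing K]
      [IsRealClosed K] (x : Fin n → K), φ.Realize (Fin.snoc x (f.interp K x) : Fin (n + 1) → K) := by
  obtain ⟨ψ, hψ, hφψ⟩ := exists_isQF_iff_theoryRCF φ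
  have hφψ' : ∀ v : Fin (n + 1) → ℝ, φ.Realize v ↔ Formula.Realize ψ v := fun v =>
    hφψ.realize_iff
  let f : SemialgFun n := ⟨fun x => (h x).choose, ψ, hψ, fun x y => by
    rw [← hφψ']
    exact ⟨fun hy => (h x).unique hy (h x).choose_spec.1, fun hy => hy ▸ (h x).choose_spec.1⟩⟩
  refine ⟨f, fun K _ _ _ _ x => ?_⟩
  have h1 := realize_of_realize_real (K := K) (f.graph.imp φ) (fun u => by
    obtain ⟨u, c, rfl⟩ : ∃ (u' : Fin n → ℝ) (b : ℝ), u = Fin.snoc u' b :=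
      ⟨Fin.init u, u (Fin.last _), (Fin.snoc_init_self u).symm⟩
    rw [Formula.realize_imp]
    intro hu
    have := (f.2.choose_spec.2 u c).1 hu
    rw [this]
    exact (h u).choose_spec.1) (Fin.snoc x (f.interp K x))
  rw [Formula.realize_imp] at h1
  exact h1 ((f.realize_graph x _).2 rfl)

/-- Semialgebraic functions commute with embeddings of real closed fields. -/
theorem SemialgFun.map_interp {n : ℕ} (f : SemialgFun n) {i : K →+* K'} (hi : Monotone i)
    (x : Fin n → K) : i (f.interp K x) = f.interp K' (i ∘ x) := by
  have hG : OrdGraph ((RingHom.id K).prod i).range := by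
    rintro _ ⟨a, rfl⟩
    change 0 ≤ a ↔ 0 ≤ i a
    rw [← map_zero i, (hi.strictMono_of_injective i.injective).le_iff_le]
  rw [← f.realize_graph]
  refine (OrdGraph.realize_iff hG f.graph (v := Fin.snoc x (f.interp K x)) (fun k => ?_)
    (fun k => k.elim0)).1 ((f.realize_graph x _).2 rfl)
  refine Fin.lastCases ?_ (fun k => ?_) k
  · rw [Fin.snoc_last, Fin.snoc_last]
    exact ⟨_, rfl⟩
  · rw [Fin.snoc_castSucc, Fin.snoc_castSucc]
    exact ⟨_, rfl⟩

end Tarski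

/-! ### Subrings closed under semialgebraic functions. -/

section Closed

/-- The variable with index `k` as a term in the language of rings. -/
abbrev ringVar {n : ℕ} (k : Fin n) : Language.ring.Term (Fin n) := Term.var k

/-- The formula `x * y = 1 ∨ x = 0 ∧ y = 0`. -/
def invFormula : langOR.Formula (Fin 2) :=
  (inclRing.onTerm (ringVar 0 * ringVar 1)).equal (inclRing.onTerm 1) ⊔
    ((inclRing.onTerm (ringVar 0)).equal (inclRing.onTerm 0) ⊓
      (inclRing.onTerm (ringVar 1)).equal (inclRing.onTerm 0))

/-- The formula `0 ≤ y ∧ y * y = x ∨ ¬ 0 ≤ x ∧ y = 0`. -/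
def sqrtFormula : langOR.Formula (Fin 2) :=
  ((leSymb.formula₂ (inclRing.onTerm 0) (inclRing.onTerm (ringVar 1))) ⊓
    (inclRing.onTerm (ringVar 1 * ringVar 1)).equal (inclRing.onTerm (ringVar 0))) ⊔
  ((leSymb.formula₂ (inclRing.onTerm 0) (inclRing.onTerm (ringVar 0))).not ⊓
    (inclRing.onTerm (ringVar 1)).equal (inclRing.onTerm 0))

/-- The formula saying that `y` is a root of the monic polynomial with coefficients `x`. -/
def monicRootFormula (n : ℕ) : langOR.Formula (Fin (n + 1)) :=
  (inclRing.onTerm (termOfFreeCommRing (Field.genericMonicPoly n))).equal (inclRing.onTerm 0)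

/-- The formula saying that `y` is the least root of the monic polynomial with coefficients `x`. -/
def leastRootFormula (n : ℕ) : langOR.Formula (Fin (n + 1)) :=
  monicRootFormula n ⊓ (exLast (dropMiddle (monicRootFormula n) ⊓
    (leSymb.formula₂ (Term.var (Fin.last n).castSucc) (Term.var (Fin.last (n + 1)))).not)).not

variable {K : Type*} [Field K] [LinearOrder K]

theorem realize_invFormula (x y : K) :
    invFormula.Realize (Fin.snoc (![x] : Fin 1 → K) y : Fin 2 → K) ↔
      x * y = 1 ∨ x = 0 ∧ y = 0 := by
  let := compatibleRingOfRing K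
  simp [invFormula, Formula.realize_equal]

theorem realize_leSymb {α : Type*} (s t : langOR.Term α) (v : α → K) :
    (leSymb.formula₂ s t).Realize v ↔ s.realize v ≤ t.realize v := Formula.realize_rel₂

theorem realize_sqrtFormula (x y : K) :
    sqrtFormula.Realize (Fin.snoc (![x] : Fin 1 → K) y : Fin 2 → K) ↔
      (0 ≤ y ∧ y * y = x) ∨ (¬ 0 ≤ x ∧ y = 0) := by
  let := compatibleRingOfRing K
  simp [sqrtFormula, Formula.realize_equal]

theorem realize_monicRootFormula {n : ℕ} (x : Fin n → K) (y : K) :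
    (monicRootFormula n).Realize (Fin.snoc x y : Fin (n + 1) → K) ↔
      y ^ n + ∑ k : Fin n, x k * y ^ (k : ℕ) = 0 := by
  let := compatibleRingOfRing K
  simp [monicRootFormula, Formula.realize_equal, Field.genericMonicPoly]

theorem realize_leastRootFormula {n : ℕ} (x : Fin n → K) (y : K) :
    (leastRootFormula n).Realize (Fin.snoc x y : Fin (n + 1) → K) ↔
      y ^ n + ∑ k : Fin n, x k * y ^ (k : ℕ) = 0 ∧
        ∀ z, z ^ n + ∑ k : Fin n, x k * z ^ (k : ℕ) = 0 → y ≤ z := by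
  rw [leastRootFormula, Formula.realize_inf, realize_monicRootFormula, Formula.realize_not,
    realize_exLast]
  simp only [Formula.realize_inf, realize_dropMiddle, realize_monicRootFormula,
    Formula.realize_not, realize_leSymb]
  simp

theorem exists_semialgFun_inv : ∃ f : SemialgFun 1, ∀ (K : Type*) [Field K] [LinearOrder K]
    [IsStrictOrderedRing K] [IsRealClosed K] (x : K), f.interp K ![x] = x⁻¹ := by
  obtain ⟨f, hf⟩ := exists_semialgFun invFormula fun x => by
    have hx : x = ![x 0] := by ext k; fin_cases k; rfl
    rw [hx]
    refine (existsUnique_congr fun y => realize_invFormula (x 0) y).2 ?_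
    generalize x 0 = x
    by_cases h : x = 0
    · exact ⟨0, .inr ⟨h, rfl⟩, fun y hy => by simpa [h] using hy⟩
    · exact ⟨x⁻¹, .inl (mul_inv_cancel₀ h), fun y hy => by
        rcases hy with hy | hy
        · exact eq_inv_of_mul_eq_one_right hy
        · exact absurd hy.1 h⟩
  refine ⟨f, fun K _ _ _ _ x => ?_⟩
  rcases (realize_invFormula _ _).1 (hf K ![x]) with h | h
  · exact eq_inv_of_mul_eq_one_right h
  · rw [h.1, inv_zero]
    exact h.1 ▸ h.2

theorem exists_semialgFun_sqrt : ∃ f : SemialgFun 1, ∀ (K : Type*) [Field K] [LinearOrder K]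
    [IsStrictOrderedRing K] [IsRealClosed K] (x : K), 0 ≤ x →
      f.interp K ![x] * f.interp K ![x] = x := by
  obtain ⟨f, hf⟩ := exists_semialgFun sqrtFormula fun x => by
    have hx : x = ![x 0] := by ext k; fin_cases k; rfl
    rw [hx]
    refine (existsUnique_congr fun y => realize_sqrtFormula (x 0) y).2 ?_
    generalize x 0 = x
    by_cases h : 0 ≤ x
    · refine ⟨√x, .inl ⟨Real.sqrt_nonneg x, Real.mul_self_sqrt h⟩, fun y hy => ?_⟩
      rcases hy with hy | hy
      · rw [← hy.2, Real.sqrt_mul_self hy.1]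
      · exact absurd h hy.1
    · refine ⟨0, .inr ⟨h, rfl⟩, fun y hy => ?_⟩
      rcases hy with hy | hy
      · exact absurd (hy.2 ▸ mul_self_nonneg y) h
      · exact hy.2
  refine ⟨f, fun K _ _ _ _ x hx => ?_⟩
  rcases (realize_sqrtFormula _ _).1 (hf K ![x]) with h | h
  · exact h.2
  · exact absurd hx h.1

-- Choosing the least root makes the root a definable function of the coefficients.
open Polynomial in
theorem exists_semialgFun_root {n : ℕ} (hn : Odd n) : ∃ f : SemialgFun n, ∀ (K : Type*) [Field K]
    [LinearOrder K] [IsStrictOrderedRing K] [IsRealClosed K] (x : Fin n → K),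
      (f.interp K x) ^ n + ∑ k : Fin n, x k * (f.interp K x) ^ (k : ℕ) = 0 := by
  obtain ⟨f, hf⟩ := exists_semialgFun (leastRootFormula n) fun x => by
    simp only [realize_leastRootFormula]
    let q : ℝ[X] := ∑ k : Fin n, C (x k) * X ^ (k : ℕ)
    have hq : q.degree < n := degree_sum_fin_lt x
    have hm : (X ^ n + q).Monic := monic_X_pow_add hq
    have hdeg : (X ^ n + q).natDegree = n := by
      refine natDegree_eq_of_degree_eq_some ?_
      rw [degree_add_eq_left_of_degree_lt (by rwa [degree_X_pow]), degree_X_pow]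
    have hev : ∀ z : ℝ, (X ^ n + q).eval z = z ^ n + ∑ k : Fin n, x k * z ^ (k : ℕ) := fun z => by
      simp [q, eval_finsetSum]
    obtain ⟨r, hr⟩ := IsRealClosed.exists_isRoot_of_odd_natDegree (f := X ^ n + q) (hdeg.symm ▸ hn)
    obtain ⟨y, hy, hmin⟩ := (X ^ n + q).roots.toFinset.exists_min_image id
      ⟨r, by simp only [Multiset.mem_toFinset, mem_roots hm.ne_zero]; exact hr⟩
    simp only [Multiset.mem_toFinset, mem_roots hm.ne_zero, IsRoot.def, hev, id] at hy hmin
    exact ⟨y, ⟨hy, hmin⟩, fun z hz => le_antisymm (hz.2 y hy) (hmin z hz.1)⟩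
  exact ⟨f, fun K _ _ _ _ x => ((realize_leastRootFormula _ _).1 (hf K x)).1⟩

variable [IsStrictOrderedRing K] [IsRealClosed K]

theorem inv_mem_of_semialg_closed {S : Subring K}
    (hS : ∀ n (f : SemialgFun n) (x : Fin n → K), (∀ k, x k ∈ S) → f.interp K x ∈ S) {x : K}
    (hx : x ∈ S) : x⁻¹ ∈ S := by
  obtain ⟨f, hf⟩ := exists_semialgFun_inv
  rw [← hf K x]
  exact hS 1 f _ fun k => by simpa using hx

open Polynomial in
/-- A subring that is closed under the semialgebraic functions is a relatively algebraically
closed subfield. -/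
theorem relClosed_of_semialg_closed {S : Subring K}
    (hS : ∀ n (f : SemialgFun n) (x : Fin n → K), (∀ k, x k ∈ S) → f.interp K x ∈ S) :
    RelClosed S.subtype := by
  let E : Subfield K := { S with inv_mem' := fun x hx => inv_mem_of_semialg_closed hS hx }
  have hE : IsRealClosed E := by
    refine .of_linearOrderedField (fun {x} hx => ?_) fun {f} hf => ?_
    · obtain ⟨g, hg⟩ := exists_semialgFun_sqrt
      exact ⟨⟨g.interp K ![x], hS 1 g _ fun k => by simp⟩,
        Subtype.ext (hg K x hx).symm⟩
    · obtain ⟨g, hg⟩ := exists_semialgFun_root hf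
      have hf0 : f ≠ 0 := by rintro rfl; simp at hf
      let p := f * C f.leadingCoeff⁻¹
      have hp : p.Monic := monic_mul_leadingCoeff_inv hf0
      have hpd : p.natDegree = f.natDegree := natDegree_mul_leadingCoeff_inv f hf0
      let x : Fin f.natDegree → K := fun k => p.coeff k
      have hy : g.interp K x ∈ E := hS _ g x fun k => (p.coeff k).2
      refine ⟨⟨_, hy⟩, ?_⟩
      have h1 : p.eval ⟨_, hy⟩ = 0 := by
        refine Subtype.ext ?_
        have hlead : p.coeff f.natDegree = 1 := by rw [← hpd]; exact hp.coeff_natDegree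
        rw [eval_eq_sum_range, hpd, Finset.sum_range_succ, Finset.sum_range, hlead, one_mul,
          add_comm]
        have := hg K x
        push_cast
        exact this
      rw [eval_mul, eval_C, mul_eq_zero] at h1
      exact h1.resolve_right (inv_ne_zero (leadingCoeff_ne_zero.2 hf0))
  exact RelClosed.of_isRealClosed (E := E) E.subtype

end Closed

end HFields

end

/-! ## The valuation of an H-field -/

noncomputable section

open scoped Differential

namespace HFields

section Valuation

variable {K : Type*} [Field K] [LinearOrder K] [IsStrictOrderedRing K] [Differential K]

theorem zero_mem_constants : (0 : K) ∈ constants K := map_zero _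

theorem one_mem_constants : (1 : K) ∈ constants K := Derivation.map_one_eq_zero _

theorem add_mem_constants {a b : K} (ha : a ∈ constants K) (hb : b ∈ constants K) :
    a + b ∈ constants K := by
  rw [constants, Set.mem_ofPred_eq] at *
  rw [map_add, ha, hb, add_zero]

theorem mul_mem_constants {a b : K} (ha : a ∈ constants K) (hb : b ∈ constants K) :
    a * b ∈ constants K := by
  rw [constants, Set.mem_ofPred_eq] at *
  rw [Derivation.leibniz, ha, hb, smul_zero, smul_zero, add_zero]

theorem neg_mem_constants {a : K} (ha : a ∈ constants K) : -a ∈ constants K := by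
  rw [constants, Set.mem_ofPred_eq] at *
  rw [map_neg, ha, neg_zero]

theorem inv_mem_constants {a : K} (ha : a ∈ constants K) : a⁻¹ ∈ constants K := by
  rw [constants, Set.mem_ofPred_eq] at *
  rw [Derivation.leibniz_inv, ha, smul_zero]

theorem abs_mem_constants {a : K} (ha : a ∈ constants K) : |a| ∈ constants K := by
  rcases abs_choice a with h | h <;> rw [h]
  exacts [ha, neg_mem_constants ha]

variable (K) in
/-- The convex hull of the field of constants, as a valuation ring. -/
def valRing : ValuationSubring K where
  carrier := bigO K
  mul_mem' := by
    rintro a b ⟨c, hc, hc0, hac⟩ ⟨d, hd, hd0, hbd⟩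
    exact ⟨c * d, mul_mem_constants hc hd, mul_pos hc0 hd0, by rw [abs_mul]; gcongr⟩
  one_mem' := ⟨1, one_mem_constants, one_pos, by simp⟩
  add_mem' := by
    rintro a b ⟨c, hc, hc0, hac⟩ ⟨d, hd, hd0, hbd⟩
    exact ⟨c + d, add_mem_constants hc hd, add_pos hc0 hd0,
      (abs_add_le a b).trans (add_le_add hac hbd)⟩
  zero_mem' := ⟨1, one_mem_constants, one_pos, by simp⟩
  neg_mem' := by
    rintro a ⟨c, hc, hc0, hac⟩
    exact ⟨c, hc, hc0, by rwa [abs_neg]⟩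
  mem_or_inv_mem' := fun a => by
    rcases le_total |a| 1 with h | h
    · exact .inl ⟨1, one_mem_constants, one_pos, h⟩
    · exact .inr ⟨1, one_mem_constants, one_pos, by rw [abs_inv]; exact inv_le_one_of_one_le₀ h⟩

variable (K) in
/-- The valuation of an ordered differential field. -/
def val : Valuation K (valRing K).ValueGroup := (valRing K).valuation

theorem val_le_one_iff {a : K} : val K a ≤ 1 ↔ a ∈ bigO K := (valRing K).valuation_le_one_iff a

theorem dominated_iff {f g : K} : Dominated f g ↔ val K f ≤ val K g := by
  rcases eq_or_ne g 0 with rfl | hg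
  · rw [map_zero, le_zero_iff, map_eq_zero]
    constructor
    · rintro ⟨c, -, -, h⟩
      simpa using h
    · rintro rfl
      exact ⟨1, one_mem_constants, one_pos, by simp⟩
  · have h0 : 0 < val K g := zero_lt_iff.2 ((map_ne_zero _).2 hg)
    rw [← div_le_one₀ h0, ← map_div₀, val_le_one_iff]
    refine exists_congr fun c => and_congr_right fun _ => and_congr_right fun _ => ?_
    rw [abs_div, div_le_iff₀ (abs_pos.2 hg)]

theorem mem_smallO_iff {a : K} : a ∈ smallO K ↔ val K a < 1 := by
  rw [← map_one (val K), ← not_le, ← dominated_iff]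
  constructor
  · rintro h ⟨c, hc, hc0, hac⟩
    have := h c⁻¹ (inv_mem_constants hc) (inv_pos.2 hc0)
    rw [abs_one] at hac
    exact absurd ((mul_lt_mul_of_pos_left this hc0).trans_eq (mul_inv_cancel₀ hc0.ne')) hac.not_gt
  · intro h c hc hc0
    by_contra hac
    refine h ⟨c⁻¹, inv_mem_constants hc, inv_pos.2 hc0, ?_⟩
    rw [abs_one, ← inv_mul_cancel₀ hc0.ne']
    exact mul_le_mul_of_nonneg_left (not_lt.1 hac) (inv_pos.2 hc0).le

theorem val_le_of_abs_le {a b : K} (h : |a| ≤ |b|) : val K a ≤ val K b :=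
  dominated_iff.1 ⟨1, one_mem_constants, one_pos, by rwa [one_mul]⟩

theorem abs_lt_of_val_lt {a b : K} (h : val K a < val K b) : |a| < |b| :=
  lt_of_not_ge fun h' => h.not_ge (val_le_of_abs_le h')

theorem val_le_of_le {a b : K} (ha : 0 ≤ a) (h : a ≤ b) : val K a ≤ val K b :=
  val_le_of_abs_le (by rwa [abs_of_nonneg ha, abs_of_nonneg (ha.trans h)])

theorem val_abs (a : K) : val K |a| = val K a :=
  le_antisymm (val_le_of_abs_le (abs_abs a).le) (val_le_of_abs_le (abs_abs a).ge)

theorem val_const_le {c : K} (hc : c ∈ constants K) : val K c ≤ 1 :=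
  val_le_one_iff.2 ⟨|c| + 1, add_mem_constants (abs_mem_constants hc) one_mem_constants,
    by positivity, by simp⟩

theorem val_const {c : K} (hc : c ∈ constants K) (h0 : c ≠ 0) : val K c = 1 := by
  refine le_antisymm (val_const_le hc) ?_
  have := val_const_le (inv_mem_constants hc)
  rwa [map_inv₀, inv_le_one₀ (zero_lt_iff.2 ((map_ne_zero _).2 h0))] at this

theorem natCast_mem_constants (n : ℕ) : (n : K) ∈ constants K := Derivation.map_natCast _ n

theorem val_natCast {n : ℕ} (hn : n ≠ 0) : val K n = 1 :=
  val_const (natCast_mem_constants n) (Nat.cast_ne_zero.2 hn)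

theorem mem_setI_iff {y : K} : y ∈ setI K ↔ ∃ f : K, val K f < 1 ∧ val K y ≤ val K f′ := by
  simp only [setI, Set.mem_ofPred_eq, mem_smallO_iff, dominated_iff]

theorem mem_setI_of_le {y z : K} (hz : z ∈ setI K) (h : val K y ≤ val K z) : y ∈ setI K := by
  rw [mem_setI_iff] at *
  obtain ⟨f, hf, hzf⟩ := hz
  exact ⟨f, hf, h.trans hzf⟩

theorem mem_setI_congr {y z : K} (h : val K y = val K z) : y ∈ setI K ↔ z ∈ setI K :=
  ⟨fun hy => mem_setI_of_le hy h.ge, fun hz => mem_setI_of_le hz h.le⟩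

theorem deriv_mem_setI {a : K} (ha : val K a < 1) : a′ ∈ setI K :=
  mem_setI_iff.2 ⟨a, ha, le_rfl⟩

theorem add_pos_of_val_lt {a b : K} (ha : 0 < a) (h : val K b < val K a) : 0 < a + b := by
  have := abs_lt_of_val_lt h
  rw [abs_of_pos ha] at this
  linarith [neg_abs_le b]

theorem smallInt_eq_zero {b : K} (hb : b ∉ setI K) : smallInt b = 0 :=
  dif_neg fun ⟨_, ha, h⟩ => hb (h ▸ deriv_mem_setI (mem_smallO_iff.1 ha))

end Valuation

/-! ### Derivatives and logarithmic derivatives of infinitesimals. -/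

namespace IsHField

variable {K : Type*} [Field K] [LinearOrder K] [IsStrictOrderedRing K] [Differential K]
  (hK : IsHField K)
include hK

theorem deriv_pos_of_val {a : K} (h0 : 0 < a) (ha : 1 < val K a) : 0 < a′ :=
  hK.deriv_pos a fun c hc => by
    have := abs_lt_of_val_lt ((val_const_le hc).trans_lt ha)
    rw [abs_of_pos h0] at this
    exact (le_abs_self c).trans_lt this

theorem deriv_neg_of_val {a : K} (h0 : 0 < a) (ha : val K a < 1) : a′ < 0 := by
  have h := hK.deriv_pos_of_val (inv_pos.2 h0) (by
    rw [map_inv₀]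
    exact (one_lt_inv₀ (zero_lt_iff.2 ((map_ne_zero _).2 h0.ne'))).2 ha)
  rw [Derivation.leibniz_inv, smul_eq_mul, neg_mul, neg_pos] at h
  exact neg_of_mul_neg_right h (sq_nonneg _)

theorem deriv_pos_of_neg {a : K} (h0 : a < 0) (ha : val K a < 1) : 0 < a′ := by
  have := hK.deriv_neg_of_val (neg_pos.2 h0) (by rwa [Valuation.map_neg])
  rwa [map_neg, neg_lt_zero] at this

/-- This is what makes the cut of a small integral readable from derivatives alone. -/
theorem pos_iff_deriv_neg {a : K} (ha : val K a < 1) : 0 < a ↔ a′ < 0 := by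
  refine ⟨fun h => hK.deriv_neg_of_val h ha, fun h => ?_⟩
  rcases lt_trichotomy a 0 with h0 | rfl | h0
  · exact absurd (hK.deriv_pos_of_neg h0 ha) h.not_gt
  · rw [map_zero] at h
    exact absurd h (lt_irrefl _)
  · exact h0

theorem eq_zero_of_deriv_eq_zero {a : K} (ha : val K a < 1) (h : a′ = 0) : a = 0 := by
  by_contra h0
  rw [val_const h h0] at ha
  exact lt_irrefl _ ha

theorem eq_of_deriv_eq {a b : K} (ha : val K a < 1) (hb : val K b < 1) (h : a′ = b′) : a = b :=
  sub_eq_zero.1 (hK.eq_zero_of_deriv_eq_zero (Valuation.map_sub_lt _ ha hb)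
    (by rw [map_sub, h, sub_self]))

theorem smallInt_deriv {a : K} (ha : val K a < 1) : smallInt a′ = a := by
  have h : ∃ b ∈ smallO K, b′ = a′ := ⟨a, mem_smallO_iff.2 ha, rfl⟩
  rw [smallInt, dif_pos h]
  exact hK.eq_of_deriv_eq (mem_smallO_iff.1 h.choose_spec.1) ha h.choose_spec.2

theorem logDeriv_neg {a : K} (h0 : a ≠ 0) (ha : val K a < 1) : Differential.logDeriv a < 0 := by
  rw [Differential.logDeriv]
  rcases h0.lt_or_gt with h | h
  · exact div_neg_of_pos_of_neg (hK.deriv_pos_of_neg h ha) h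
  · exact div_neg_of_neg_of_pos (hK.deriv_neg_of_val h ha) h

/-- The derivative of an infinitesimal is smaller than every logarithmic derivative of an element
that is not of the size of a constant: the case of a positive infinite element. -/
theorem val_deriv_mul_lt_of_pos {e g : K} (he : val K e < 1) (h0 : 0 < g) (hg : 1 < val K g) :
    val K (e′ * g) < val K g′ := by
  -- The product `(c + e)g` is positive and infinite, so its derivative is positive. Using this for
  -- `e` and for `-e` bounds `e′g` from both sides.
  have key : ∀ e : K, val K e < 1 → ∀ c ∈ constants K, 0 < c → 0 < (e′ * g) + (c + e) * g′ := by
    intro e he c hc hc0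
    have hce : 0 < c + e := add_pos_of_val_lt hc0 (by rwa [val_const hc hc0.ne'])
    have h := hK.deriv_pos_of_val (mul_pos hce h0) (by
      rw [map_mul, Valuation.map_add_eq_of_lt_left _ (by rwa [val_const hc hc0.ne']),
        val_const hc hc0.ne', one_mul]
      exact hg)
    rw [Derivation.leibniz, map_add, show c′ = 0 from hc, zero_add, smul_eq_mul,
      smul_eq_mul] at h
    linarith
  have hg' := hK.deriv_pos_of_val h0 hg
  rw [← not_le, ← dominated_iff]
  rintro ⟨c, hc, hc0, hle⟩
  -- One half of `c⁻¹` serves as the added constant, and the other half bounds `|e|`.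
  have hc' : (2 * c)⁻¹ ∈ constants K := inv_mem_constants
    (mul_mem_constants (by simpa using natCast_mem_constants (K := K) 2) hc)
  have hc0' : 0 < (2 * c)⁻¹ := by positivity
  have hec : |e| < (2 * c)⁻¹ := mem_smallO_iff.2 he _ hc' hc0'
  have h1 := key e he _ hc' hc0'
  have h2 := key (-e) (by rwa [Valuation.map_neg]) _ hc' hc0'
  rw [map_neg] at h2
  have h3 : |e′ * g| < c⁻¹ * g′ := by
    have h4 : c⁻¹ = (2 * c)⁻¹ + (2 * c)⁻¹ := by field_simp; norm_num
    have h5 : e * g′ < (2 * c)⁻¹ * g′ := mul_lt_mul_of_pos_right ((le_abs_self e).trans_lt hec) hg'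
    have h6 : -e * g′ < (2 * c)⁻¹ * g′ := mul_lt_mul_of_pos_right ((neg_le_abs e).trans_lt hec) hg'
    rw [abs_lt, h4]
    constructor <;> linarith
  have h7 := mul_lt_mul_of_pos_left h3 hc0
  rw [← mul_assoc, mul_inv_cancel₀ hc0.ne', one_mul] at h7
  rw [abs_of_pos hg'] at hle
  exact absurd h7 hle.not_gt

/-- In terms of logarithmic derivatives, `e′ ≺ g′/g`. The case of infinitesimal `g` follows from
that of `g⁻¹`, whose logarithmic derivative is the negative. -/
theorem val_deriv_mul_lt {e g : K} (he : val K e < 1) (h0 : g ≠ 0) (hg : val K g ≠ 1) :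
    val K (e′ * g) < val K g′ := by
  have key : ∀ g : K, g ≠ 0 → 1 < val K g → val K (e′ * g) < val K g′ := by
    intro g h0 hg
    rcases h0.lt_or_gt with h | h
    · have := hK.val_deriv_mul_lt_of_pos he (neg_pos.2 h) (by rwa [Valuation.map_neg])
      rwa [map_neg, mul_neg, Valuation.map_neg, Valuation.map_neg] at this
    · exact hK.val_deriv_mul_lt_of_pos he h hg
  rcases hg.lt_or_gt with h | h
  · have hv : 0 < val K g := zero_lt_iff.2 ((map_ne_zero _).2 h0)
    have := key g⁻¹ (inv_ne_zero h0) (by rw [map_inv₀]; exact (one_lt_inv₀ hv).2 h)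
    rw [Derivation.leibniz_inv, smul_eq_mul, neg_mul, Valuation.map_neg] at this
    have h2 := mul_lt_mul_of_pos_right this (mul_pos hv hv)
    rw [← map_mul, ← map_mul, ← map_mul] at h2
    have e1 : e′ * g⁻¹ * (g * g) = e′ * g := by field_simp
    have e2 : g⁻¹ ^ 2 * g′ * (g * g) = g′ := by field_simp
    rwa [e1, e2] at h2
  · exact key g h0 h

/-- With `u = f/g` infinitesimal, `f′ = u′g + ug′`, and both summands are strictly dominated by
`g′`. -/
theorem val_deriv_lt {f g : K} (h : val K f < val K g) (hg : val K g < 1) :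
    val K f′ < val K g′ := by
  have h0 : g ≠ 0 := by
    rintro rfl
    rw [map_zero] at h
    exact not_lt_zero h
  have hu : val K (f / g) < 1 := by
    rw [map_div₀]
    exact (div_lt_one₀ (zero_lt_iff.2 ((map_ne_zero _).2 h0))).2 h
  have h1 := hK.val_deriv_mul_lt hu h0 hg.ne
  have hg' : 0 < val K g′ := zero_le.trans_lt h1
  have e1 : f′ = (f / g)′ * g + (f / g) * g′ := by
    conv_lhs => rw [← div_mul_cancel₀ f h0]
    rw [Derivation.leibniz, smul_eq_mul, smul_eq_mul]
    ring
  rw [e1]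
  refine Valuation.map_add_lt _ h1 ?_
  rw [map_mul]
  exact (mul_lt_mul_of_pos_right hu hg').trans_eq (one_mul _)

theorem exists_const_add {a : K} (ha : val K a ≤ 1) :
    ∃ c ∈ constants K, ∃ e : K, val K e < 1 ∧ a = c + e := by
  obtain ⟨c, hc, e, he, h⟩ := (hK.mem_bigO_iff a).1 (val_le_one_iff.1 ha)
  exact ⟨c, hc, e, mem_smallO_iff.1 he, h⟩

theorem val_deriv_le {f g : K} (h : val K f ≤ val K g) (hg : val K g < 1) :
    val K f′ ≤ val K g′ := by
  rcases eq_or_ne g 0 with rfl | h0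
  · rw [map_zero, le_zero_iff, map_eq_zero] at h
    rw [h]
  · obtain ⟨c, hc, e, he, hce⟩ := hK.exists_const_add (a := f / g) (by
      rw [map_div₀]
      exact div_le_one_of_le₀ h zero_le)
    have e1 : f = c * g + e * g := by rw [← add_mul, ← hce, div_mul_cancel₀ f h0]
    have h1 : val K (e * g) < val K g := by
      rw [map_mul]
      exact (mul_lt_mul_of_pos_right he (zero_lt_iff.2 ((map_ne_zero _).2 h0))).trans_eq
        (one_mul _)
    rw [e1, map_add, Derivation.leibniz, show c′ = 0 from hc, smul_zero, add_zero, smul_eq_mul]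
    refine Valuation.map_add_le _ ?_ (hK.val_deriv_lt h1 hg).le
    rw [map_mul]
    exact (mul_le_mul_left (val_const_le hc) _).trans_eq (one_mul _)

/-- The logarithmic derivative of `f` is the sum of those of `f/g` and `g`. If `f/g` is
infinitesimal, both are negative and cannot cancel. Otherwise `f/g` is a nonzero constant plus an
infinitesimal, and its contribution is negligible. -/
theorem val_logDeriv_le {f g : K} (h0 : f ≠ 0) (h : val K f ≤ val K g) (hg : val K g < 1) :
    val K (Differential.logDeriv g) ≤ val K (Differential.logDeriv f) := by
  have hg0 : g ≠ 0 := by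
    rintro rfl
    rw [map_zero, le_zero_iff, map_eq_zero] at h
    exact h0 h
  have hvg : 0 < val K g := zero_lt_iff.2 ((map_ne_zero _).2 hg0)
  have hu0 : f / g ≠ 0 := div_ne_zero h0 hg0
  have e1 : Differential.logDeriv f = Differential.logDeriv (f / g) + Differential.logDeriv g := by
    rw [Differential.logDeriv_div _ _ h0 hg0, sub_add_cancel]
  have hlg := hK.logDeriv_neg hg0 hg
  have hu : val K (f / g) ≤ 1 := by
    rw [map_div₀]
    exact div_le_one_of_le₀ h zero_le
  rcases hu.lt_or_eq with hu | hu
  · have hlu := hK.logDeriv_neg hu0 hu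
    refine val_le_of_abs_le ?_
    rw [e1, abs_of_neg hlg, abs_of_neg (add_neg hlu hlg)]
    linarith
  · obtain ⟨c, hc, e, he, hce⟩ := hK.exists_const_add hu.le
    have h1 : val K (Differential.logDeriv (f / g)) < val K (Differential.logDeriv g) := by
      rw [Differential.logDeriv, Differential.logDeriv, map_div₀, hu, div_one, hce, map_add,
        show c′ = 0 from hc, zero_add, map_div₀, lt_div_iff₀ hvg, ← map_mul]
      exact hK.val_deriv_mul_lt he hg0 hg.ne
    rw [e1, Valuation.map_add_eq_of_lt_right _ h1]

theorem exists_smallInt (hI : AdmitsSmallIntegration K) {b : K} (hb : b ∈ setI K) :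
    val K (smallInt b) < 1 ∧ (smallInt b)′ = b := by
  have h : b ∈ {y : K | ∃ a ∈ smallO K, a′ = y} := by rwa [hI]
  obtain ⟨a, ha, rfl⟩ := h
  rw [mem_smallO_iff] at ha
  rw [hK.smallInt_deriv ha]
  exact ⟨ha, rfl⟩

end IsHField

end HFields

end

/-! ## Small integrals over a subfield -/

noncomputable section

open scoped Differential
open Polynomial

namespace HFields

open RealClosed

section Valuation

variable {K : Type*} [Field K] [LinearOrder K] [IsStrictOrderedRing K] [Differential K]

theorem val_pos_iff {a : K} : 0 < val K a ↔ a ≠ 0 := by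
  rw [zero_lt_iff, Valuation.ne_zero_iff]

theorem val_sq_add_sq (a b : K) : val K (a ^ 2 + b ^ 2) = max (val K a ^ 2) (val K b ^ 2) := by
  rw [← map_pow, ← map_pow]
  refine le_antisymm (Valuation.map_add _ _ _) (max_le ?_ ?_)
  · exact val_le_of_le (sq_nonneg a) (by linarith [sq_nonneg b])
  · exact val_le_of_le (sq_nonneg b) (by linarith [sq_nonneg a])

/-- The terms of index above `m` add up to `x ^ m * d` with `d` infinitesimal, and `|1 + d| ≥ 1/2`
accounts for the factor 2. The resulting bound involves only ordering and coefficients, so an order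
isomorphism can carry it over. -/
theorem abs_le_of_sum_eq_zero {x : K} {b : ℕ → K} {m n : ℕ} (hmn : m ≤ n) (hm : b m = 1)
    (hb : ∀ k, m < k → val K (b k) < 1) (hx : val K x ≤ 1)
    (h : ∑ k ∈ Finset.range (n + 1), b k * x ^ k = 0) :
    |x| ≤ 1 + ∑ k ∈ Finset.range m, 2 * |b k| := by
  let d := ∑ k ∈ Finset.range (n - m), b (m + (k + 1)) * x ^ (k + 1)
  have hd : val K d < 1 := by
    refine Valuation.map_sum_lt _ one_ne_zero fun k _ => ?_
    rw [map_mul, map_pow]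
    exact mul_lt_one_of_lt_of_le (hb _ (by omega)) (pow_le_one₀ zero_le hx)
  have h2 : ∑ k ∈ Finset.range m, b k * x ^ k = -(x ^ m * (1 + d)) := by
    rw [show n + 1 = m + ((n - m) + 1) by omega, Finset.sum_range_add, Finset.sum_range_succ'] at h
    have e1 : ∑ k ∈ Finset.range (n - m), b (m + (k + 1)) * x ^ (m + (k + 1)) = x ^ m * d := by
      rw [Finset.mul_sum]
      exact Finset.sum_congr rfl fun k _ => by ring
    rw [e1, add_zero, hm] at h
    linear_combination h
  have hd2 : |d| < 2⁻¹ := mem_smallO_iff.2 hd _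
    (inv_mem_constants (by simpa using natCast_mem_constants (K := K) 2)) (by norm_num)
  have h3 : |x| ^ m ≤ ∑ k ∈ Finset.range m, 2 * |b k| * |x| ^ k := by
    have h4 := Finset.abs_sum_le_sum_abs (fun k => b k * x ^ k) (Finset.range m)
    rw [h2, abs_neg, abs_mul, abs_pow] at h4
    simp only [abs_mul, abs_pow] at h4
    have h5 : 2⁻¹ ≤ |1 + d| := le_trans (by linarith [neg_abs_le d]) (le_abs_self _)
    have h6 : |x| ^ m * 2⁻¹ ≤ |x| ^ m * |1 + d| := by gcongr
    have h7 : ∑ k ∈ Finset.range m, 2 * |b k| * |x| ^ k =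
        2 * ∑ k ∈ Finset.range m, |b k| * |x| ^ k := by
      rw [Finset.mul_sum]
      exact Finset.sum_congr rfl fun k _ => by ring
    rw [h7]
    linarith
  rcases Nat.eq_zero_or_pos m with rfl | hm0
  · simp at h3
    linarith
  · exact abs_le_of_pow_le hm0 (fun k => by positivity) h3

/-- In a vanishing sum the largest value must be attained at least twice. -/
theorem exists_val_eq_of_sum_eq_zero {s : Finset ℕ} {t : ℕ → K} (hs : s.Nonempty)
    (ht : ∀ k ∈ s, t k ≠ 0) (h : ∑ k ∈ s, t k = 0) :
    ∃ k ∈ s, ∃ l ∈ s, k < l ∧ val K (t k) = val K (t l) := by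
  obtain ⟨k, hk, hmax⟩ := s.exists_max_image (fun k => val K (t k)) hs
  by_cases hl : ∃ l ∈ s, l ≠ k ∧ val K (t l) = val K (t k)
  · obtain ⟨l, hl, hlk, hv⟩ := hl
    rcases hlk.lt_or_gt with h | h
    · exact ⟨l, hl, k, hk, h, hv⟩
    · exact ⟨k, hk, l, hl, h, hv.symm⟩
  · push Not at hl
    have := Valuation.map_sum_eq_of_lt (val K) hk (f := t) fun l hl' => by
        simp only [Finset.mem_sdiff, Finset.mem_singleton] at hl'
        exact lt_of_le_of_ne (hmax l hl'.1) (hl l hl'.1 hl'.2)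
    rw [h, map_zero] at this
    exact absurd this.symm ((val K).ne_zero_iff.2 (ht k hk))

end Valuation

namespace IsHField

variable {K : Type*} [Field K] [LinearOrder K] [IsStrictOrderedRing K] [Differential K]
  (hK : IsHField K)
include hK

theorem deriv_ne_zero {a : K} (ha : val K a < 1) (h0 : a ≠ 0) : a′ ≠ 0 :=
  mt (hK.eq_zero_of_deriv_eq_zero ha) h0

/-- Write `y = (c + e)g` with `c` constant and `e` infinitesimal. The ratio `y′/g′` equals `c + e`
plus the term `e′g/g′`, which is infinitesimal by `val_deriv_mul_lt`. -/
theorem val_sub_ratio_lt {y g : K} (hy : val K y < 1) (hg : g ≠ 0) (h : val K y = val K g) :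
    val K (y - y′ / g′ * g) < val K y := by
  have hg' := hK.deriv_ne_zero (h ▸ hy) hg
  have hv : 0 < val K g := val_pos_iff.2 hg
  have hv' : 0 < val K g′ := val_pos_iff.2 hg'
  obtain ⟨c, hc, e, he, hce⟩ := hK.exists_const_add (a := y / g) (by
    rw [map_div₀, h, div_self hv.ne'])
  have e1 : y = c * g + e * g := by rw [← add_mul, ← hce, div_mul_cancel₀ y hg]
  have e2 : y′ = c * g′ + (e * g′ + g * e′) := by
    conv_lhs => rw [e1]
    rw [map_add, Derivation.leibniz, Derivation.leibniz, show c′ = 0 from hc, smul_zero, add_zero]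
    rfl
  have e3 : y - y′ / g′ * g = -(e′ * g / g′ * g) := by
    rw [e2]
    conv_lhs => enter [1]; rw [e1]
    field_simp
    ring
  rw [e3, Valuation.map_neg, map_mul, map_div₀, h]
  refine (mul_lt_mul_of_pos_right ?_ hv).trans_eq (one_mul _)
  rw [div_lt_one₀ hv']
  exact hK.val_deriv_mul_lt he hg (h ▸ hy).ne

variable {E : Type*} [Field E] {i : E →+* K} (hd : ∀ e, ∃ d, i d = (i e)′)
include hd

/-- If an element `e` of `E` had the value of `y`, then `(y′/e′)e` would lie in `E` and approximate
`y` better than `0` does. -/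
theorem val_ne_of_val_le_sub {y : K} (hy : val K y < 1) (ha : ∃ a, i a = y′) (hy0 : y ≠ 0)
    (h : ∀ e, val K (i e) < 1 → val K y ≤ val K (y - i e)) (e : E) : val K (i e) ≠ val K y := by
  intro he
  obtain ⟨a, ha⟩ := ha
  obtain ⟨d, hd⟩ := hd e
  have hi0 : i e ≠ 0 := (val K).ne_zero_iff.1 (he ▸ (val K).ne_zero_iff.2 hy0)
  have h1 := hK.val_sub_ratio_lt hy hi0 he.symm
  have h2 : y′ / (i e)′ * i e = i (a / d * e) := by rw [map_mul, map_div₀, ha, hd]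
  rw [h2] at h1
  refine (h _ ?_).not_gt h1
  have h3 := Valuation.map_sub_lt (val K) hy (h1.trans hy)
  rwa [sub_sub_cancel] at h3

/-- Write `f†` for `f′/f`. Suppose `y ≺ h` with `h` infinitesimal in `E`, and put `s = √|y|` and `k
= y′/h†`, an element of `E`. Since `h† ≼ y†` and `s′ ≺ h†`, one gets `y ≼ k ≺ s`. Monotonicity of
logarithmic derivatives gives `s† ≼ k† ≼ y†`, and `s†` and `y†` have the same value. Hence `y` has
the value of `y′/k†`, which is in `E`, a contradiction. -/
theorem val_lt_of_val_ne [IsRealClosed K] {y : K} (hy : val K y < 1) (ha : ∃ a, i a = y′)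
    (hval : ∀ e, val K (i e) ≠ val K y) {e : E} (he : val K (i e) < 1) :
    val K (i e) < val K y := by
  by_contra hcon
  have hye := lt_of_le_of_ne (not_lt.1 hcon) (hval e).symm
  have hy0 : y ≠ 0 := by
    rintro rfl
    exact hval 0 (by simp)
  obtain ⟨a, ha⟩ := ha
  obtain ⟨d, hd'⟩ := hd e
  obtain ⟨s, hs⟩ := IsRealClosed.nonneg_iff_isSquare.1 (abs_nonneg y)
  have hh0 : i e ≠ 0 := val_pos_iff.1 (zero_le.trans_lt hye)
  have hh0' := hK.deriv_ne_zero he hh0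
  have hy0' := hK.deriv_ne_zero hy hy0
  have hs0 : s ≠ 0 := by
    rintro rfl
    rw [mul_zero, abs_eq_zero] at hs
    exact hy0 hs
  have hvs : val K s * val K s = val K y := by rw [← map_mul, ← hs, val_abs]
  have hvsp : 0 < val K s := val_pos_iff.2 hs0
  have hs1 : val K s < 1 := by
    by_contra h
    exact hy.not_ge (hvs ▸ one_le_mul (not_lt.1 h) (not_lt.1 h))
  have hvs' : val K y′ = val K s * val K s′ := by
    have h1 : val K y′ = val K (|y|)′ := by
      rcases abs_choice y with h | h <;> rw [h]
      rw [map_neg, Valuation.map_neg]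
    have h2 : (s * s)′ = (2 : ℕ) * (s * s′) := by
      rw [Derivation.leibniz, smul_eq_mul]
      push_cast
      ring
    rw [h1, hs, h2, map_mul, val_natCast two_ne_zero, one_mul, map_mul]
  have hs0' : 0 < val K s′ := val_pos_iff.2 (hK.deriv_ne_zero hs1 hs0)
  let k := (y′ * i e / (i e)′)
  have hk : k = i (a * e / d) := by rw [map_div₀, map_mul, ha, hd']
  have hk0 : k ≠ 0 := div_ne_zero (mul_ne_zero hy0' hh0) hh0'
  have hvh' : 0 < val K (i e)′ := val_pos_iff.2 hh0'
  have hks : val K k < val K s := by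
    rw [map_div₀, div_lt_iff₀ hvh', map_mul, hvs', mul_assoc, ← map_mul (val K) s′]
    exact mul_lt_mul_of_pos_left (hK.val_deriv_mul_lt hs1 hh0 he.ne) hvsp
  have hyk : val K y ≤ val K k := by
    have := hK.val_logDeriv_le hy0 hye.le he
    rw [Differential.logDeriv, Differential.logDeriv, map_div₀, map_div₀,
      div_le_div_iff₀ (val_pos_iff.2 hh0) (val_pos_iff.2 hy0)] at this
    rw [map_div₀, le_div_iff₀ hvh', map_mul, mul_comm]
    exact this
  have h1 := hK.val_logDeriv_le hk0 hks.le hs1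
  have h2 := hK.val_logDeriv_le hy0 hyk (hks.trans hs1)
  have h3 : val K (Differential.logDeriv s) = val K (Differential.logDeriv y) := by
    rw [Differential.logDeriv, Differential.logDeriv, map_div₀, map_div₀, hvs', ← hvs,
      mul_div_mul_left _ _ hvsp.ne']
  have h4 : val K k′ / val K k = val K y′ / val K y := by
    rw [← map_div₀, ← map_div₀]
    exact le_antisymm h2 (h3 ▸ h1)
  obtain ⟨f, hf⟩ := hd (a * e / d)
  -- This element of `E` is `y′k/k′`.
  refine hval (a * (a * e / d) / f) ?_
  have hvk' : 0 < val K k′ := val_pos_iff.2 (hK.deriv_ne_zero (hks.trans hs1) hk0)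
  have hvy' : 0 < val K y′ := val_pos_iff.2 hy0'
  rw [map_div₀, map_mul, ha, hf, ← hk, map_div₀, map_mul, div_eq_iff hvk'.ne']
  rwa [div_eq_div_iff (val_pos_iff.2 hk0).ne' (val_pos_iff.2 hy0).ne', mul_comm, eq_comm] at h4

end IsHField

/-- Membership in `I` of an element that is comparable to a power of `y`, where `y` lies between
the infinitesimals and the elements of size 1 of a smaller field. -/
theorem IsHField.mem_setI_iff_lt {K : Type*} [Field K] [LinearOrder K] [IsStrictOrderedRing K]
    [Differential K] (hK : IsHField K) {b y e : K} (hy : val K y < 1) (hy0 : y ≠ 0) (hb : b ≠ 0)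
    {m l k : ℕ} (hm : m ≠ 0)
    (h : val K (b * y / y′) ^ m * val K y ^ l = val K e * val K y ^ k)
    (he : val K e < 1 → ∀ n, val K e ≤ val K y ^ n)
    (he' : 1 < val K e → ∀ n, 1 < val K e * val K y ^ n) :
    b ∈ setI K ↔ val K (b * y) < val K y′ := by
  have hy0' := hK.deriv_ne_zero hy hy0
  have hvy : 0 < val K y := val_pos_iff.2 hy0
  constructor
  · intro hbI
    obtain ⟨f, hf, hbf⟩ := mem_setI_iff.1 hbI
    refine lt_of_le_of_lt ?_ (hK.val_deriv_mul_lt hf hy0 hy.ne)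
    rw [map_mul, map_mul]
    gcongr
  · intro hlt
    -- `f` is `b` divided by the logarithmic derivative of `y`. Once `f ^ m ≼ y`, comparing
    -- logarithmic derivatives gives `b ≼ f′`.
    let f := (b * y / y′)
    have hf0 : f ≠ 0 := div_ne_zero (mul_ne_zero hb hy0) hy0'
    have hf : val K f < 1 := by rwa [map_div₀, div_lt_one₀ (val_pos_iff.2 hy0')]
    have hfm : val K (f ^ m) ≤ val K y := by
      rw [map_pow]
      have hyl : 0 < val K y ^ l := pow_pos hvy l
      -- An infinitesimal `e` lies below all powers of `y`. If `e` has value 1, then `f ^ m` has the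
      -- value of a positive power of `y`. A larger `e` would make `f` infinite.
      rcases lt_trichotomy (val K e) 1 with h1 | h1 | h1
      · refine le_of_mul_le_mul_right ?_ hyl
        rw [h, ← pow_succ']
        calc val K e * val K y ^ k ≤ val K y ^ (l + 1) * 1 :=
              mul_le_mul' (he h1 _) (pow_le_one₀ zero_le hy.le)
          _ = _ := mul_one _
      · rw [h1, one_mul] at h
        have hkl : l < k := by
          by_contra hkl
          have h2 : val K y ^ l ≤ val K y ^ k := pow_le_pow_of_le_one zero_le hy.le (not_lt.1 hkl)
          rw [← h] at h2
          have h3 : val K f ^ m * val K y ^ l < 1 * val K y ^ l :=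
            mul_lt_mul_of_pos_right (pow_lt_one₀ zero_le hf hm) hyl
          rw [one_mul] at h3
          exact h2.not_gt h3
        refine le_of_mul_le_mul_right ?_ hyl
        rw [h, ← pow_succ']
        exact pow_le_pow_of_le_one zero_le hy.le hkl
      · have h2 := he' h1 k
        rw [← h] at h2
        exact absurd (mul_le_one' (pow_le_one₀ zero_le hf.le) (pow_le_one₀ zero_le hy.le)) h2.not_ge
    have h1 := hK.val_logDeriv_le (pow_ne_zero m hf0) hfm hy
    rw [Differential.logDeriv_pow, map_mul, val_natCast hm, one_mul, Differential.logDeriv,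
      Differential.logDeriv, map_div₀, map_div₀, div_le_div_iff₀ hvy (val_pos_iff.2 hf0)] at h1
    refine mem_setI_iff.2 ⟨f, hf, le_of_mul_le_mul_right ?_ hvy⟩
    rw [← map_mul]
    have : b * y = y′ * f := by rw [mul_div_cancel₀ _ hy0']
    rw [this, map_mul]
    exact h1

end HFields

end

/-! ## Valuation and derivation on algebraic extensions -/

noncomputable section

open scoped Differential
open Polynomial

namespace HFields

open RealClosed

section Graphs

variable {K K' : Type*} [Field K] [LinearOrder K] [IsStrictOrderedRing K] [Differential K]
  [Field K'] [LinearOrder K'] [IsStrictOrderedRing K'] [Differential K']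

/-- The two coordinates of the elements of `G` have the same valuation divisibilities. -/
def ValGraph (G : Subring (K × K')) : Prop :=
  ∀ p ∈ G, ∀ q ∈ G, val K p.1 ≤ val K q.1 ↔ val K' p.2 ≤ val K' q.2

theorem ValGraph.lt_iff {G : Subring (K × K')} (hG : ValGraph G) {p q : K × K'} (hp : p ∈ G)
    (hq : q ∈ G) : val K p.1 < val K q.1 ↔ val K' p.2 < val K' q.2 := by
  rw [← not_le, ← not_le, hG q hq p hp]

/-! ### The valuation on algebraic extensions. -/

section Algebraic

variable {R H : Subring (K × K')} (hRH : R ≤ H) (hH : OrdGraph H) (hinv : ∀ p ∈ H, p⁻¹ ∈ H)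
  (hR : ValGraph R)
include hRH hH hinv hR

/-- After dividing by a coefficient of largest value, `abs_le_of_sum_eq_zero` bounds `|p.1|` by an
expression in coefficients of value at most 1. The ordering carries this bound to `p.2`, and `hR`
controls the coefficients there. -/
theorem val_snd_le_one_of_algebraic {f : R[X]} (hf : f ≠ 0) {p : K × K'} (hp : p ∈ H)
    (hfp : f.eval₂ (fstHom R) p.1 = 0) (h : val K p.1 ≤ 1) : val K' p.2 ≤ 1 := by
  let T := f.support.filter fun k => ∀ l ∈ f.support,
    val K (f.coeff l : K × K').1 ≤ val K (f.coeff k : K × K').1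
  have hT : T.Nonempty := by
    obtain ⟨k, hk, hmax⟩ := f.support.exists_max_image (fun k => val K (f.coeff k : K × K').1)
      (nonempty_support_iff.2 hf)
    exact ⟨k, Finset.mem_filter.2 ⟨hk, hmax⟩⟩
  -- Taking the last index of maximal value makes all later normalized coefficients infinitesimal.
  let m := T.max' hT
  have hmT : m ∈ T := T.max'_mem hT
  obtain ⟨hms, hmax⟩ := Finset.mem_filter.1 hmT
  let c : K × K' := f.coeff m
  have hcR : c ∈ R := (f.coeff m).2
  have hc : c.1 ≠ 0 := fun h0 => mem_support_iff.1 hms <| Subtype.ext <|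
    hH.eq_of_fst_eq (hRH hcR) (zero_mem H) h0
  have hc' : c.2 ≠ 0 := mt (hH.fst_eq_zero_iff (hRH hcR)).2 hc
  have hmax' : ∀ k, val K (f.coeff k : K × K').1 ≤ val K c.1 := by
    intro k
    by_cases hk : k ∈ f.support
    · exact hmax k hk
    · rw [notMem_support_iff.1 hk]
      simp
  have hlt : ∀ k, m < k → val K (f.coeff k : K × K').1 < val K c.1 := by
    intro k hk
    refine lt_of_le_of_ne (hmax' k) fun heq => ?_
    have hks : k ∈ f.support := by
      refine mem_support_iff.2 fun h0 => ?_
      rw [h0] at heq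
      exact (val K).ne_zero_iff.2 hc (heq.symm.trans (map_zero _))
    exact (T.le_max' k (Finset.mem_filter.2 ⟨hks, fun l _ => heq ▸ hmax' l⟩)).not_gt hk
  let b : ℕ → K × K' := fun k => f.coeff k * c⁻¹
  have hb : ∀ k, b k ∈ H := fun k => mul_mem (hRH (f.coeff k).2) (hinv _ (hRH hcR))
  have h1 := abs_le_of_sum_eq_zero (x := p.1) (b := fun k => (b k).1) (m := m) (n := f.natDegree)
    (le_natDegree_of_mem_supp m hms) (mul_inv_cancel₀ hc) (fun k hk => by
      simp only [b, Prod.fst_mul, Prod.fst_inv]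
      rw [← div_eq_mul_inv, map_div₀, div_lt_one₀ (val_pos_iff.2 hc)]
      exact hlt k hk) h (by
      rw [eval₂_eq_sum_range] at hfp
      have : ∑ k ∈ Finset.range (f.natDegree + 1), (b k).1 * p.1 ^ k =
          (∑ k ∈ Finset.range (f.natDegree + 1), fstHom R (f.coeff k) * p.1 ^ k) * c.1⁻¹ := by
        rw [Finset.sum_mul]
        refine Finset.sum_congr rfl fun k _ => ?_
        simp only [b, Prod.fst_mul, Prod.fst_inv]
        exact mul_right_comm _ _ _
      rw [this, hfp, zero_mul])
  let Q : K × K' := 1 + ∑ k ∈ Finset.range m, 2 * (|(b k).1|, |(b k).2|)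
  have hQ : Q ∈ H := add_mem (one_mem H) <| sum_mem fun k _ =>
    mul_mem (by simp) (hH.abs_mem (hb k))
  have hQ1 : Q.1 = 1 + ∑ k ∈ Finset.range m, 2 * |(b k).1| := by
    simp [Q, Prod.fst_sum]
  have hQ2 : Q.2 = 1 + ∑ k ∈ Finset.range m, 2 * |(b k).2| := by
    simp [Q, Prod.snd_sum]
  have h2 : |p.2| ≤ Q.2 := (hH.le_iff (hH.abs_mem hp) hQ).1 (h1.trans_eq hQ1.symm)
  have hv := val_le_of_le (abs_nonneg _) h2
  rw [val_abs] at hv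
  refine hv.trans ?_
  rw [hQ2]
  refine Valuation.map_add_le _ (map_one _).le (Valuation.map_sum_le _ fun k _ => ?_)
  rw [map_mul, val_abs]
  refine mul_le_one' (by simpa using (val_natCast (K := K') two_ne_zero).le) ?_
  simp only [b, Prod.snd_mul, Prod.snd_inv]
  rw [← div_eq_mul_inv, map_div₀]
  exact div_le_one_of_le₀ ((hR _ (f.coeff k).2 _ hcR).1 (hmax' k)) zero_le

variable (halg : ∀ p ∈ H, ∃ f : R[X], f ≠ 0 ∧ f.eval₂ (fstHom R) p.1 = 0)
include halg

/-- Two terms of a polynomial relation for `p` have equal value, so `w = p ^ m * b * a⁻¹` has value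
1 in the first coordinate. The preceding lemma, applied to `w` and `w⁻¹`, gives the same in the
second. -/
theorem exists_val_pow_eq_of_algebraic {p : K × K'} (hp : p ∈ H) (hp0 : p.1 ≠ 0) :
    ∃ m ≠ 0, ∃ a ∈ R, ∃ b ∈ R, a.1 ≠ 0 ∧ b.1 ≠ 0 ∧ val K p.1 ^ m * val K b.1 = val K a.1 ∧
      val K' p.2 ^ m * val K' b.2 = val K' a.2 := by
  obtain ⟨f, hf, hfp⟩ := halg p hp
  have hf0 : ∀ k ∈ f.support, (f.coeff k : K × K').1 ≠ 0 := fun k hk h0 =>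
    mem_support_iff.1 hk <| Subtype.ext <| hH.eq_of_fst_eq (hRH (f.coeff k).2) (zero_mem H) h0
  rw [eval₂_eq_sum, sum_def] at hfp
  obtain ⟨l, hl, k, hk, hlk, hv⟩ := exists_val_eq_of_sum_eq_zero (nonempty_support_iff.2 hf)
    (fun k hk => mul_ne_zero (hf0 k hk) (pow_ne_zero k hp0)) hfp
  let a : K × K' := f.coeff l
  let b : K × K' := f.coeff k
  have haR : a ∈ R := (f.coeff l).2
  have hbR : b ∈ R := (f.coeff k).2
  have ha0 : a.1 ≠ 0 := hf0 l hl
  have hb0 : b.1 ≠ 0 := hf0 k hk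
  have ha0' : a.2 ≠ 0 := mt (hH.fst_eq_zero_iff (hRH haR)).2 ha0
  have hb0' : b.2 ≠ 0 := mt (hH.fst_eq_zero_iff (hRH hbR)).2 hb0
  have h1 : val K p.1 ^ (k - l) * val K b.1 = val K a.1 := by
    have hpl : val K p.1 ^ l ≠ 0 := pow_ne_zero l ((val K).ne_zero_iff.2 hp0)
    refine mul_right_cancel₀ hpl ?_
    change val K (a.1 * p.1 ^ l) = val K (b.1 * p.1 ^ k) at hv
    rw [map_mul, map_mul, map_pow, map_pow] at hv
    rw [hv, mul_right_comm, ← pow_add, Nat.sub_add_cancel hlk.le, mul_comm]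
  refine ⟨k - l, by omega, a, haR, b, hbR, ha0, hb0, h1, ?_⟩
  let w : K × K' := p ^ (k - l) * b * a⁻¹
  have hw : w ∈ H := mul_mem (mul_mem (pow_mem hp _) (hRH hbR)) (hinv _ (hRH haR))
  have hw1 : val K w.1 = 1 := by
    simp only [w, Prod.fst_mul, Prod.fst_inv, Prod.pow_fst]
    rw [← div_eq_mul_inv, map_div₀, map_mul, map_pow, h1,
      div_self ((val K).ne_zero_iff.2 ha0)]
  have key : ∀ q ∈ H, val K q.1 ≤ 1 → val K' q.2 ≤ 1 := fun q hq h => by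
    obtain ⟨g, hg, hgq⟩ := halg q hq
    exact val_snd_le_one_of_algebraic hRH hH hinv hR hg hq hgq h
  have hw2 : val K' w.2 = 1 := by
    refine le_antisymm (key w hw hw1.le) ?_
    have := key w⁻¹ (hinv w hw) (by rw [Prod.fst_inv, map_inv₀, hw1, inv_one])
    rw [Prod.snd_inv, map_inv₀] at this
    refine (inv_le_one₀ (val_pos_iff.2 ?_)).1 this
    refine mt (hH.fst_eq_zero_iff hw).2 ((val K).ne_zero_iff.1 ?_)
    rw [hw1]
    exact one_ne_zero
  simp only [w, Prod.snd_mul, Prod.snd_inv, Prod.pow_snd] at hw2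
  rwa [← div_eq_mul_inv, map_div₀, map_mul, map_pow,
    div_eq_one_iff_eq ((val K').ne_zero_iff.2 ha0')] at hw2

theorem ValGraph.of_algebraic : ValGraph H := by
  have key : ∀ p ∈ H, val K p.1 ≤ 1 ↔ val K' p.2 ≤ 1 := by
    intro p hp
    by_cases hp0 : p.1 = 0
    · rw [(hH.fst_eq_zero_iff hp).1 hp0, hp0]
      simp
    · obtain ⟨m, hm, a, ha, b, hb, -, hb0, h1, h2⟩ :=
        exists_val_pow_eq_of_algebraic hRH hH hinv hR halg hp hp0
      have hb0' : b.2 ≠ 0 := mt (hH.fst_eq_zero_iff (hRH hb)).2 hb0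
      rw [← pow_le_one_iff hm, ← pow_le_one_iff (x := val K' p.2) hm,
        ← mul_le_iff_le_one_left (val_pos_iff.2 hb0), h1,
        ← mul_le_iff_le_one_left (val_pos_iff.2 hb0'), h2]
      exact hR a ha b hb
  intro p hp q hq
  by_cases hq0 : q.1 = 0
  · rw [(hH.fst_eq_zero_iff hq).1 hq0, hq0, map_zero, map_zero, le_zero_iff, le_zero_iff,
      map_eq_zero, map_eq_zero]
    exact hH.fst_eq_zero_iff hp
  · have hq0' : q.2 ≠ 0 := mt (hH.fst_eq_zero_iff hq).2 hq0
    have h := key (p * q⁻¹) (mul_mem hp (hinv q hq))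
    simp only [Prod.snd_mul, Prod.snd_inv, Prod.fst_mul, Prod.fst_inv] at h
    rwa [← div_eq_mul_inv, ← div_eq_mul_inv, map_div₀, map_div₀,
      div_le_one₀ (val_pos_iff.2 hq0), div_le_one₀ (val_pos_iff.2 hq0')] at h

end Algebraic

/-! ### The derivation on algebraic extensions. -/

section Derivation

/-- The componentwise derivation. -/
def derivProd (p : K × K') : K × K' := (p.1′, p.2′)

theorem derivProd_add (p q : K × K') : derivProd (p + q) = derivProd p + derivProd q :=
  Prod.ext (map_add _ _ _) (map_add _ _ _)

theorem derivProd_mul (p q : K × K') : derivProd (p * q) = p * derivProd q + q * derivProd p :=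
  Prod.ext (Derivation.leibniz _ _ _) (Derivation.leibniz _ _ _)

theorem exists_derivProd_eval₂ {G H : Subring (K × K')} (hGH : G ≤ H) {q : K × K'} (hq : q ∈ H)
    (hG : ∀ p ∈ G, derivProd p ∈ H) (f : G[X]) :
    ∃ w ∈ H, derivProd (f.eval₂ G.subtype q) =
      w + f.derivative.eval₂ G.subtype q * derivProd q := by
  have hev : ∀ g : G[X], g.eval₂ G.subtype q ∈ H := fun g => by
    rw [eval₂_eq_sum_range]
    exact sum_mem fun k _ => mul_mem (hGH (g.coeff k).2) (pow_mem hq k)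
  induction f using Polynomial.induction_on with
  | C a =>
    refine ⟨derivProd a, hG a a.2, ?_⟩
    simp
  | add f g hf hg =>
    obtain ⟨w, hw, h1⟩ := hf
    obtain ⟨x, hx, h2⟩ := hg
    refine ⟨w + x, add_mem hw hx, ?_⟩
    rw [eval₂_add, derivProd_add, h1, h2, derivative_add, eval₂_add]
    ring
  | monomial n a hf =>
    obtain ⟨w, hw, h1⟩ := hf
    refine ⟨q * w, mul_mem hq hw, ?_⟩
    rw [pow_succ, ← mul_assoc, derivative_mul, derivative_X, mul_one, eval₂_mul, derivProd_mul, h1, eval₂_X,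
      eval₂_add, eval₂_mul _ _ (p := derivative _), eval₂_X]
    ring

theorem derivProd_mem_adjoin {G : Subring (K × K')} {q : K × K'}
    (hG : ∀ p ∈ G, derivProd p ∈ G) (hq : derivProd q ∈ G) {p : K × K'} (hp : p ∈ adjoin G q) :
    derivProd p ∈ adjoin G q := by
  obtain ⟨f, rfl⟩ := hp
  obtain ⟨w, hw, h⟩ := exists_derivProd_eval₂ (le_adjoin G q) (mem_adjoin G q)
    (fun p hp => le_adjoin G q (hG p hp)) f
  rw [coe_eval₂RingHom, h]
  exact add_mem hw (mul_mem ⟨_, rfl⟩ (le_adjoin G q hq))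

/-- Differentiating a relation `f(p) = 0` of least degree gives a linear equation for the derivative
of `p`, with nonzero coefficient `f.derivative` at `p`. It is solved inside `H` for both coordinates
at once. -/
theorem derivProd_mem_of_algebraic {R H : Subring (K × K')} (hRH : R ≤ H) (hH : OrdGraph H)
    (hinv : ∀ p ∈ H, p⁻¹ ∈ H) (hR : ∀ p ∈ R, derivProd p ∈ R)
    (halg : ∀ p ∈ H, ∃ f : R[X], f ≠ 0 ∧ f.eval₂ (fstHom R) p.1 = 0) {p : K × K'} (hp : p ∈ H) :
    derivProd p ∈ H := by
  classical
  have hex : ∃ n, ∃ f : R[X], f.natDegree = n ∧ f ≠ 0 ∧ f.eval₂ (fstHom R) p.1 = 0 := by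
    obtain ⟨f, hf⟩ := halg p hp
    exact ⟨_, f, rfl, hf⟩
  obtain ⟨f, hn, hf, hfp⟩ := Nat.find_spec hex
  have hev : ∀ g : R[X], g.eval₂ R.subtype p ∈ H := fun g => by
    rw [eval₂_eq_sum_range]
    exact sum_mem fun k _ => mul_mem (hRH (g.coeff k).2) (pow_mem hp k)
  have hdeg : f.natDegree ≠ 0 := by
    intro h0
    rw [eq_C_of_natDegree_eq_zero h0, eval₂_C] at hfp
    refine hf ?_
    rw [eq_C_of_natDegree_eq_zero h0, C_eq_zero]
    exact Subtype.ext (hH.eq_of_fst_eq (hRH (f.coeff 0).2) (zero_mem H) hfp)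
  have : CharZero R := ⟨fun m n h => by
    have := congrArg (fstHom R) h
    simpa using this⟩
  have : IsDomain R := (show Function.Injective (fstHom R) from fun a b h =>
    Subtype.ext (hH.eq_of_fst_eq (hRH a.2) (hRH b.2) h)).isDomain (fstHom R)
  have hf' : f.derivative.eval₂ (fstHom R) p.1 ≠ 0 := by
    intro h0
    have hlt := natDegree_derivative_lt hdeg
    refine Nat.find_min hex (hn ▸ hlt) ⟨_, rfl, fun h1 => hdeg ?_, h0⟩
    exact derivative_eq_zero.1 h1
  obtain ⟨w, hw, h⟩ := exists_derivProd_eval₂ hRH hp (fun p hp => hRH (hR p hp)) f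
  have hfp0 : f.eval₂ R.subtype p = 0 := hH.eq_of_fst_eq (hev f) (zero_mem H) (by
    rw [eval₂_fst]
    exact hfp)
  set d := f.derivative.eval₂ R.subtype p with hd
  have hdH : d ∈ H := hev _
  have hd1 : d.1 ≠ 0 := by rwa [hd, eval₂_fst]
  have hd2 : d.2 ≠ 0 := mt (hH.fst_eq_zero_iff hdH).2 hd1
  have hD0 : derivProd (0 : K × K') = 0 := Prod.ext (map_zero _) (map_zero _)
  rw [hfp0, hD0] at h
  have : derivProd p = -w * d⁻¹ := by
    have h1 : d * d⁻¹ = 1 := Prod.ext (mul_inv_cancel₀ hd1) (mul_inv_cancel₀ hd2)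
    linear_combination (-derivProd p) * h1 - d⁻¹ * h
  rw [this]
  exact mul_mem (neg_mem hw) (hinv d hdH)

end Derivation

end Graphs

end HFields

end

/-! ## Common subfields of two H-fields -/

noncomputable section

open scoped Differential
open Polynomial

namespace HFields

open RealClosed

theorem lt_iff_neg_of_val_lt {K : Type*} [Field K] [LinearOrder K] [IsStrictOrderedRing K]
    [Differential K] {x u : K} (h : val K x < val K u) : u < x ↔ u < 0 := by
  have := abs_lt_of_val_lt h
  rcases lt_trichotomy u 0 with hu | rfl | hu
  · rw [abs_of_neg hu] at this
    exact ⟨fun _ => hu, fun _ => by linarith [neg_abs_le x]⟩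
  · rw [map_zero] at h
    exact absurd h not_lt_zero
  · rw [abs_of_pos hu] at this
    exact ⟨fun h => by linarith [le_abs_self x], fun h => by linarith⟩

/-! ### A common subfield, its cuts and its values. -/

section Common

variable {K K' E : Type*} [Field K] [LinearOrder K] [IsStrictOrderedRing K] [Differential K]
  [Field K'] [LinearOrder K'] [IsStrictOrderedRing K'] [Differential K']
  [Field E] [LinearOrder E] [IsStrictOrderedRing E]

/-- `E` is, via `i` and `j`, a common real closed differential subfield of `K` and `K'`, with the
same ordering, valuation and predicate `I`. -/
structure IsCommonSubfield (i : E →+* K) (j : E →+* K') : Prop where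
  mono_fst : Monotone i
  mono_snd : Monotone j
  relClosed_fst : RelClosed i
  relClosed_snd : RelClosed j
  exists_deriv : ∀ e, ∃ d, i d = (i e)′ ∧ (j d = (j e)′)
  val_le_iff : ∀ e f, val K (i e) ≤ val K (i f) ↔ val K' (j e) ≤ val K' (j f)
  mem_setI_iff : ∀ e, i e ∈ setI K ↔ j e ∈ setI K'

namespace IsCommonSubfield

variable {i : E →+* K} {j : E →+* K'} (h : IsCommonSubfield i j)
include h

theorem swap : IsCommonSubfield j i where
  mono_fst := h.mono_snd
  mono_snd := h.mono_fst
  relClosed_fst := h.relClosed_snd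
  relClosed_snd := h.relClosed_fst
  exists_deriv := fun e => (h.exists_deriv e).imp fun _ => And.symm
  val_le_iff := fun e f => (h.val_le_iff e f).symm
  mem_setI_iff := fun e => (h.mem_setI_iff e).symm

theorem val_lt_iff (e f : E) : val K (i e) < val K (i f) ↔ val K' (j e) < val K' (j f) := by
  rw [← not_le, ← not_le, h.val_le_iff]

theorem val_lt_one_iff (e : E) : val K (i e) < 1 ↔ val K' (j e) < 1 := by
  have := h.val_lt_iff e 1
  simpa using this

theorem neg_fst (e : E) : i e < 0 ↔ e < 0 := by
  rw [← map_zero i]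
  exact (h.mono_fst.strictMono_of_injective i.injective).lt_iff_lt

variable (hK : IsHField K) (hK' : IsHField K') {y : K} {z : K'} (hy : val K y < 1)
  (hz : val K' z < 1) {a : E} (hya : i a = y′) (hza : j a = z′)
include hK hK' hy hz hya hza

theorem eq_snd_of_eq_fst {e : E} (he : i e = y) : j e = z := by
  obtain ⟨d, hd1, hd2⟩ := h.exists_deriv e
  have had : a = d := i.injective (by rw [hya, hd1, he])
  refine hK'.eq_of_deriv_eq ((h.val_lt_one_iff e).1 (he ▸ hy)) hz ?_
  rw [← hd2, ← had, hza]

/-- For infinitesimal `e`, the sign of `y - e` is opposite to that of its derivative, which lies in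
`E`. Any other `e` dominates both integrals strictly, so its own sign decides. -/
theorem lt_iff (e : E) : i e < y ↔ j e < z := by
  by_cases h1 : val K (i e) < 1
  · have h2 := (h.val_lt_one_iff e).1 h1
    obtain ⟨d, hd1, hd2⟩ := h.exists_deriv e
    rw [← sub_pos, hK.pos_iff_deriv_neg (Valuation.map_sub_lt _ hy h1), map_sub, ← hya, ← hd1,
      ← sub_pos (b := j e), hK'.pos_iff_deriv_neg (Valuation.map_sub_lt _ hz h2), map_sub, ← hza,
      ← hd2, ← map_sub, ← map_sub, h.neg_fst, h.swap.neg_fst]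
  · have h2 := mt (h.val_lt_one_iff e).2 h1
    rw [lt_iff_neg_of_val_lt (hy.trans_le (not_lt.1 h1)),
      lt_iff_neg_of_val_lt (hz.trans_le (not_lt.1 h2)), h.neg_fst, h.swap.neg_fst]

end IsCommonSubfield

/-- The valuation on `E[y]` and `E[z]` is controlled by elements of `E` and powers of `y` and `z`
with exponents in `M`. -/
structure IsControlled (i : E →+* K) (j : E →+* K') (y : K) (z : K') (M : AddSubmonoid ℕ) :
    Prop where
  fst_ne_zero : y ≠ 0
  snd_ne_zero : z ≠ 0
  le_iff : ∀ c, val K (i c) ≤ val K y ↔ val K' (j c) ≤ val K' z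
  ge_iff : ∀ c, val K y ≤ val K (i c) ↔ val K' z ≤ val K' (j c)
  val_sub : ∀ g, ∃ e ≠ 0, ∃ k ∈ M, val K (y - i g) = val K (i e) * val K y ^ k ∧
    val K' (z - j g) = val K' (j e) * val K' z ^ k

namespace IsControlled

/-- The value group of a real closed field is divisible, with roots taken simultaneously in `K` and
`K'`. -/
theorem exists_root [IsRealClosed E] (i : E →+* K) (j : E →+* K') (c : E) {k : ℕ} (hk : k ≠ 0) :
    ∃ r, val K (i r) ^ k = val K (i c) ∧ val K' (j r) ^ k = val K' (j c) := by
  obtain ⟨r, hr⟩ := IsRealClosed.exists_eq_pow_of_nonneg (abs_nonneg c) hk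
  refine ⟨r, ?_, ?_⟩ <;>
  · rw [← map_pow, ← map_pow, ← hr]
    rcases abs_choice c with h | h <;> rw [h]
    rw [map_neg, Valuation.map_neg]

variable [IsRealClosed E] {i : E →+* K} {j : E →+* K'} {y : K} {z : K'} {M : AddSubmonoid ℕ}
  (h : IsControlled i j y z M) (hE : IsCommonSubfield i j)
include h hE

theorem le_pow_iff (c : E) (k : ℕ) : val K (i c) ≤ val K y ^ k ↔ val K' (j c) ≤ val K' z ^ k := by
  rcases eq_or_ne k 0 with rfl | hk
  · rw [pow_zero, pow_zero]
    simpa using hE.val_le_iff c 1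
  · obtain ⟨r, h1, h2⟩ := exists_root i j c hk
    rw [← h1, ← h2, pow_le_pow_iff_left₀ zero_le zero_le hk,
      pow_le_pow_iff_left₀ zero_le zero_le hk]
    exact h.le_iff r

theorem pow_le_iff (c : E) (k : ℕ) : val K y ^ k ≤ val K (i c) ↔ val K' z ^ k ≤ val K' (j c) := by
  rcases eq_or_ne k 0 with rfl | hk
  · rw [pow_zero, pow_zero]
    simpa using hE.val_le_iff 1 c
  · obtain ⟨r, h1, h2⟩ := exists_root i j c hk
    rw [← h1, ← h2, pow_le_pow_iff_left₀ zero_le zero_le hk,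
      pow_le_pow_iff_left₀ zero_le zero_le hk]
    exact h.ge_iff r

theorem mul_pow_le_iff (e f : E) (k l : ℕ) :
    val K (i e) * val K y ^ k ≤ val K (i f) * val K y ^ l ↔
      val K' (j e) * val K' z ^ k ≤ val K' (j f) * val K' z ^ l := by
  have hy : ∀ n, 0 < val K y ^ n := fun n => pow_pos (val_pos_iff.2 h.fst_ne_zero) n
  have hz : ∀ n, 0 < val K' z ^ n := fun n => pow_pos (val_pos_iff.2 h.snd_ne_zero) n
  rcases eq_or_ne e 0 with rfl | he
  · simp
  rcases eq_or_ne f 0 with rfl | hf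
  · simp [he, h.fst_ne_zero, h.snd_ne_zero]
  have hve : 0 < val K (i e) := val_pos_iff.2 ((map_ne_zero i).2 he)
  have hve' : 0 < val K' (j e) := val_pos_iff.2 ((map_ne_zero j).2 he)
  have hvf : 0 < val K (i f) := val_pos_iff.2 ((map_ne_zero i).2 hf)
  have hvf' : 0 < val K' (j f) := val_pos_iff.2 ((map_ne_zero j).2 hf)
  rcases le_total k l with hkl | hkl
  · obtain ⟨n, rfl⟩ := Nat.exists_eq_add_of_le' hkl
    have := h.le_pow_iff hE (e / f) n
    rw [map_div₀, map_div₀, map_div₀, map_div₀, div_le_iff₀ hvf, div_le_iff₀ hvf'] at this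
    rw [pow_add, pow_add, ← mul_assoc, ← mul_assoc, mul_le_mul_iff_left₀ (hy k),
      mul_le_mul_iff_left₀ (hz k), mul_comm (val K (i f)), mul_comm (val K' (j f))]
    exact this
  · obtain ⟨n, rfl⟩ := Nat.exists_eq_add_of_le' hkl
    have := h.pow_le_iff hE (f / e) n
    rw [map_div₀, map_div₀, map_div₀, map_div₀, le_div_iff₀ hve, le_div_iff₀ hve'] at this
    rw [pow_add, pow_add, ← mul_assoc, ← mul_assoc, mul_le_mul_iff_left₀ (hy l),
      mul_le_mul_iff_left₀ (hz l), mul_comm (val K (i e)), mul_comm (val K' (j e))]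
    exact this

/-- Values are multiplicative over the factors of `f`. A factor `(X - b)² + c²` takes the larger of
the two values, and `mul_pow_le_iff` ensures the same choice on both sides. -/
theorem exists_val_eval₂ {f : E[X]} (hf : f ≠ 0) : ∃ e ≠ 0, ∃ k ∈ M,
    val K (f.eval₂ i y) = val K (i e) * val K y ^ k ∧
      val K' (f.eval₂ j z) = val K' (j e) * val K' z ^ k := by
  refine poly_induction (motive := fun f => ∃ e ≠ 0, ∃ k ∈ M,
    val K (f.eval₂ i y) = val K (i e) * val K y ^ k ∧
      val K' (f.eval₂ j z) = val K' (j e) * val K' z ^ k) ?_ ?_ ?_ ?_ hf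
  · intro d hd
    exact ⟨d, hd, 0, zero_mem M, by simp, by simp⟩
  · rintro p q ⟨e, he, k, hk, h1, h2⟩ ⟨f, hf, l, hl, h3, h4⟩
    refine ⟨e * f, mul_ne_zero he hf, k + l, add_mem hk hl, ?_, ?_⟩
    · rw [eval₂_mul, map_mul, h1, h3, map_mul, map_mul, pow_add, mul_mul_mul_comm]
    · rw [eval₂_mul, map_mul, h2, h4, map_mul, map_mul, pow_add, mul_mul_mul_comm]
  · intro a
    simpa using h.val_sub a
  · intro b c hc
    obtain ⟨e, he, k, hk, h1, h2⟩ := h.val_sub b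
    simp only [eval₂_add, eval₂_pow, eval₂_sub, eval₂_X, eval₂_C]
    rw [val_sq_add_sq, val_sq_add_sq, h1, h2]
    have e1 : (val K (i e) * val K y ^ k) ^ 2 = val K (i (e ^ 2)) * val K y ^ (k * 2) := by
      rw [mul_pow, map_pow, map_pow, pow_mul]
    have e2 : (val K' (j e) * val K' z ^ k) ^ 2 = val K' (j (e ^ 2)) * val K' z ^ (k * 2) := by
      rw [mul_pow, map_pow, map_pow, pow_mul]
    have e3 : val K (i c) ^ 2 = val K (i (c ^ 2)) * val K y ^ 0 := by
      rw [map_pow, map_pow, pow_zero, mul_one]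
    have e4 : val K' (j c) ^ 2 = val K' (j (c ^ 2)) * val K' z ^ 0 := by
      rw [map_pow, map_pow, pow_zero, mul_one]
    rw [e1, e2, e3, e4]
    have hiff := h.mul_pow_le_iff hE (c ^ 2) (e ^ 2) 0 (k * 2)
    by_cases hle : val K (i (c ^ 2)) * val K y ^ 0 ≤ val K (i (e ^ 2)) * val K y ^ (k * 2)
    · exact ⟨e ^ 2, pow_ne_zero 2 he, k * 2, by rw [mul_two]; exact add_mem hk hk, max_eq_left hle,
        max_eq_left (hiff.1 hle)⟩
    · exact ⟨c ^ 2, pow_ne_zero 2 hc, 0, zero_mem M, max_eq_right (not_le.1 hle).le,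
        max_eq_right (not_le.1 (mt hiff.2 hle)).le⟩

theorem val_eval₂_le_iff (f g : E[X]) : val K (f.eval₂ i y) ≤ val K (g.eval₂ i y) ↔
    val K' (f.eval₂ j z) ≤ val K' (g.eval₂ j z) := by
  have key : ∀ f : E[X], ∃ e k, val K (f.eval₂ i y) = val K (i e) * val K y ^ k ∧
      val K' (f.eval₂ j z) = val K' (j e) * val K' z ^ k := by
    intro f
    rcases eq_or_ne f 0 with rfl | hf
    · exact ⟨0, 0, by simp, by simp⟩
    · obtain ⟨e, -, k, -, h⟩ := h.exists_val_eval₂ hE hf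
      exact ⟨e, k, h⟩
  obtain ⟨e, k, h1, h2⟩ := key f
  obtain ⟨d, l, h3, h4⟩ := key g
  rw [h1, h2, h3, h4]
  exact h.mul_pow_le_iff hE e d k l

end IsControlled

end Common

end HFields

end

/-! ## Adjoining a small integral -/

noncomputable section

open scoped Differential
open Polynomial

namespace HFields

open RealClosed

section

variable {K : Type*} [Field K] [LinearOrder K] [IsStrictOrderedRing K] [Differential K]

theorem IsHField.val_lt_iff_deriv (hK : IsHField K) {f g : K} (hf : val K f < 1)
    (hg : val K g < 1) : val K f < val K g ↔ val K f′ < val K g′ :=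
  ⟨fun h => hK.val_deriv_lt h hg, fun h => lt_of_not_ge fun h' => h.not_ge (hK.val_deriv_le h' hf)⟩

theorem deriv_sub (a b : K) : (a - b)′ = a′ - b′ := map_sub _ _ _

theorem zero_mem_setI : (0 : K) ∈ setI K :=
  mem_setI_iff.2 ⟨0, by simp, by simp⟩

end

/-! ### Extending a good graph by one small integral. -/

section Extension

variable {K K' E : Type*} [Field K] [LinearOrder K] [IsStrictOrderedRing K] [Differential K]
  [Field K'] [LinearOrder K'] [IsStrictOrderedRing K'] [Differential K']

theorem IsCommonSubfield.exists_isControlled [IsRealClosed K] [IsRealClosed K']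
    [Field E] [LinearOrder E] [IsStrictOrderedRing E] {i : E →+* K} {j : E →+* K'}
    (h : IsCommonSubfield i j) (hK : IsHField K) (hK' : IsHField K') {y : K} {z : K'}
    (hy : val K y < 1) (hz : val K' z < 1) {a : E} (hya : i a = y′) (hza : j a = z′)
    (hne : ∀ e, i e ≠ y) :
    ∃ e M, val K (i e) < 1 ∧ IsControlled i j (y - i e) (z - j e) M ∧
      (M = ⊥ ∨ (∀ c, val K (i c) < 1 → val K (i c) < val K (y - i e)) ∧
        ∀ c, val K' (j c) < 1 → val K' (j c) < val K' (z - j e)) := by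
  have hne' : ∀ e, j e ≠ z := fun e he =>
    hne e (h.swap.eq_snd_of_eq_fst hK' hK hz hy hza hya he)
  have hcmp : ∀ e f, val K (i e) < 1 → val K (i f) < 1 →
      (val K (y - i e) < val K (y - i f) ↔ val K' (z - j e) < val K' (z - j f)) := by
    intro e f he hf
    obtain ⟨d, hd1, hd2⟩ := h.exists_deriv e
    obtain ⟨g, hg1, hg2⟩ := h.exists_deriv f
    rw [hK.val_lt_iff_deriv (Valuation.map_sub_lt _ hy he) (Valuation.map_sub_lt _ hy hf),
      hK'.val_lt_iff_deriv (Valuation.map_sub_lt _ hz ((h.val_lt_one_iff e).1 he))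
        (Valuation.map_sub_lt _ hz ((h.val_lt_one_iff f).1 hf)), deriv_sub, deriv_sub,
      deriv_sub, deriv_sub, ← hya, ← hza, ← hd1, ← hd2, ← hg1, ← hg2, ← map_sub, ← map_sub, ← map_sub,
      ← map_sub]
    exact h.val_lt_iff _ _
  -- Either every infinitesimal approximation of `y` from `E` can be improved, or there is a best
  -- one. In the first case all values of `y - g` are attained in `E`, so no powers of `y` are
  -- needed and `M = ⊥`.
  by_cases hbest : ∀ g, val K (i g) < 1 → ∃ f, val K (i f) < 1 ∧ val K (y - i f) < val K (y - i g)
  · have hlin : ∀ g, ∃ e ≠ 0, ∃ k ∈ (⊥ : AddSubmonoid ℕ),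
        val K (y - i g) = val K (i e) * val K y ^ k ∧
          val K' (z - j g) = val K' (j e) * val K' z ^ k := by
      intro g
      by_cases hg : val K (i g) < 1
      · obtain ⟨f, hf, hlt⟩ := hbest g hg
        refine ⟨f - g, ?_, 0, zero_mem _, ?_, ?_⟩
        · rw [sub_ne_zero]
          rintro rfl
          exact lt_irrefl _ hlt
        -- Since `f` is strictly closer to `y` than `g`, the differences `y - g` and `f - g` have
        -- the same value.
        · rw [pow_zero, mul_one, RingHom.map_sub, ← sub_sub_sub_cancel_left (i g) (i f) y,
            Valuation.map_sub_eq_of_lt_left _ hlt]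
        · rw [pow_zero, mul_one, RingHom.map_sub, ← sub_sub_sub_cancel_left (j g) (j f) z,
            Valuation.map_sub_eq_of_lt_left _ ((hcmp f g hf hg).1 hlt)]
      · have hg' := mt (h.val_lt_one_iff g).2 hg
        refine ⟨g, ?_, 0, zero_mem _, ?_, ?_⟩
        · rintro rfl
          exact hg (by simp)
        · rw [pow_zero, mul_one, Valuation.map_sub_eq_of_lt_right _ (hy.trans_le (not_lt.1 hg))]
        · rw [pow_zero, mul_one, Valuation.map_sub_eq_of_lt_right _ (hz.trans_le (not_lt.1 hg'))]
    have h0 : ∃ e, val K y = val K (i e) ∧ val K' z = val K' (j e) := by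
      obtain ⟨e, -, k, hk, h1, h2⟩ := hlin 0
      rw [AddSubmonoid.mem_bot] at hk
      subst hk
      exact ⟨e, by simpa using h1, by simpa using h2⟩
    obtain ⟨e, h1, h2⟩ := h0
    refine ⟨0, ⊥, by simp, ?_, .inl rfl⟩
    rw [map_zero, map_zero, sub_zero, sub_zero]
    exact ⟨fun h0 => hne 0 (by rw [map_zero, h0]), fun h0 => hne' 0 (by rw [map_zero, h0]),
      fun c => by rw [h1, h2]; exact h.val_le_iff c e,
      fun c => by rw [h1, h2]; exact h.val_le_iff e c, hlin⟩
  -- With `g` a best approximation, the value of `y - g` is not attained in `E`, and every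
  -- infinitesimal of `E` lies strictly below it.
  · push Not at hbest
    obtain ⟨g, hg, hmin⟩ := hbest
    have hg' := (h.val_lt_one_iff g).1 hg
    have hmin' : ∀ f, val K' (j f) < 1 → val K' (z - j g) ≤ val K' (z - j f) := fun f hf => by
      have hf' := (h.val_lt_one_iff f).2 hf
      exact not_lt.1 (mt (hcmp f g hf' hg).2 (hmin f hf').not_gt)
    obtain ⟨d, hd1, hd2⟩ := h.exists_deriv g
    have hy1 : val K (y - i g) < 1 := Valuation.map_sub_lt _ hy hg
    have hz1 : val K' (z - j g) < 1 := Valuation.map_sub_lt _ hz hg'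
    have hy0 : y - i g ≠ 0 := sub_ne_zero.2 (hne g).symm
    have hz0 : z - j g ≠ 0 := sub_ne_zero.2 (hne' g).symm
    have hya' : ∃ b, i b = (y - i g)′ := ⟨a - d, by rw [map_sub, map_sub, hya, hd1]⟩
    have hza' : ∃ b, j b = (z - j g)′ := ⟨a - d, by rw [map_sub, map_sub, hza, hd2]⟩
    have hdi : ∀ e, ∃ d, i d = (i e)′ := fun e => (h.exists_deriv e).imp fun _ => And.left
    have hdj : ∀ e, ∃ d, j d = (j e)′ := fun e => (h.exists_deriv e).imp fun _ => And.right
    have h1 := hK.val_ne_of_val_le_sub hdi hy1 hya' hy0 fun e he => by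
      have := hmin (g + e) (by rw [map_add]; exact Valuation.map_add_lt _ hg he)
      rwa [map_add, ← sub_sub] at this
    have h2 := hK'.val_ne_of_val_le_sub hdj hz1 hza' hz0 fun e he => by
      have := hmin' (g + e) (by rw [map_add]; exact Valuation.map_add_lt _ hg' he)
      rwa [map_add, ← sub_sub] at this
    have h3 : ∀ c, val K (i c) < 1 → val K (i c) < val K (y - i g) := fun c hc =>
      hK.val_lt_of_val_ne hdi hy1 hya' h1 hc
    have h4 : ∀ c, val K' (j c) < 1 → val K' (j c) < val K' (z - j g) := fun c hc =>
      hK'.val_lt_of_val_ne hdj hz1 hza' h2 hc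
    refine ⟨g, ⊤, hg, ⟨hy0, hz0, fun c => ?_, fun c => ?_, fun c => ?_⟩, .inr ⟨h3, h4⟩⟩
    · have e1 : val K (i c) ≤ val K (y - i g) ↔ val K (i c) < 1 :=
        ⟨fun hc => hc.trans_lt hy1, fun hc => (h3 c hc).le⟩
      have e2 : val K' (j c) ≤ val K' (z - j g) ↔ val K' (j c) < 1 :=
        ⟨fun hc => hc.trans_lt hz1, fun hc => (h4 c hc).le⟩
      rw [e1, e2, h.val_lt_one_iff]
    · have e1 : val K (i c) < val K (y - i g) ↔ val K (i c) < 1 :=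
        ⟨fun hc => hc.trans hy1, fun hc => h3 c hc⟩
      have e2 : val K' (j c) < val K' (z - j g) ↔ val K' (j c) < 1 :=
        ⟨fun hc => hc.trans hz1, fun hc => h4 c hc⟩
      rw [← not_lt, ← not_lt, e1, e2, h.val_lt_one_iff]
    · by_cases hc : val K (i c) < 1
      · refine ⟨1, one_ne_zero, 1, trivial, ?_, ?_⟩
        · rw [map_one, map_one, one_mul, pow_one, Valuation.map_sub_eq_of_lt_left _ (h3 c hc)]
        · rw [map_one, map_one, one_mul, pow_one,
            Valuation.map_sub_eq_of_lt_left _ (h4 c ((h.val_lt_one_iff c).1 hc))]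
      · have hc' := mt (h.val_lt_one_iff c).2 hc
        refine ⟨c, ?_, 0, trivial, ?_, ?_⟩
        · rintro rfl
          exact hc (by simp)
        · rw [pow_zero, mul_one, Valuation.map_sub_eq_of_lt_right _ (hy1.trans_le (not_lt.1 hc))]
        · rw [pow_zero, mul_one, Valuation.map_sub_eq_of_lt_right _ (hz1.trans_le (not_lt.1 hc'))]

/-- `G` is the graph of an isomorphism between real closed differential subfields of `K` and `K'`
that respects the ordering, the valuation, and the predicate `I`. -/
structure IsGood (G : Subring (K × K')) : Prop where
  ord : OrdGraph G
  inv_mem : ∀ p ∈ G, p⁻¹ ∈ G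
  derivProd_mem : ∀ p ∈ G, derivProd p ∈ G
  val : ValGraph G
  mem_setI_iff : ∀ p ∈ G, p.1 ∈ setI K ↔ p.2 ∈ setI K'
  relClosed_fst : RelClosed (fstHom G)
  relClosed_snd : RelClosed (sndHom G)

theorem IsGood.exists_isCommonSubfield.{w, v} {K : Type w} {K' : Type v} [Field K] [LinearOrder K]
    [IsStrictOrderedRing K] [Differential K] [Field K'] [LinearOrder K'] [IsStrictOrderedRing K']
    [Differential K'] [IsRealClosed K] {G : Subring (K × K')} (hG : IsGood G) :
    ∃ (E : Type (max w v)) (_ : Field E) (_ : LinearOrder E) (_ : IsStrictOrderedRing E)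
      (i : E →+* K) (j : E →+* K'), IsCommonSubfield i j ∧ IsRealClosed E ∧
      (∀ p, p ∈ G ↔ ∃ e, p = (i e, j e)) ∧
      ∀ f : G[X], ∃ g : E[X], ∀ q : K × K', f.eval₂ (fstHom G) q.1 = g.eval₂ i q.1 ∧
        f.eval₂ (sndHom G) q.2 = g.eval₂ j q.2 := by
  obtain ⟨E, _, _, _, e, hi, hj⟩ := hG.ord.exists_orderedField hG.inv_mem
  have hri := (relClosed_comp_iff e).2 hG.relClosed_fst
  refine ⟨E, _, _, ‹_›, _, _, ⟨hi, hj, hri, (relClosed_comp_iff e).2 hG.relClosed_snd,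
    fun c => ?_, fun c d => hG.val _ (e c).2 _ (e d).2, fun c => hG.mem_setI_iff _ (e c).2⟩,
    hri.isRealClosed hi, fun p => ⟨fun hp => ⟨e.symm ⟨p, hp⟩, by simp⟩, ?_⟩, fun f => ?_⟩
  · exact ⟨e.symm ⟨_, hG.derivProd_mem _ (e c).2⟩, by simp [derivProd], by simp [derivProd]⟩
  · rintro ⟨c, rfl⟩
    exact (e c).2
  · refine ⟨f.map (e.symm : G →+* E), fun q => ?_⟩
    constructor <;>
    · rw [eval₂_map, RingHom.comp_assoc]
      simp

/-- Applies the hypothesis to an `n`-th root of `|e|` in `E`. -/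
theorem le_pow_of_lt_one [Field E] [LinearOrder E] [IsStrictOrderedRing E]
    [IsRealClosed E] {i : E →+* K} {y : K}
    (h : ∀ c, val K (i c) < 1 → val K (i c) < val K y) {e : E}
    (he : val K (i e) < 1) (n : ℕ) : val K (i e) ≤ val K y ^ n := by
  rcases eq_or_ne n 0 with rfl | hn
  · rw [pow_zero]
    exact he.le
  · obtain ⟨r, hr, -⟩ := IsControlled.exists_root i i e hn
    rw [← hr] at he ⊢
    exact pow_le_pow_left₀ zero_le (h r ((pow_lt_one_iff hn).1 he)).le n

theorem one_lt_mul_pow [Field E] [LinearOrder E] [IsStrictOrderedRing E]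
    [IsRealClosed E] {i : E →+* K} {y : K} (hy : val K y < 1) (hy0 : y ≠ 0)
    (h : ∀ c, val K (i c) < 1 → val K (i c) < val K y) {e : E}
    (he : 1 < val K (i e)) (n : ℕ) : 1 < val K (i e) * val K y ^ n := by
  have hvy := val_pos_iff.2 hy0
  have hve : 0 < val K (i e) := zero_lt_one.trans he
  -- The exponent `n + 1` leaves a spare factor `val K y < 1`, which makes the final inequality
  -- strict.
  have h1 := le_pow_of_lt_one h (e := e⁻¹)
    (by rw [map_inv₀, map_inv₀]; exact inv_lt_one_of_one_lt₀ he) (n + 1)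
  rw [map_inv₀, map_inv₀, inv_le_iff_one_le_mul₀' hve] at h1
  refine h1.trans_lt ?_
  rw [pow_succ, ← mul_assoc]
  exact mul_lt_of_lt_one_right (mul_pos hve (pow_pos hvy n)) hy

theorem IsGood.exists_extension [IsRealClosed K] [IsRealClosed K'] {G : Subring (K × K')}
    (hG : IsGood G) (hK : IsHField K) (hK' : IsHField K') {y : K} {z : K'} (hy : HFields.val K y < 1)
    (hz : HFields.val K' z < 1) (hyz : (y′, z′) ∈ G) :
    ∃ H, G ≤ H ∧ IsGood H ∧ (y, z) ∈ H := by
  obtain ⟨E, _, _, _, i, j, hE, hRC, hmem, hpoly⟩ := hG.exists_isCommonSubfield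
  obtain ⟨a, ha⟩ := (hmem _).1 hyz
  obtain ⟨hya, hza⟩ := Prod.ext_iff.1 ha
  change y′ = i a at hya
  change z′ = j a at hza
  by_cases hne : ∃ e, i e = y
  · obtain ⟨e, he⟩ := hne
    have := hE.eq_snd_of_eq_fst hK hK' hy hz hya.symm hza.symm he
    exact ⟨G, le_rfl, hG, (hmem _).2 ⟨e, by rw [he, this]⟩⟩
  push Not at hne
  obtain ⟨b, M, hb, hc, hM⟩ := hE.exists_isControlled hK hK' hy hz hya.symm hza.symm hne
  obtain ⟨d, hd1, hd2⟩ := hE.exists_deriv b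
  have hbG : (i b, j b) ∈ G := (hmem _).2 ⟨b, rfl⟩
  -- The best approximation `b` is subtracted on both sides; it is `0` when no correction is needed.
  let q : K × K' := (y - i b, z - j b)
  have hq1 : HFields.val K q.1 < 1 := Valuation.map_sub_lt _ hy hb
  have hq2 : HFields.val K' q.2 < 1 := Valuation.map_sub_lt _ hz ((hE.val_lt_one_iff b).1 hb)
  have hqa : i (a - d) = q.1′ := by rw [RingHom.map_sub, hd1, ← hya, deriv_sub]
  have hqa' : j (a - d) = q.2′ := by rw [RingHom.map_sub, hd2, ← hza, deriv_sub]
  have hqne : ∀ e, i e ≠ q.1 := fun e he => hne (e + b) (by rw [map_add, he, sub_add_cancel])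
  have hqne' : ∀ e, j e ≠ q.2 := fun e he =>
    hqne e (hE.swap.eq_snd_of_eq_fst hK' hK hq2 hq1 hqa' hqa he)
  have hR : OrdGraph (adjoin G q) := OrdGraph.adjoin fun f => by
    obtain ⟨g, hg⟩ := hpoly f
    rw [(hg q).1, (hg q).2]
    exact sign_eq_of_cut_eq (fun e => hE.lt_iff hK hK' hq1 hq2 hqa hqa' e) hqne hqne' g
  have hRpoly : ∀ p ∈ adjoin G q, ∃ g : E[X], p.1 = g.eval₂ i q.1 ∧ p.2 = g.eval₂ j q.2 := by
    rintro _ ⟨f, rfl⟩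
    obtain ⟨g, hg⟩ := hpoly f
    exact ⟨g, by rw [← (hg q).1, ← eval₂_fst]; rfl, by rw [← (hg q).2, ← eval₂_snd]; rfl⟩
  have hRval : ValGraph (adjoin G q) := by
    intro p hp r hr
    obtain ⟨f, h1, h2⟩ := hRpoly p hp
    obtain ⟨g, h3, h4⟩ := hRpoly r hr
    rw [h1, h2, h3, h4]
    exact hc.val_eval₂_le_iff hE f g
  have hqD : derivProd q ∈ G := (hmem _).2 ⟨a - d, by rw [hqa, hqa']; rfl⟩
  have hRD : ∀ p ∈ adjoin G q, derivProd p ∈ adjoin G q := fun p hp =>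
    derivProd_mem_adjoin hG.derivProd_mem hqD hp
  obtain ⟨H, hRH, hH, hinv, hrc, hrc', halg⟩ := hR.exists_relClosed
  have hGH : G ≤ H := (le_adjoin G q).trans hRH
  have hqH : q ∈ H := hRH (mem_adjoin G q)
  have hHval : ValGraph H := .of_algebraic hRH hH hinv hRval halg
  -- Modulo powers of the value of `q`, the values on `H` are torsion over those of `E`, with the
  -- same relation in both coordinates.
  have htors : ∀ p ∈ H, p.1 ≠ 0 → ∃ m ≠ 0, ∃ e, ∃ k ∈ M, ∃ l ∈ M,
      HFields.val K p.1 ^ m * HFields.val K q.1 ^ l = HFields.val K (i e) * HFields.val K q.1 ^ k ∧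
      HFields.val K' p.2 ^ m * HFields.val K' q.2 ^ l =
        HFields.val K' (j e) * HFields.val K' q.2 ^ k := by
    intro p hp hp0
    obtain ⟨m, hm, r, hr, s, hs, hr0, hs0, h1, h2⟩ :=
      exists_val_pow_eq_of_algebraic hRH hH hinv hRval halg hp hp0
    have key : ∀ t ∈ adjoin G q, t.1 ≠ 0 → ∃ e ≠ 0, ∃ k ∈ M,
        HFields.val K t.1 = HFields.val K (i e) * HFields.val K q.1 ^ k ∧
        HFields.val K' t.2 = HFields.val K' (j e) * HFields.val K' q.2 ^ k := by
      intro t ht ht0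
      obtain ⟨f, h3, h4⟩ := hRpoly t ht
      rw [h3, h4]
      refine hc.exists_val_eval₂ hE fun hf => ht0 ?_
      rw [h3, hf, eval₂_zero]
    obtain ⟨e, he, k, hk, h3, h4⟩ := key r hr hr0
    obtain ⟨f, hf, l, hl, h5, h6⟩ := key s hs hs0
    refine ⟨m, hm, e / f, k, hk, l, hl, ?_, ?_⟩
    · rw [map_div₀, map_div₀, div_mul_eq_mul_div,
        eq_div_iff (val_pos_iff.2 ((map_ne_zero i).2 hf)).ne', ← h3, ← h1, h5, mul_assoc,
        mul_comm (HFields.val K (i f))]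
    · rw [map_div₀, map_div₀, div_mul_eq_mul_div,
        eq_div_iff (val_pos_iff.2 ((map_ne_zero j).2 hf)).ne', ← h4, ← h2, h6, mul_assoc,
        mul_comm (HFields.val K' (j f))]
  have hHI : ∀ p ∈ H, p.1 ∈ setI K ↔ p.2 ∈ setI K' := by
    intro p hp
    by_cases hp0 : p.1 = 0
    · rw [(hH.fst_eq_zero_iff hp).1 hp0, hp0]
      exact iff_of_true zero_mem_setI zero_mem_setI
    have hp0' : p.2 ≠ 0 := mt (hH.fst_eq_zero_iff hp).2 hp0
    rcases hM with rfl | ⟨hM1, hM2⟩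
    -- No powers of `q` occur here. By divisibility, `p` has the value of an element of `E`, and
    -- membership in `I` depends on the value only.
    · obtain ⟨m, hm, e, k, hk, l, hl, h1, h2⟩ := htors p hp hp0
      rw [AddSubmonoid.mem_bot] at hk hl
      subst hk hl
      rw [pow_zero, mul_one, mul_one] at h1 h2
      obtain ⟨r, h3, h4⟩ := IsControlled.exists_root i j e hm
      rw [← h3] at h1
      rw [← h4] at h2
      rw [mem_setI_congr (pow_left_injective hm h1), mem_setI_congr (pow_left_injective hm h2)]
      exact hE.mem_setI_iff r
    -- Here `I` is cut out by the logarithmic derivative of `q`, so membership is a comparison of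
    -- values inside `H`.
    · have hD1 := hK.deriv_ne_zero hq1 hc.fst_ne_zero
      have hD2 := hK'.deriv_ne_zero hq2 hc.snd_ne_zero
      obtain ⟨m, hm, e, k, -, l, -, h1, h2⟩ := htors (p * q * (derivProd q)⁻¹)
        (mul_mem (mul_mem hp hqH) (hinv _ (hGH hqD)))
        (mul_ne_zero (mul_ne_zero hp0 hc.fst_ne_zero) (inv_ne_zero hD1))
      rw [hK.mem_setI_iff_lt hq1 hc.fst_ne_zero hp0 hm (by rw [div_eq_mul_inv]; exact h1)
          (fun he n => le_pow_of_lt_one hM1 he n)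
          (fun he n => one_lt_mul_pow hq1 hc.fst_ne_zero hM1 he n),
        hK'.mem_setI_iff_lt hq2 hc.snd_ne_zero hp0' hm (by rw [div_eq_mul_inv]; exact h2)
          (fun he n => le_pow_of_lt_one hM2 he n)
          (fun he n => one_lt_mul_pow hq2 hc.snd_ne_zero hM2 he n)]
      exact hHval.lt_iff (mul_mem hp hqH) (hGH hqD)
  refine ⟨H, hGH, ⟨hH, hinv, fun p hp => derivProd_mem_of_algebraic hRH hH hinv hRD halg hp,
    hHval, hHI, hrc, hrc'⟩, ?_⟩
  have : (y, z) = q + (i b, j b) := Prod.ext (sub_add_cancel _ _).symm (sub_add_cancel _ _).symm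
  rw [this]
  exact add_mem hqH (hGH hbG)

end Extension

end HFields

end

/-! ## Models of `T*` -/

noncomputable section

open FirstOrder FirstOrder.Language
open scoped Differential

namespace HFields

open FirstOrder.Ring

/-! ### Axioms for real closed H-fields with small integration -/

/-- The language of ordered rings as a sublanguage of `ℒ*`. -/
abbrev inclOR : langOR →ᴸ langLstar :=
  LHom.sumInl.comp (LHom.sumInl.comp (LHom.sumInl.comp LHom.sumInl))

section Symbols

/-- The symbol `∂`. -/
abbrev symD : langLstar.Functions 1 := .inl (.inl (.inl (.inr UnarySymbol.sym)))

/-- The symbol `≼`. -/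
abbrev symDom : langLstar.Relations 2 := .inl (.inl (.inl (.inr BinarySymbol.sym)))

/-- The symbol for a semialgebraic function. -/
abbrev symFun {n : ℕ} (f : SemialgFun n) : langLstar.Functions n := .inl (.inl (.inr f))

/-- The symbol `I`. -/
abbrev symI : langLstar.Relations 1 := .inl (.inr UnarySymbol.sym)

/-- The symbol `∫`. -/
abbrev symInt : langLstar.Functions 1 := .inr UnarySymbol.sym

variable {A : Type*} [langLstar.Structure A]

/-- The interpretation of `∂` in a structure. -/
def opD (x : A) : A := Structure.funMap symD ![x]

/-- The interpretation of `∫` in a structure. -/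
def opInt (x : A) : A := Structure.funMap symInt ![x]

/-- The interpretation of `≼` in a structure. -/
def relDom (x y : A) : Prop := Structure.RelMap symDom ![x, y]

/-- The interpretation of `I` in a structure. -/
def relI (x : A) : Prop := Structure.RelMap symI ![x]

variable {α : Type} {n : ℕ}

/-- Terms of the language of rings as terms of `ℒ*`. -/
def ringT (t : Language.ring.Term α) : langLstar.Term α := inclOR.onTerm (inclRing.onTerm t)

/-- The term `∂ t`. -/
def derT (t : langLstar.Term α) : langLstar.Term α := symD.apply₁ t

/-- The term `∫ t`. -/
def intT (t : langLstar.Term α) : langLstar.Term α := symInt.apply₁ t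

/-- The term `s + t`. -/
def addT (s t : langLstar.Term α) : langLstar.Term α :=
  Functions.apply₂ (inclOR.onFunction (inclRing.onFunction addFunc)) s t

/-- The term `s t`. -/
def mulT (s t : langLstar.Term α) : langLstar.Term α :=
  Functions.apply₂ (inclOR.onFunction (inclRing.onFunction mulFunc)) s t

/-- The formula `s ≤ t`. -/
def leF (s t : langLstar.Term (α ⊕ Fin n)) : langLstar.BoundedFormula α n :=
  (inclOR.onRelation leSymb).boundedFormula₂ s t

/-- The formula `s ≼ t`. -/
def domF (s t : langLstar.Term (α ⊕ Fin n)) : langLstar.BoundedFormula α n :=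
  symDom.boundedFormula₂ s t

/-- The formula `I(t)`. -/
def iF (t : langLstar.Term (α ⊕ Fin n)) : langLstar.BoundedFormula α n :=
  symI.boundedFormula₁ t

theorem realize_derT (t : langLstar.Term α) (v : α → A) :
    (derT t).realize v = opD (t.realize v) := Term.realize_functions_apply₁

theorem realize_intT (t : langLstar.Term α) (v : α → A) :
    (intT t).realize v = opInt (t.realize v) := Term.realize_functions_apply₁

theorem realize_domF (s t : langLstar.Term (α ⊕ Fin n)) (v : α → A) (x : Fin n → A) :
    (domF s t).Realize v x ↔ relDom (s.realize (Sum.elim v x)) (t.realize (Sum.elim v x)) :=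
  BoundedFormula.realize_rel₂

theorem realize_iF (t : langLstar.Term (α ⊕ Fin n)) (v : α → A) (x : Fin n → A) :
    (iF t).Realize v x ↔ relI (t.realize (Sum.elim v x)) :=
  BoundedFormula.realize_rel₁

variable [Field A] [LinearOrder A] [inclOR.IsExpansionOn A]

theorem realize_ringT (t : Language.ring.Term α) (v : α → A) :
    (ringT t).realize v = letI := compatibleRingOfRing A; t.realize v := by
  let := compatibleRingOfRing A
  have := isExpansionOn_inclRing A
  rw [ringT, LHom.realize_onTerm, LHom.realize_onTerm]

theorem realize_addT (s t : langLstar.Term α) (v : α → A) :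
    (addT s t).realize v = s.realize v + t.realize v := by
  rw [addT, Term.realize_functions_apply₂, LHom.map_onFunction]
  let := compatibleRingOfRing A
  exact CompatibleRing.funMap_add _

theorem realize_mulT (s t : langLstar.Term α) (v : α → A) :
    (mulT s t).realize v = s.realize v * t.realize v := by
  rw [mulT, Term.realize_functions_apply₂, LHom.map_onFunction]
  let := compatibleRingOfRing A
  exact CompatibleRing.funMap_mul _

theorem realize_leF (s t : langLstar.Term (α ⊕ Fin n)) (v : α → A) (x : Fin n → A) :
    (leF s t).Realize v x ↔ s.realize (Sum.elim v x) ≤ t.realize (Sum.elim v x) := by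
  rw [leF, BoundedFormula.realize_rel₂, LHom.map_onRelation]
  exact relMap_leSymb _

end Symbols

section Axioms

open Term

/-- `∂ (x + y) = ∂ x + ∂ y`. -/
def axiomDerAdd : langLstar.Formula (Fin 2) :=
  (derT (ringT (var (.inl 0) + var (.inl 1)))).bdEqual
    (addT (derT (var (.inl 0))) (derT (var (.inl 1))))

/-- `∂ (x y) = x ∂ y + y ∂ x`. -/
def axiomDerMul : langLstar.Formula (Fin 2) :=
  (derT (ringT (var (.inl 0) * var (.inl 1)))).bdEqual
    (addT (mulT (var (.inl 0)) (derT (var (.inl 1)))) (mulT (var (.inl 1)) (derT (var (.inl 0)))))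

/-- `x ≼ y` if and only if `x² ≤ (c y)²` for some constant `c > 0`. -/
def axiomDom : langLstar.Formula (Fin 2) :=
  (domF (var (.inl 0)) (var (.inl 1))).iff
    (∃' ((derT (&0)).bdEqual (ringT 0) ⊓ ((leF (&0) (ringT 0)).not ⊓
      leF (ringT (var (.inl 0) * var (.inl 0)))
        (ringT ((&0 * var (.inl 1)) * (&0 * var (.inl 1)))))))

/-- `I(x)` if and only if `x ≼ ∂ f` for some infinitesimal `f`. -/
def axiomI : langLstar.Formula (Fin 1) :=
  (iF (var (.inl 0))).iff
    (∃' ((domF (ringT 1) (&0)).not ⊓ domF (var (.inl 0)) (derT (&0))))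

/-- `x ≼ 1` if and only if `x` is the sum of a constant and an infinitesimal. -/
def axiomBigO : langLstar.Formula (Fin 1) :=
  (domF (var (.inl 0)) (ringT 1)).iff
    (∃' ∃' ((derT (&0)).bdEqual (ringT 0) ⊓ ((domF (ringT 1) (&1)).not ⊓
      (var (.inl 0)).bdEqual (addT (&0) (&1)))))

/-- `∂ x > 0` for infinite `x > 0`. -/
def axiomDerPos : langLstar.Formula (Fin 1) :=
  (leF (var (.inl 0)) (ringT 0)).not ⟹ (domF (var (.inl 0)) (ringT 1)).not ⟹
    (leF (derT (var (.inl 0))) (ringT 0)).not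

/-- The elements of `I` are derivatives of infinitesimals. -/
def axiomSmallInt : langLstar.Formula (Fin 1) :=
  iF (var (.inl 0)) ⟹ ∃' ((domF (ringT 1) (&0)).not ⊓ (derT (&0)).bdEqual (var (.inl 0)))

/-- `∫ ∂ x = x` for infinitesimal `x`. -/
def axiomIntDer : langLstar.Formula (Fin 1) :=
  (domF (ringT 1) (var (.inl 0))).not ⟹ (intT (derT (var (.inl 0)))).bdEqual (var (.inl 0))

/-- `∫ x = 0` for `x` not in `I`. -/
def axiomIntZero : langLstar.Formula (Fin 1) :=
  (iF (var (.inl 0))).not ⟹ (intT (var (.inl 0))).bdEqual (ringT 0)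

/-- The formula for the graph of `f` holds for the values of the function symbol for `f`. -/
def axiomSemialg {n : ℕ} (f : SemialgFun n) : langLstar.Formula (Fin n) :=
  BoundedFormula.subst (inclOR.onFormula f.graph)
    (Fin.snoc (α := fun _ => langLstar.Term (Fin n)) var (func (symFun f) var))

section Realize

variable {A : Type*} [langLstar.Structure A] [Field A] [LinearOrder A] [inclOR.IsExpansionOn A]

theorem realize_axiomDerAdd (x : Fin 2 → A) :
    axiomDerAdd.Realize x ↔ opD (x 0 + x 1) = opD (x 0) + opD (x 1) := by
  let := compatibleRingOfRing A
  simp [axiomDerAdd, Formula.Realize, realize_derT, realize_ringT, realize_addT]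

theorem realize_axiomDerMul (x : Fin 2 → A) :
    axiomDerMul.Realize x ↔ opD (x 0 * x 1) = x 0 * opD (x 1) + x 1 * opD (x 0) := by
  let := compatibleRingOfRing A
  simp [axiomDerMul, Formula.Realize, realize_derT, realize_ringT, realize_addT, realize_mulT]

theorem realize_axiomDom (x : Fin 2 → A) : axiomDom.Realize x ↔ (relDom (x 0) (x 1) ↔
    ∃ c : A, opD c = 0 ∧ 0 < c ∧ x 0 * x 0 ≤ (c * x 1) * (c * x 1)) := by
  let := compatibleRingOfRing A
  simp [axiomDom, Formula.Realize, realize_domF, realize_derT, realize_ringT, realize_leF, Fin.snoc]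

theorem realize_axiomI (x : Fin 1 → A) : axiomI.Realize x ↔ (relI (x 0) ↔
    ∃ f : A, ¬ relDom 1 f ∧ relDom (x 0) (opD f)) := by
  let := compatibleRingOfRing A
  simp [axiomI, Formula.Realize, realize_domF, realize_iF, realize_derT, realize_ringT, Fin.snoc]

theorem realize_axiomBigO (x : Fin 1 → A) : axiomBigO.Realize x ↔ (relDom (x 0) 1 ↔
    ∃ c e : A, opD c = 0 ∧ ¬ relDom 1 e ∧ x 0 = c + e) := by
  let := compatibleRingOfRing A
  simp [axiomBigO, Formula.Realize, realize_domF, realize_derT, realize_ringT, realize_addT,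
    Fin.snoc]

theorem realize_axiomDerPos (x : Fin 1 → A) : axiomDerPos.Realize x ↔
    (0 < x 0 → ¬ relDom (x 0) 1 → 0 < opD (x 0)) := by
  let := compatibleRingOfRing A
  simp [axiomDerPos, Formula.Realize, realize_domF, realize_derT, realize_ringT, realize_leF]

theorem realize_axiomSmallInt (x : Fin 1 → A) : axiomSmallInt.Realize x ↔
    (relI (x 0) → ∃ a : A, ¬ relDom 1 a ∧ opD a = x 0) := by
  let := compatibleRingOfRing A
  simp [axiomSmallInt, Formula.Realize, realize_domF, realize_iF, realize_derT, realize_ringT,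
    Fin.snoc]

theorem realize_axiomIntDer (x : Fin 1 → A) : axiomIntDer.Realize x ↔
    (¬ relDom 1 (x 0) → opInt (opD (x 0)) = x 0) := by
  let := compatibleRingOfRing A
  simp [axiomIntDer, Formula.Realize, realize_domF, realize_intT, realize_derT, realize_ringT]

theorem realize_axiomIntZero (x : Fin 1 → A) : axiomIntZero.Realize x ↔
    (¬ relI (x 0) → opInt (x 0) = 0) := by
  let := compatibleRingOfRing A
  simp [axiomIntZero, Formula.Realize, realize_iF, realize_intT, realize_ringT]

theorem realize_axiomSemialg {n : ℕ} (f : SemialgFun n) (x : Fin n → A) :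
    (axiomSemialg f).Realize x ↔
      f.graph.Realize (Fin.snoc x (Structure.funMap (symFun f) x) : Fin (n + 1) → A) := by
  rw [axiomSemialg, Formula.Realize, BoundedFormula.realize_subst, ← Formula.Realize,
    LHom.realize_onFormula]
  refine iff_of_eq (congrArg f.graph.Realize ?_)
  ext k
  refine Fin.lastCases ?_ (fun k => ?_) k
  · simp
  · simp

end Realize

section Natural

variable (K : Type*) [Field K] [LinearOrder K] [Differential K]

instance isExpansionOn_inclOR : inclOR.IsExpansionOn K := ⟨fun _ _ => rfl, fun _ _ => rfl⟩

variable {K}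

theorem opD_eq (x : K) : opD x = x′ := rfl

theorem opInt_eq (x : K) : opInt x = smallInt x := rfl

theorem relDom_iff (x y : K) : relDom x y ↔ Dominated x y := Iff.rfl

theorem relI_iff (x : K) : relI x ↔ x ∈ setI K := Iff.rfl

end Natural

/-- `theoryTstar` contains every sentence valid in the intended structures in `Type`, in particular
the universal closure of `φ`. So `φ` holds in models of any universe. -/
theorem realize_of_forall {n : ℕ} (φ : langLstar.Formula (Fin n))
    (h : ∀ (K : Type) [Field K] [LinearOrder K] [IsStrictOrderedRing K] [Differential K],
      IsRealClosed K → IsHField K → AdmitsSmallIntegration K → ∀ x : Fin n → K, φ.Realize x)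
    (A : Type*) [langLstar.Structure A] [A ⊨ theoryTstar] (x : Fin n → A) : φ.Realize x := by
  have hmem : (bindVars φ).alls ∈ theoryTstar := by
    intro K _ _ _ _ h1 h2 h3
    exact BoundedFormula.realize_alls.2 fun x => (realize_bindVars φ _ _).2 (h K h1 h2 h3 x)
  have h4 := Theory.realize_sentence_of_mem (M := A) theoryTstar hmem
  exact (realize_bindVars φ _ _).1 (BoundedFormula.realize_alls.1 h4 x)

theorem dominated_iff_mul_self {K : Type*} [Field K] [LinearOrder K] [IsStrictOrderedRing K]
    [Differential K] {x y : K} : Dominated x y ↔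
      ∃ c : K, c′ = 0 ∧ 0 < c ∧ x * x ≤ (c * y) * (c * y) := by
  refine exists_congr fun c => and_congr_right fun _ => and_congr_right fun hc => ?_
  rw [← abs_le_iff_mul_self_le, abs_mul, abs_of_pos hc]

theorem not_dominated_one_iff {K : Type*} [Field K] [LinearOrder K] [IsStrictOrderedRing K]
    [Differential K] {x : K} : ¬ Dominated 1 x ↔ val K x < 1 := by
  rw [dominated_iff, map_one, not_le]

theorem dominated_one_iff {K : Type*} [Field K] [LinearOrder K] [IsStrictOrderedRing K]
    [Differential K] {x : K} : Dominated x 1 ↔ val K x ≤ 1 := by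
  rw [dominated_iff, map_one]

theorem exists_isExpansionOn_inclOR (A : Type*) [S : langLstar.Structure A] [A ⊨ theoryTstar] :
    ∃ (_ : Field A) (_ : LinearOrder A) (_ : IsStrictOrderedRing A),
      IsRealClosed A ∧ inclOR.IsExpansionOn A := by
  let SOR : langOR.Structure A := inclOR.reduct A
  have hexp : inclOR.IsExpansionOn A := LHom.isExpansionOn_reduct inclOR A
  have : A ⊨ theoryRCF := ⟨fun σ hσ => by
    have hmem : inclOR.onSentence σ ∈ theoryTstar := by
      intro K _ _ _ _ h1 _ _
      rw [LHom.realize_onSentence]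
      exact Theory.realize_sentence_of_mem theoryRCF hσ
    have := Theory.realize_sentence_of_mem (M := A) theoryTstar hmem
    rwa [LHom.realize_onSentence] at this⟩
  obtain ⟨i1, i2, i3, hRC, hOR⟩ := exists_realClosed_of_models A
  exact ⟨i1, i2, i3, hRC, hOR ▸ hexp⟩

/-- The models of `T*` are the real closed H-fields that admit small integration. -/
theorem exists_isHField_of_models (A : Type*) [S : langLstar.Structure A] [A ⊨ theoryTstar] :
    ∃ (_ : Field A) (_ : LinearOrder A) (_ : IsStrictOrderedRing A) (_ : Differential A),
      IsRealClosed A ∧ IsHField A ∧ AdmitsSmallIntegration A ∧ S = structureLstar A := by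
  obtain ⟨_, _, _, hRC, hexp⟩ := exists_isExpansionOn_inclOR A
  have hadd : ∀ x y : A, opD (x + y) = opD x + opD y := fun x y =>
    (realize_axiomDerAdd ![x, y]).1 (realize_of_forall axiomDerAdd
      (fun K _ _ _ _ _ _ _ x => (realize_axiomDerAdd x).2 (map_add (Differential.deriv (R := K)) _ _)) A _)
  have hmul : ∀ x y : A, opD (x * y) = x * opD y + y * opD x := fun x y =>
    (realize_axiomDerMul ![x, y]).1 (realize_of_forall axiomDerMul
      (fun K _ _ _ _ _ _ _ x => (realize_axiomDerMul x).2 (Derivation.leibniz _ _ _)) A _)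
  let iD : Differential A := ⟨Derivation.mk' (AddMonoidHom.mk' opD hadd).toIntLinearMap hmul⟩
  have hD : ∀ x : A, opD x = x′ := fun x => rfl
  have hdom : ∀ x y : A, relDom x y ↔ Dominated x y := fun x y => by
    rw [dominated_iff_mul_self]
    exact (realize_axiomDom ![x, y]).1 (realize_of_forall axiomDom
      (fun K _ _ _ _ _ _ _ x => (realize_axiomDom x).2 dominated_iff_mul_self) A _)
  have hI : ∀ x : A, relI x ↔ x ∈ setI A := fun x => by
    rw [mem_setI_iff]
    have := (realize_axiomI ![x]).1 (realize_of_forall axiomI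
      (fun K _ _ _ _ _ _ _ x => (realize_axiomI x).2 (by
        simp only [relI_iff, relDom_iff, dominated_iff, opD_eq, map_one, not_le]
        exact mem_setI_iff)) A _)
    simp only [hdom, dominated_iff, hD, map_one, not_le] at this
    exact this
  have hK : IsHField A := by
    refine ⟨fun x => ?_, fun x hx => ?_⟩
    · rw [← val_le_one_iff, ← dominated_one_iff, ← hdom]
      have := (realize_axiomBigO ![x]).1 (realize_of_forall axiomBigO
        (fun K _ _ _ _ _ hK _ x => (realize_axiomBigO x).2 (by
          simp only [relDom_iff, not_dominated_one_iff, dominated_one_iff, opD_eq]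
          rw [val_le_one_iff, hK.mem_bigO_iff]
          simp only [mem_smallO_iff]
          constructor
          · rintro ⟨c, hc, e, he, h⟩
            exact ⟨c, e, hc, he, h⟩
          · rintro ⟨c, e, hc, he, h⟩
            exact ⟨c, hc, e, he, h⟩)) A _)
      refine this.trans ?_
      simp only [hdom, not_dominated_one_iff, hD, mem_smallO_iff]
      constructor
      · rintro ⟨c, e, hc, he, h⟩
        exact ⟨c, hc, e, he, h⟩
      · rintro ⟨c, hc, e, he, h⟩
        exact ⟨c, e, hc, he, h⟩
    · have := (realize_axiomDerPos ![x]).1 (realize_of_forall axiomDerPos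
        (fun K _ _ _ _ _ hK _ x => (realize_axiomDerPos x).2 (by
          simp only [relDom_iff, dominated_one_iff, opD_eq, not_le]
          exact hK.deriv_pos_of_val)) A _)
      simp only [hdom, dominated_one_iff, hD, val_le_one_iff] at this
      have h0 : 0 < x := hx 0 zero_mem_constants
      refine this h0 ?_
      rintro ⟨c, hc, -, hxc⟩
      exact (hx c hc).not_ge ((le_abs_self x).trans hxc)
  have hsm : AdmitsSmallIntegration A := by
    ext y
    constructor
    · rintro ⟨a, ha, rfl⟩
      exact deriv_mem_setI (mem_smallO_iff.1 ha)
    · intro hy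
      have := (realize_axiomSmallInt ![y]).1 (realize_of_forall axiomSmallInt
        (fun K _ _ _ _ _ hK hsm x => (realize_axiomSmallInt x).2 (by
          simp only [relDom_iff, relI_iff, not_dominated_one_iff, opD_eq]
          exact fun h => ⟨_, hK.exists_smallInt hsm h⟩)) A _)
      simp only [hdom, hI, hD, not_dominated_one_iff, ← mem_smallO_iff] at this
      exact this hy
  have hint : ∀ x : A, opInt x = smallInt x := by
    intro x
    by_cases hx : x ∈ setI A
    · obtain ⟨h1, h2⟩ := hK.exists_smallInt hsm hx
      have := (realize_axiomIntDer ![smallInt x]).1 (realize_of_forall axiomIntDer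
        (fun K _ _ _ _ _ hK hsm x => (realize_axiomIntDer x).2 (by
          simp only [relDom_iff, not_dominated_one_iff, opD_eq, opInt_eq]
          exact hK.smallInt_deriv)) A _)
      simp only [hdom, hD, not_dominated_one_iff] at this
      have h3 := this h1
      change opInt ((smallInt x)′) = smallInt x at h3
      rwa [h2] at h3
    · have := (realize_axiomIntZero ![x]).1 (realize_of_forall axiomIntZero
        (fun K _ _ _ _ _ hK hsm x => (realize_axiomIntZero x).2 (by
          simp only [relI_iff, opInt_eq]
          exact smallInt_eq_zero)) A _)
      simp only [hI] at this
      rw [smallInt_eq_zero hx]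
      exact this hx
  have hsem : ∀ {n : ℕ} (f : SemialgFun n) (x : Fin n → A),
      Structure.funMap (symFun f) x = f.interp A x := fun f x => by
    have := (realize_axiomSemialg f x).1 (realize_of_forall (axiomSemialg f)
      (fun K _ _ _ _ _ hK hsm x => (realize_axiomSemialg f x).2
        ((SemialgFun.realize_graph f _ _).2 rfl)) A _)
    exact (SemialgFun.realize_graph f _ _).1 this
  have hx1 : ∀ x : Fin 1 → A, x = ![x 0] := fun x => by ext k; fin_cases k; rfl
  have hx2 : ∀ x : Fin 2 → A, x = ![x 0, x 1] := fun x => by ext k; fin_cases k <;> rfl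
  refine ⟨_, _, ‹_›, iD, hRC, hK, hsm, ?_⟩
  ext n f x
  · rcases f with (((f | f) | f) | f) | f
    · exact hexp.map_onFunction f x
    · cases f
      rw [hx1 x]
      rfl
    · exact hsem f x
    · exact nomatch f
    · cases f
      rw [hx1 x]
      exact hint (x 0)
  · rcases f with (((r | r) | r) | r) | r
    · exact iff_of_eq (hexp.map_onRelation r x)
    · cases r
      rw [hx2 x]
      exact hdom (x 0) (x 1)
    · exact nomatch r
    · cases r
      rw [hx1 x]
      exact hI (x 0)
    · exact nomatch r

end Axioms

end HFields

end

/-! ## Closures -/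

noncomputable section

open FirstOrder FirstOrder.Language
open scoped Differential
open Polynomial

namespace HFields

/-! ### Graphs of isomorphisms between substructures. -/

section IsoGraph

universe u₁ v₁ w₁ w₂

variable {L : FirstOrder.Language.{u₁, v₁}} {A : Type w₁} {B : Type w₂} [L.Structure A]
  [L.Structure B]

/-- `G` is the graph of an isomorphism between substructures of `A` and `B`. -/
structure IsIsoGraph (L : FirstOrder.Language.{u₁, v₁}) {A : Type w₁} {B : Type w₂}
    [L.Structure A] [L.Structure B] (G : Set (A × B)) : Prop where
  funMap_mem : ∀ {n : ℕ} (f : L.Functions n) (x : Fin n → A × B), (∀ k, x k ∈ G) →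
    (Structure.funMap f fun k => (x k).1, Structure.funMap f fun k => (x k).2) ∈ G
  relMap_iff : ∀ {n : ℕ} (r : L.Relations n) (x : Fin n → A × B), (∀ k, x k ∈ G) →
    (Structure.RelMap r (fun k => (x k).1) ↔ Structure.RelMap r fun k => (x k).2)
  eq_iff : ∀ p ∈ G, ∀ q ∈ G, p.1 = q.1 ↔ p.2 = q.2

namespace IsIsoGraph

variable {G : Set (A × B)} (hG : IsIsoGraph L G)
include hG

theorem realize_mem {α : Type*} (t : L.Term α) (x : α → A × B) (hx : ∀ k, x k ∈ G) :
    (t.realize (fun k => (x k).1), t.realize fun k => (x k).2) ∈ G := by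
  induction t with
  | var k => exact hx k
  | func f ts ih => exact hG.funMap_mem f (fun k => ((ts k).realize fun k => (x k).1,
      (ts k).realize fun k => (x k).2)) ih

theorem realize_iff {α : Type*} {φ : L.Formula α} (hφ : φ.IsQF) (x : α → A × B)
    (hx : ∀ k, x k ∈ G) : φ.Realize (fun k => (x k).1) ↔ φ.Realize fun k => (x k).2 := by
  have hmem : ∀ t : L.Term (α ⊕ Fin 0), (t.realize (Sum.elim (fun k => (x k).1) default),
      t.realize (Sum.elim (fun k => (x k).2) default)) ∈ G := by
    intro t
    have h1 : Sum.elim (fun k => (x k).1) (default : Fin 0 → A) =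
        fun k => (Sum.elim x (default : Fin 0 → A × B) k).1 := by
      ext (k | k)
      · rfl
      · exact k.elim0
    have h2 : Sum.elim (fun k => (x k).2) (default : Fin 0 → B) =
        fun k => (Sum.elim x (default : Fin 0 → A × B) k).2 := by
      ext (k | k)
      · rfl
      · exact k.elim0
    rw [h1, h2]
    exact hG.realize_mem t _ fun k => k.rec hx fun k => k.elim0
  induction hφ with
  | falsum => exact Iff.rfl
  | of_isAtomic h =>
    cases h with
    | equal t₁ t₂ => exact hG.eq_iff _ (hmem t₁) _ (hmem t₂)
    | rel r ts => exact hG.relMap_iff r _ fun k => hmem (ts k)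
  | imp _ _ h1 h2 => exact imp_congr h1 h2

/-- Induction over each generated substructure finds partners inside the other one; `eq_iff` makes
them unique. -/
theorem exists_equiv {C : Type*} {i : C → A} {j : C → B} (hij : ∀ c, (i c, j c) ∈ G) :
    ∃ e : Substructure.closure L (Set.range i) ≃[L] Substructure.closure L (Set.range j),
      ∀ c : C, e ⟨i c, Substructure.subset_closure (Set.mem_range_self c)⟩ =
        ⟨j c, Substructure.subset_closure (Set.mem_range_self c)⟩ := by
  have h1 : ∀ a : Substructure.closure L (Set.range i),
      ∃ b : Substructure.closure L (Set.range j), ((a : A), (b : B)) ∈ G := by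
    rintro ⟨a, ha⟩
    refine Substructure.closure_induction
      (p := fun a => ∃ b : Substructure.closure L (Set.range j), (a, (b : B)) ∈ G) ha ?_ ?_
    · rintro _ ⟨c, rfl⟩
      exact ⟨⟨j c, Substructure.subset_closure (Set.mem_range_self c)⟩, hij c⟩
    · intro n f x hx
      choose y hy using hx
      exact ⟨Structure.funMap f y, hG.funMap_mem f (fun k => (x k, (y k : B))) hy⟩
  have h2 : ∀ b : Substructure.closure L (Set.range j),
      ∃ a : Substructure.closure L (Set.range i), ((a : A), (b : B)) ∈ G := by
    rintro ⟨b, hb⟩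
    refine Substructure.closure_induction
      (p := fun b => ∃ a : Substructure.closure L (Set.range i), ((a : A), b) ∈ G) hb ?_ ?_
    · rintro _ ⟨c, rfl⟩
      exact ⟨⟨i c, Substructure.subset_closure (Set.mem_range_self c)⟩, hij c⟩
    · intro n f x hx
      choose y hy using hx
      exact ⟨Structure.funMap f y, hG.funMap_mem f (fun k => ((y k : A), x k)) hy⟩
  choose e he using h1
  choose e' he' using h2
  have huniq : ∀ (a : Substructure.closure L (Set.range i))
      (b : Substructure.closure L (Set.range j)), ((a : A), (b : B)) ∈ G →
      e a = b := fun a b h => Subtype.ext ((hG.eq_iff _ (he a) _ h).1 rfl)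
  refine ⟨{
    toFun := e
    invFun := e'
    left_inv := fun a => ?_
    right_inv := fun b => ?_
    map_fun' := fun f x => ?_
    map_rel' := fun r x => ?_ }, fun c => huniq _ _ (hij c)⟩
  · exact Subtype.ext ((hG.eq_iff _ (he' (e a)) _ (he a)).2 rfl)
  · exact huniq _ _ (he' b)
  · exact huniq _ _ (hG.funMap_mem f (fun k => ((x k : A), (e (x k) : B))) fun k => he (x k))
  · exact (hG.relMap_iff r (fun k => ((x k : A), (e (x k) : B))) fun k => he (x k)).symm

end IsIsoGraph

end IsoGraph

open RealClosed FirstOrder.Ring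

/-! ### Maximal good graphs. -/

section Chains

variable {K K' : Type*} [Field K] [LinearOrder K] [IsStrictOrderedRing K] [Differential K]
  [Field K'] [LinearOrder K'] [IsStrictOrderedRing K'] [Differential K']

/-- The finitely many coefficients of a polynomial lie in a single member of the directed family. -/
theorem relClosed_comp_subtype_sSup {R F : Type*} [CommRing R] [CommRing F] (φ : R →+* F)
    {c : Set (Subring R)} (hne : c.Nonempty) (hc : DirectedOn (· ≤ ·) c)
    (h : ∀ S ∈ c, RelClosed (φ.comp S.subtype)) : RelClosed (φ.comp (sSup c).subtype) := by
  intro f hf x hx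
  let p := f.map (sSup c).subtype
  obtain ⟨S₀, hS₀⟩ := hne
  obtain ⟨S, hS, hpS⟩ := DirectedOn.exists_mem_subset_of_finset_subset_biUnion
    (f := fun S : Subring R => (S : Set R)) ⟨S₀, hS₀⟩ hc (s := p.coeffs) (by
      intro r hr
      obtain ⟨n, -, rfl⟩ := mem_coeffs_iff.1 hr
      rw [Set.mem_iUnion₂]
      obtain ⟨S, hS, h⟩ := (Subring.mem_sSup_of_directedOn ⟨S₀, hS₀⟩ hc).1 (f.coeff n).2
      exact ⟨S, hS, by rw [coeff_map]; exact h⟩)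
  have hp0 : p ≠ 0 := (Polynomial.map_ne_zero_iff Subtype.val_injective).2 hf
  have hmap : (p.toSubring S hpS).map S.subtype = p := p.map_toSubring S hpS
  obtain ⟨s, hs⟩ := h S hS (p.toSubring S hpS) (fun h0 => hp0 (by
    rw [← hmap, h0, Polynomial.map_zero])) x (by
      rw [← eval₂_map, hmap, eval₂_map]
      exact hx)
  exact ⟨⟨s, le_sSup hS s.2⟩, hs⟩

theorem IsGood.sSup_of_isChain {c : Set (Subring (K × K'))} (hne : c.Nonempty) (hc : IsChain (· ≤ ·) c)
    (h : ∀ G ∈ c, IsGood G) : IsGood (sSup c) := by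
  have hdir := hc.directedOn
  have hmem : ∀ p, p ∈ sSup c ↔ ∃ G ∈ c, p ∈ G := fun p =>
    Subring.mem_sSup_of_directedOn hne hdir
  refine ⟨fun p hp => ?_, fun p hp => ?_, fun p hp => ?_, fun p hp q hq => ?_, fun p hp => ?_,
    relClosed_comp_subtype_sSup _ hne hdir fun G hG => (h G hG).relClosed_fst,
    relClosed_comp_subtype_sSup _ hne hdir fun G hG => (h G hG).relClosed_snd⟩
  · obtain ⟨G, hG, hpG⟩ := (hmem p).1 hp
    exact (h G hG).ord p hpG
  · obtain ⟨G, hG, hpG⟩ := (hmem p).1 hp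
    exact (hmem _).2 ⟨G, hG, (h G hG).inv_mem p hpG⟩
  · obtain ⟨G, hG, hpG⟩ := (hmem p).1 hp
    exact (hmem _).2 ⟨G, hG, (h G hG).derivProd_mem p hpG⟩
  · obtain ⟨G, hG, hpG⟩ := (hmem p).1 hp
    obtain ⟨H, hH, hqH⟩ := (hmem q).1 hq
    obtain ⟨J, hJ, hGJ, hHJ⟩ := hdir G hG H hH
    exact (h J hJ).val p (hGJ hpG) q (hHJ hqH)
  · obtain ⟨G, hG, hpG⟩ := (hmem p).1 hp
    exact (h G hG).mem_setI_iff p hpG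

/-- A maximal good graph absorbs every pair of small integrals by `IsGood.exists_extension`. Outside
`I` both integrals take the default value zero, and the two sides agree on being outside `I`. -/
theorem IsGood.exists_smallInt_closed [IsRealClosed K] [IsRealClosed K'] (hK : IsHField K)
    (hI : AdmitsSmallIntegration K) (hK' : IsHField K') (hI' : AdmitsSmallIntegration K')
    {G₀ : Subring (K × K')} (hG₀ : IsGood G₀) :
    ∃ G, G₀ ≤ G ∧ IsGood G ∧ ∀ p ∈ G, (smallInt p.1, smallInt p.2) ∈ G := by
  obtain ⟨G, hle, hG, hmax⟩ := zorn_le_nonempty₀ {G | IsGood G} (fun c hc hchain H hH =>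
    ⟨sSup c, IsGood.sSup_of_isChain ⟨H, hH⟩ hchain fun G hG => hc hG, fun G hG => le_sSup hG⟩) G₀ hG₀
  refine ⟨G, hle, hG, fun p hp => ?_⟩
  by_cases h : p.1 ∈ setI K
  · obtain ⟨h1, h2⟩ := hK.exists_smallInt hI h
    obtain ⟨h3, h4⟩ := hK'.exists_smallInt hI' ((hG.mem_setI_iff p hp).1 h)
    obtain ⟨H, hGH, hH, hmem⟩ := hG.exists_extension hK hK' h1 h3 (by rw [h2, h4]; exact hp)
    exact hmax hH hGH hmem
  · rw [smallInt_eq_zero h, smallInt_eq_zero (mt (hG.mem_setI_iff p hp).2 h)]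
    exact zero_mem G

theorem IsGood.interp_mem [IsRealClosed K] [IsRealClosed K'] {G : Subring (K × K')}
    (hG : IsGood G) {n : ℕ} (f : SemialgFun n) (x : Fin n → K × K') (hx : ∀ k, x k ∈ G) :
    (f.interp K fun k => (x k).1, f.interp K' fun k => (x k).2) ∈ G := by
  obtain ⟨E, _, _, _, i, j, hE, _, hmem, -⟩ := hG.exists_isCommonSubfield
  choose e he using fun k => (hmem (x k)).1 (hx k)
  refine (hmem _).2 ⟨f.interp E e, ?_⟩
  rw [f.map_interp hE.mono_fst, f.map_interp hE.mono_snd]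
  simp only [he]
  rfl

theorem IsGood.isIsoGraph [IsRealClosed K] [IsRealClosed K'] {G : Subring (K × K')}
    (hG : IsGood G) (hint : ∀ p ∈ G, (smallInt p.1, smallInt p.2) ∈ G) :
    IsIsoGraph langLstar (G : Set (K × K')) where
  funMap_mem := by
    intro n f x hx
    rcases f with ((((f | f) | f) | f) | f) | f
    · cases f
      · exact add_mem (hx 0) (hx 1)
      · exact mul_mem (hx 0) (hx 1)
      · exact neg_mem (hx 0)
      · exact zero_mem G
      · exact one_mem G
    · exact nomatch f
    · cases f
      exact hG.derivProd_mem _ (hx 0)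
    · exact hG.interp_mem f x hx
    · exact nomatch f
    · cases f
      exact hint _ (hx 0)
  relMap_iff := by
    intro n r x hx
    rcases r with ((((r | r) | r) | r) | r) | r
    · exact nomatch r
    · cases r
      exact hG.ord.le_iff (hx 0) (hx 1)
    · cases r
      exact dominated_iff.trans ((hG.val _ (hx 0) _ (hx 1)).trans dominated_iff.symm)
    · exact nomatch r
    · cases r
      exact hG.mem_setI_iff _ (hx 0)
    · exact nomatch r
  eq_iff := fun p hp q hq => hG.ord.eq_iff hp hq

end Chains

/-! ### From partial `ℒ′_I`-maps to good graphs. -/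

section Range

theorem relClosed_comp_of_injective {R F : Type*} [CommRing R] [CommRing F] {φ : R →+* F}
    (hφ : Function.Injective φ) (h : RelClosed φ.range.subtype) : RelClosed φ := by
  intro f hf x hx
  have hψ : Function.Injective φ.rangeRestrict := fun a b h => hφ (congrArg Subtype.val h)
  obtain ⟨s, rfl⟩ := h (f.map φ.rangeRestrict) ((Polynomial.map_ne_zero_iff hψ).2 hf) x (by
    rw [eval₂_map]
    exact hx)
  exact s.2

universe w

variable {K K' : Type w} [Field K] [LinearOrder K] [IsStrictOrderedRing K] [Differential K]
  [Field K'] [LinearOrder K'] [IsStrictOrderedRing K'] [Differential K']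
  [IsRealClosed K] [IsRealClosed K']

/-- `C` is only an index type without structure, so this serves both a common substructure and the
family of all terms evaluated at two tuples. Preservation of equality comes from preservation of
`≤`. -/
theorem exists_isGood_range {C : Type*} {i : C → K} {j : C → K'}
    (hfun : ∀ {n : ℕ} (f : langLprimeI.Functions n) (x : Fin n → C), ∃ c,
      i c = Structure.funMap (inclLprimeI.onFunction f) (fun k => i (x k)) ∧
      j c = Structure.funMap (inclLprimeI.onFunction f) (fun k => j (x k)))
    (hrel : ∀ {n : ℕ} (r : langLprimeI.Relations n) (x : Fin n → C),
      Structure.RelMap (inclLprimeI.onRelation r) (fun k => i (x k)) ↔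
      Structure.RelMap (inclLprimeI.onRelation r) (fun k => j (x k))) :
    ∃ G : Subring (K × K'), IsGood G ∧ ∀ c, (i c, j c) ∈ G := by
  let g : C → K × K' := fun c => (i c, j c)
  have hD : ∀ a, ∃ c, g c = derivProd (g a) := fun a => by
    obtain ⟨c, h1, h2⟩ := hfun (.inl (.inl (.inr UnarySymbol.sym))) ![a]
    exact ⟨c, Prod.ext h1 h2⟩
  have hsem : ∀ {n : ℕ} (f : SemialgFun n) (x : Fin n → C), ∃ c,
      i c = f.interp K (fun k => i (x k)) ∧ j c = f.interp K' (fun k => j (x k)) := fun f x =>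
    hfun (.inl (.inr f)) x
  let G : Subring (K × K') :=
    { carrier := Set.range g
      mul_mem' := by
        rintro _ _ ⟨a, rfl⟩ ⟨b, rfl⟩
        obtain ⟨c, h1, h2⟩ := hfun (.inl (.inl (.inl (.inl mulFunc)))) ![a, b]
        exact ⟨c, Prod.ext h1 h2⟩
      one_mem' := by
        obtain ⟨c, h1, h2⟩ := hfun (.inl (.inl (.inl (.inl oneFunc)))) ![]
        exact ⟨c, Prod.ext h1 h2⟩
      add_mem' := by
        rintro _ _ ⟨a, rfl⟩ ⟨b, rfl⟩
        obtain ⟨c, h1, h2⟩ := hfun (.inl (.inl (.inl (.inl addFunc)))) ![a, b]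
        exact ⟨c, Prod.ext h1 h2⟩
      zero_mem' := by
        obtain ⟨c, h1, h2⟩ := hfun (.inl (.inl (.inl (.inl zeroFunc)))) ![]
        exact ⟨c, Prod.ext h1 h2⟩
      neg_mem' := by
        rintro _ ⟨a, rfl⟩
        obtain ⟨c, h1, h2⟩ := hfun (.inl (.inl (.inl (.inl negFunc)))) ![a]
        exact ⟨c, Prod.ext h1 h2⟩ }
  have hord : OrdGraph G := by
    intro p hp
    obtain ⟨a, ha⟩ := zero_mem G
    obtain ⟨b, rfl⟩ := hp
    have h := hrel (.inl (.inl (.inl leSymb))) ![a, b]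
    change i a ≤ i b ↔ j a ≤ j b at h
    rwa [show i a = 0 from congrArg Prod.fst ha, show j a = 0 from congrArg Prod.snd ha] at h
  refine ⟨G, ⟨hord, ?_, ?_, ?_, ?_, ?_, ?_⟩, fun c => ⟨c, rfl⟩⟩
  · rintro _ ⟨a, rfl⟩
    obtain ⟨f, hf⟩ := exists_semialgFun_inv.{w}
    obtain ⟨c, h1, h2⟩ := hsem f ![a]
    have e1 : (fun k => i (![a] k)) = ![i a] := by ext k; fin_cases k; rfl
    have e2 : (fun k => j (![a] k)) = ![j a] := by ext k; fin_cases k; rfl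
    rw [e1, hf] at h1
    rw [e2, hf] at h2
    exact ⟨c, Prod.ext h1 h2⟩
  · rintro _ ⟨a, rfl⟩
    exact hD a
  · rintro _ ⟨a, rfl⟩ _ ⟨b, rfl⟩
    have h := hrel (.inl (.inl (.inr BinarySymbol.sym))) ![a, b]
    change Dominated (i a) (i b) ↔ Dominated (j a) (j b) at h
    rwa [dominated_iff, dominated_iff] at h
  · rintro _ ⟨a, rfl⟩
    exact hrel (.inr UnarySymbol.sym) ![a]
  · refine relClosed_comp_of_injective hord.fst_injective (relClosed_of_semialg_closed ?_)
    intro n f x hx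
    choose p hp using hx
    choose c hc using fun k => (p k).2
    obtain ⟨d, h1, -⟩ := hsem f c
    refine ⟨⟨g d, d, rfl⟩, h1.trans (congrArg (f.interp K) ?_)⟩
    ext k
    rw [← hp k]
    exact congrArg Prod.fst (hc k)
  · refine relClosed_comp_of_injective hord.snd_injective (relClosed_of_semialg_closed ?_)
    intro n f x hx
    choose p hp using hx
    choose c hc using fun k => (p k).2
    obtain ⟨d, -, h2⟩ := hsem f c
    refine ⟨⟨g d, d, rfl⟩, h2.trans (congrArg (f.interp K') ?_)⟩
    ext k
    rw [← hp k]
    exact congrArg Prod.snd (hc k)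

end Range

/-- Partial maps between models of `T*` that respect `ℒ′_I` extend to isomorphisms of
`ℒ*`-substructures. -/
theorem exists_isIsoGraph.{w} {A B : Type w} [SA : langLstar.Structure A]
    [SB : langLstar.Structure B] [A ⊨ theoryTstar] [B ⊨ theoryTstar] {C : Type*} {i : C → A}
    {j : C → B}
    (hfun : ∀ {n : ℕ} (f : langLprimeI.Functions n) (x : Fin n → C), ∃ c,
      i c = Structure.funMap (inclLprimeI.onFunction f) (fun k => i (x k)) ∧
      j c = Structure.funMap (inclLprimeI.onFunction f) (fun k => j (x k)))
    (hrel : ∀ {n : ℕ} (r : langLprimeI.Relations n) (x : Fin n → C),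
      Structure.RelMap (inclLprimeI.onRelation r) (fun k => i (x k)) ↔
      Structure.RelMap (inclLprimeI.onRelation r) (fun k => j (x k))) :
    ∃ G : Set (A × B), IsIsoGraph langLstar G ∧ ∀ c, (i c, j c) ∈ G := by
  obtain ⟨_, _, _, _, _, hA, hIA, rfl⟩ := exists_isHField_of_models A
  obtain ⟨_, _, _, _, _, hB, hIB, rfl⟩ := exists_isHField_of_models B
  obtain ⟨G₀, hG₀, hmem⟩ := exists_isGood_range hfun hrel
  obtain ⟨G, hle, hG, hint⟩ := IsGood.exists_smallInt_closed hA hIA hB hIB hG₀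
  exact ⟨G, hG.isIsoGraph hint, fun c => hle (hmem c)⟩

theorem hasClosures_theoryTstar.{w} : HasClosures.{w} inclLprimeI theoryTstar := by
  intro A B C _ _ _ _ _ i j
  let : langLprimeI.Structure A := inclLprimeI.reduct A
  let : langLprimeI.Structure B := inclLprimeI.reduct B
  obtain ⟨G, hG, hmem⟩ := exists_isIsoGraph (i := i) (j := j)
    (fun f x => ⟨Structure.funMap f x, i.map_fun f x, j.map_fun f x⟩)
    (fun r x => (i.map_rel r x).trans (j.map_rel r x).symm)
  exact hG.exists_equiv hmem

theorem exists_isQF_iff_theoryTstar {α : Type} (φ : langLstar.Formula α) (hφ : φ.IsQF) :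
    ∃ ψ : langLprimeI.Formula α, ψ.IsQF ∧ theoryTstar.Iff φ (inclLprimeI.onFormula ψ) := by
  refine exists_isQF_iff inclLprimeI theoryTstar φ fun A B _ _ _ _ _ _ a b hab => ?_
  let : langLprimeI.Structure A := inclLprimeI.reduct A
  let : langLprimeI.Structure B := inclLprimeI.reduct B
  -- The terms index the `ℒ′_I`-substructures generated by `a` and `b`; equality of types says that
  -- the relations match.
  obtain ⟨G, hG, hmem⟩ := exists_isIsoGraph (C := langLprimeI.Term α)
    (i := fun t => t.realize a) (j := fun t => t.realize b)
    (fun f x => ⟨.func f x, rfl, rfl⟩) (fun r x => by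
      have h := hab (r.formula x) (BoundedFormula.IsAtomic.rel r _).isQF
      rw [LHom.realize_onFormula, LHom.realize_onFormula, Formula.realize_rel,
        Formula.realize_rel] at h
      exact h)
  exact (hG.realize_iff hφ (fun k => (a k, b k)) fun k => hmem (.var k)).1

end HFields

end

theorem mainTheorem12 :
    HFields.HasClosures.{u} HFields.inclLprimeI HFields.theoryTstar ∧
    ∀ (n : ℕ) (φ : HFields.langLstar.Formula (Fin n)), φ.IsQF →
      ∃ ψ : HFields.langLprimeI.Formula (Fin n), ψ.IsQF ∧
        HFields.theoryTstar.Iff φ (HFields.inclLprimeI.onFormula ψ) :=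
  ⟨HFields.hasClosures_theoryTstar, fun _ φ hφ => HFields.exists_isQF_iff_theoryTstar φ hφ⟩
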